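/- **Setting.** Let $D\subset\mathbb R^2$ be a bounded simply connected domain whose boundary $\Sigma$ is a simple closed curve with a regular counterclockwise parametrization of class $C^2([0,1])$ starting and ending at $P_0$; $\Sigma$ is of class $C^2$ except for a corner at $P_0$, with interior angle $(1-\chi)\pi$, $-1<\chi<1$, $\chi\neq0$. Let $\Sigma$ be split into three arcs $\Sigma_1,\Sigma_2,\Sigma_3$ with regular parametrizations $\sigma_i=(\xi_i,\eta_i)\in C^2([0,1])$, where $\sigma_1(0)=\sigma_2(0)=P_0$, $\sigma_2(1)=\sigma_3(0)$, $\sigma_1(1)=\sigma_3(1)$; $\sigma_2,\sigma_3$ run counterclockwise and $\sigma_1$ clockwise. Put $\epsilon_1=-1$, $\epsilon_2=\epsilon_3=1$, $$K^{i,j}(t,s)=\epsilon_j\,\frac{\eta_j'(t)[\xi_i(s)-\xi_j(t)]-\xi_j'(t)[\eta_i(s)-\eta_j(t)]}{[\xi_i(s)-\xi_j(t)]^2+[\eta_i(s)-\eta_j(t)]^2}\quad\text{if }\sigma_i(s)\ne\sigma_j(t),$$ $$K^{i,j}(t,s)=\frac{\epsilon_j}{2}\,\frac{\eta_j'(t)\xi_j''(t)-\xi_j'(t)\eta_j''(t)}{\xi_j'(t)^2+\eta_j'(t)^2}\quad\text{if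 }\sigma_i(s)=\sigma_j(t),$$ $$L(t,s)=-\frac{s\sin(\chi\pi)}{s^2+2ts\cos(\chi\pi)+t^2},\qquad L(0,0)=0,\qquad M^{i,j}=K^{i,j}-L,$$ and assume that the parametrizations are such that $M^{1,2}$ and $M^{2,1}$ are continuous on $[0,1]^2$. Let $\bar\Omega_1(s)=\bar\Omega_2(s)=\pi$ for $0<s\le1$, $\bar\Omega_1(0)=\bar\Omega_2(0)=(1-\chi)\pi$, $\bar\Omega_3\equiv\pi$. For $\rho=(\rho_1,\rho_2,\rho_3)$ in $$\mathcal X=\{(f_1,f_2,f_3)\in C([0,1])^3: f_1(0)=f_2(0)\},\qquad \|f\|_\infty=\max_i\|f_i\|_\infty,$$ let $(\mathcal L\rho_j)(s)=\int_0^1L(t,s)\rho_j(t)\,dt$ and $$(\mathcal K\rho)_i(s)=(-\pi+\bar\Omega_i(s))\rho_i(s)+\sum_{j=1}^3\int_0^1K^{i,j}(t,s)\rho_j(t)\,dt,$$ $$\mathcal W\rho=\big((-\pi+\bar\Omega_1)\rho_1+\mathcal L\rho_2,\ \mathcal L\rho_1+(-\pi+\bar\Omega_2)\rho_2,\ 0\big),\qquad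 \mathcal S=\mathcal K-\mathcal W.$$ *Discretization.* Let $x_0=0<x_1<\dots<x_m<x_{m+1}=1$, with $x_1,\dots,x_m$ the zeros of the $m$-th orthogonal polynomial on $[0,1]$ for the weight $v(x)=x(1-x)$, and let $\lambda_0=\lambda_{m+1}=\frac1{(m+1)(m+2)}$, $\lambda_k=\int_0^1\frac{l_k(x)v(x)}{v(x_k)}\,dx$ for $1\le k\le m$, where $l_k$ are the fundamental Lagrange polynomials on $x_1,\dots,x_m$ (Lobatto rule). Let $(\mathcal L_m\rho_j)(s)=\sum_{h=0}^{m+1}\lambda_hL(x_h,s)\rho_j(x_h)$, let $\mathcal W_m$ be $\mathcal W$ with $\mathcal L$ replaced by $\mathcal L_m$, and let $$(\mathcal S_m\rho)_i(s)=\sum_{j=1}^3\sum_{h=0}^{m+1}\lambda_h S^{i,j}(x_h,s)\rho_j(x_h),$$ where $S^{1,2}=M^{1,2}$, $S^{2,1}=M^{2,1}$ and $S^{i,j}=K^{i,j}$ otherwise. For fixed $c>0$ and $0<\epsilon<1$ put $s_m=c/m^{2-2\epsilon}$ and $$(\tilde{\mathcal W}_m\rho)(s)=\begin{cases}(\mathcal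 W_m\rho)(s),& s_m\le s\le1,\\ \frac1{s_m}\big[s\,(\mathcal W_m\rho)(s_m)+(s_m-s)(\mathcal W\rho)(0)\big],&0\le s<s_m.\end{cases}$$ Let $A_m$ be the $3(m+2)\times3(m+2)$ matrix of the linear system obtained by collocating $(-\pi\mathcal I+\tilde{\mathcal W}_m+\mathcal S_m)\bar\psi_m=\bar g$ at $x_0,\dots,x_{m+1}$, with unknowns $a_{j,h}=\bar\psi_{m,j}(x_h)$, and let $\tilde{\mathbb R}^{3(m+2)}$ be the space of the arrays $(c_{i,l})_{1\le i\le3,\,0\le l\le m+1}$ with $c_{1,0}=c_{2,0}$, with the norm $\|\cdot\|_\infty$. For an invertible bounded operator $T$ on a normed space, $\mathrm{cond}(T)=\|T\|\,\|T^{-1}\|$. **Theorem.** Assume that $\mathrm{Ker}(-\pi\mathcal I+\mathcal W+\mathcal S)=\{0\}$ in $\mathcal X$. Then there are $m_0\in\mathbb N$ and a constant $\mathcal C$, independent of $m$, such that for every $m\ge m_0$ the operator $-\pi\mathcal I+\tilde{\mathcal W}_m+\mathcal S_m:\mathcal X\to\mathcal X$ is well defined, bounded and boundedly invertible, $A_m$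 maps $\tilde{\mathbb R}^{3(m+2)}$ bijectively onto itself, and $$\mathrm{cond}(A_m)\le\mathrm{cond}(-\pi\mathcal I+\tilde{\mathcal W}_m+\mathcal S_m)\le\mathcal C .$$ -/

import Mathlib

open Set Filter Topology

noncomputable section

/-! ## The Lobatto quadrature rule on `[0,1]` -/

namespace Lobatto

/-- The Jacobi weight `v^{1,1}(x) = x (1 - x)`. -/
def weight (x : ℝ) : ℝ := x * (1 - x)

/-- `∫₀¹ p q v^{1,1}`. -/
def pairing (p q : Polynomial ℝ) : ℝ :=
  ∫ x in (0 : ℝ)..1, p.eval x * q.eval x * weight x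

/-- The (monic) orthogonal polynomials on `[0,1]` for the weight `v^{1,1}`, obtained from
`1, X, X², …` by the Gram-Schmidt process. -/
def orthPoly (m : ℕ) : Polynomial ℝ :=
  Polynomial.X ^ m - ∑ k : Fin m,
    Polynomial.C (pairing (Polynomial.X ^ m) (orthPoly k) / pairing (orthPoly k) (orthPoly k)) *
      orthPoly k
termination_by m
decreasing_by all_goals exact k.isLt

/-- The nodes `x₀ = 0`, `x₁ < … < x_m` the zeros of the `m`-th orthogonal polynomial in increasing
order, `x_{m+1} = 1`.  The `m`-th orthogonal polynomial has exactly `m` zeros, all simple and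
in `(0,1)`, so that the default value in `getD` is never used for `k ≤ m + 1`. -/
def node (m k : ℕ) : ℝ :=
  if k = 0 then 0
  else if k = m + 1 then 1
  else ((orthPoly m).roots.sort (· ≤ ·)).getD (k - 1) 0

/-- The coefficients `λ₀ = λ_{m+1} = 1 / ((m+1)(m+2))` and
`λ_k = ∫₀¹ l_k(x) v(x) / v(x_k) dx`, with `l_k` the fundamental Lagrange polynomials on
`x₁, …, x_m`. -/
def coeff (m k : ℕ) : ℝ :=
  if k = 0 ∨ k = m + 1 then 1 / (((m : ℝ) + 1) * ((m : ℝ) + 2))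
  else ∫ x in (0 : ℝ)..1,
    (Lagrange.basis (Finset.Icc 1 m) (node m) k).eval x * weight x / weight (node m k)

end Lobatto

/-! ## The domain, its boundary and the decomposition of the boundary -/

/-- A simply connected bounded plane domain `D` whose boundary is a simple closed curve with one
corner `P₀ = γ 0 = γ 1`, of class `C²` elsewhere (and up to the corner from both sides), described
counterclockwise by `γ` on `[0,1]`.  The plane is `ℂ`; only the values of `γ` and of its derivatives
on `[0,1]` matter (a `C²` function on `[0,1]` is the restriction of a `C²` function on `ℝ`). -/
structure CornerDomain where
  /-- the domain -/
  D : Set ℂ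
  /-- the parametrization of its boundary -/
  γ : ℝ → ℂ
  /-- the interior angle at the corner is `(1 - χ) π` -/
  χ : ℝ
  isOpen : IsOpen D
  isBounded : Bornology.IsBounded D
  simplyConnected : SimplyConnectedSpace D
  frontier_eq : frontier D = γ '' Icc 0 1
  contDiff : ContDiff ℝ 2 γ
  deriv_ne_zero : ∀ t ∈ Icc (0 : ℝ) 1, deriv γ t ≠ 0
  closed : γ 0 = γ 1
  injOn : InjOn γ (Ico 0 1)
  /-- counterclockwise orientation: the left normal `i γ'(t)` points into `D` -/
  inner_normal : ∀ t ∈ Ioo (0 : ℝ) 1,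
    ∀ᶠ h : ℝ in 𝓝[>] 0, γ t + (h : ℂ) * (Complex.I * deriv γ t) ∈ D
  χ_gt : -1 < χ
  χ_lt : χ < 1
  χ_ne : χ ≠ 0
  /-- the interior angle, measured from the outgoing tangent `γ'(0)` counterclockwise to the
  tangent `-γ'(1)` of the other arm, is `(1 - χ) π` -/
  angle : ∃ r : ℝ, 0 < r ∧
    -deriv γ 1 = (r : ℂ) * Complex.exp (((1 - χ) * Real.pi : ℝ) * Complex.I) * deriv γ 0

/-- The decomposition of the boundary into three sections, indexed by `0, 1, 2`, with regular `C²`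
parametrizations on `[0,1]`: sections `0` and `1` start at the corner, section `0` is
described clockwise, the others counterclockwise, and section `2` connects the end of section `1`
with the end of section `0`.  The parametrizations are `γ ∘ θ i`. -/
structure CornerDomain.Sections (G : CornerDomain) where
  θ : Fin 3 → ℝ → ℝ
  contDiff : ∀ i, ContDiff ℝ 2 (θ i)
  deriv_neg : ∀ s ∈ Icc (0 : ℝ) 1, deriv (θ 0) s < 0
  deriv_pos₁ : ∀ s ∈ Icc (0 : ℝ) 1, 0 < deriv (θ 1) s
  deriv_pos₂ : ∀ s ∈ Icc (0 : ℝ) 1, 0 < deriv (θ 2) s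
  start₀ : θ 0 0 = 1
  start₁ : θ 1 0 = 0
  start₂ : θ 2 0 = θ 1 1
  end₂ : θ 2 1 = θ 0 1

/-! ## The space `𝒳` and the condition number -/

/-- `𝒳 = {(f₁,f₂,f₃) ∈ C([0,1])³ | f₁(0) = f₂(0)}`, with the norm `max ‖f_i‖_∞`. -/
def spaceX : Submodule ℝ (Fin 3 → C(unitInterval, ℝ)) where
  carrier := {f | f 0 0 = f 1 0}
  add_mem' := by
    intro f g hf hg
    simp only [mem_ofPred_eq, Pi.add_apply, ContinuousMap.add_apply] at *
    rw [hf, hg]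
  zero_mem' := by simp
  smul_mem' := by
    intro a f hf
    simp only [mem_ofPred_eq, Pi.smul_apply, ContinuousMap.smul_apply] at *
    rw [hf]

/-- The functions on `ℝ` that agree with the components of `f` on `[0,1]` (and are
constant on both sides of it), so that `f` can be evaluated at real numbers. -/
def extendReal (f : Fin 3 → C(unitInterval, ℝ)) (i : Fin 3) : ℝ → ℝ :=
  Set.IccExtend zero_le_one (f i)

/-- The subspace of the arrays `(c_{i,l})` with `c_{1,0} = c_{2,0}` (the sections being indexed
by `0, 1, 2`), with the norm `‖·‖_∞`. -/
def arraySpace (m : ℕ) : Submodule ℝ (Fin 3 × Fin (m + 2) → ℝ) where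
  carrier := {v | v (0, 0) = v (1, 0)}
  add_mem' := by
    intro f g hf hg
    simp only [mem_ofPred_eq, Pi.add_apply] at *
    rw [hf, hg]
  zero_mem' := by simp
  smul_mem' := by
    intro a f hf
    simp only [mem_ofPred_eq, Pi.smul_apply] at *
    rw [hf]

/-- The condition number `‖T‖ ‖T⁻¹‖` of an invertible bounded operator. -/
def condNumber {E : Type*} [NormedAddCommGroup E] [NormedSpace ℝ E] (T : E ≃L[ℝ] E) : ℝ :=
  ‖(T : E →L[ℝ] E)‖ * ‖(T.symm : E →L[ℝ] E)‖

namespace CornerDomain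

variable (G : CornerDomain)

/-- The Mellin kernel `L(t,s)`. -/
def kernelL (t s : ℝ) : ℝ :=
  -(s * Real.sin (G.χ * Real.pi)) /
    (s ^ 2 + 2 * t * s * Real.cos (G.χ * Real.pi) + t ^ 2)

/-- The interior angle at the point with parameter `s` of the section `i`. -/
def angleBar (i : Fin 3) (s : ℝ) : ℝ :=
  if i ≠ 2 ∧ s = 0 then (1 - G.χ) * Real.pi else Real.pi

namespace Sections

variable {G : CornerDomain} (Γ : G.Sections)

/-- The parametrization of the section `i`. -/
def σ (i : Fin 3) (s : ℝ) : ℂ := G.γ (Γ.θ i s)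

/-- `1` if the section is described counterclockwise, `-1` otherwise; the inner normal at
`σ j t` is `orientation j * i σ_j'(t) / |σ_j'(t)|`. -/
def orientation (j : Fin 3) : ℝ := if j = 0 then -1 else 1

/-- The kernel `K^{i,j}(t,s)`: the derivative of `log |P - Q|` along the inner normal at
`Q = σ j t`, times the arc length element `|σ_j'(t)|`, where `P = σ i s`; if `P = Q` the kernel
takes the value by which it is continuous along the boundary. -/
def kernelK (i j : Fin 3) (t s : ℝ) : ℝ :=
  let P := Γ.σ i s
  let Q := Γ.σ j t
  let d := deriv (Γ.σ j) t
  let d₂ := deriv (deriv (Γ.σ j)) t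
  orientation j *
    if P = Q then 1 / 2 * ((d.im * d₂.re - d.re * d₂.im) / (d.re ^ 2 + d.im ^ 2))
    else (d.im * (P.re - Q.re) - d.re * (P.im - Q.im)) /
      ((P.re - Q.re) ^ 2 + (P.im - Q.im) ^ 2)

/-- The kernels `M^{i,j} = K^{i,j} - L`, for the two sections that meet at the corner. -/
def kernelM (i j : Fin 3) (t s : ℝ) : ℝ := Γ.kernelK i j t s - G.kernelL t s

/-! ### The integral operators, on triples of functions -/

/-- The matrix operator `𝒦`. -/
def opK (ρ : Fin 3 → ℝ → ℝ) (i : Fin 3) (s : ℝ) : ℝ :=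
  (-Real.pi + G.angleBar i s) * ρ i s +
    ∑ j : Fin 3, ∫ t in (0 : ℝ)..1, Γ.kernelK i j t s * ρ j t

end Sections

/-- The integral operator `ℒ`. -/
def opL (ρ : ℝ → ℝ) (s : ℝ) : ℝ := ∫ t in (0 : ℝ)..1, G.kernelL t s * ρ t

/-- The matrix operator `𝒲`. -/
def opW (ρ : Fin 3 → ℝ → ℝ) : Fin 3 → ℝ → ℝ :=
  ![fun s => (-Real.pi + G.angleBar 0 s) * ρ 0 s + G.opL (ρ 1) s,
    fun s => G.opL (ρ 0) s + (-Real.pi + G.angleBar 1 s) * ρ 1 s,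
    fun _ => 0]

/-- The discrete operator `ℒ_m`. -/
def opLm (m : ℕ) (ρ : ℝ → ℝ) (s : ℝ) : ℝ :=
  ∑ h : Fin (m + 2), Lobatto.coeff m h * G.kernelL (Lobatto.node m h) s * ρ (Lobatto.node m h)

/-- The matrix operator `𝒲_m`. -/
def opWm (m : ℕ) (ρ : Fin 3 → ℝ → ℝ) : Fin 3 → ℝ → ℝ :=
  ![fun s => (-Real.pi + G.angleBar 0 s) * ρ 0 s + G.opLm m (ρ 1) s,
    fun s => G.opLm m (ρ 0) s + (-Real.pi + G.angleBar 1 s) * ρ 1 s,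
    fun _ => 0]

/-- The threshold `c / m^{2 - 2ε}`. -/
def threshold (c ε : ℝ) (m : ℕ) : ℝ := c / (m : ℝ) ^ (2 - 2 * ε)

/-- The modified operator `𝒲̃_m`. -/
def opWmod (c ε : ℝ) (m : ℕ) (ρ : Fin 3 → ℝ → ℝ) (i : Fin 3) (s : ℝ) : ℝ :=
  if threshold c ε m ≤ s then G.opWm m ρ i s
  else 1 / threshold c ε m *
    (s * G.opWm m ρ i (threshold c ε m) + (threshold c ε m - s) * G.opW ρ i 0)

namespace Sections

variable {G : CornerDomain} (Γ : G.Sections)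

/-- The matrix operator `𝒮 = 𝒦 - 𝒲`. -/
def opS (ρ : Fin 3 → ℝ → ℝ) (i : Fin 3) (s : ℝ) : ℝ := Γ.opK ρ i s - G.opW ρ i s

/-- The kernels of the entries of `𝒮`. -/
def kernelS (i j : Fin 3) (t s : ℝ) : ℝ :=
  !![Γ.kernelK 0 0 t s, Γ.kernelM 0 1 t s, Γ.kernelK 0 2 t s;
     Γ.kernelM 1 0 t s, Γ.kernelK 1 1 t s, Γ.kernelK 1 2 t s;
     Γ.kernelK 2 0 t s, Γ.kernelK 2 1 t s, Γ.kernelK 2 2 t s] i j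

/-- The matrix operator `𝒮_m`. -/
def opSm (m : ℕ) (ρ : Fin 3 → ℝ → ℝ) (i : Fin 3) (s : ℝ) : ℝ :=
  ∑ j : Fin 3, ∑ h : Fin (m + 2),
    Lobatto.coeff m h * Γ.kernelS i j (Lobatto.node m h) s * ρ j (Lobatto.node m h)

/-- The operator `-π ℐ + 𝒲 + 𝒮`. -/
def opExact (ρ : Fin 3 → ℝ → ℝ) (i : Fin 3) (s : ℝ) : ℝ :=
  -Real.pi * ρ i s + G.opW ρ i s + Γ.opS ρ i s

/-- The operator `-π ℐ + 𝒲̃_m + 𝒮_m`. -/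
def opNystrom (c ε : ℝ) (m : ℕ) (ρ : Fin 3 → ℝ → ℝ) (i : Fin 3) (s : ℝ) : ℝ :=
  -Real.pi * ρ i s + G.opWmod c ε m ρ i s + Γ.opSm m ρ i s

end Sections

/-! ### The matrix of the linear system -/

/-- The coefficient of `ρ_j(x_h)` in `(𝒲_m ρ)_i(s)`, for `s > 0`. -/
def coeffWm (m : ℕ) (s : ℝ) (i j : Fin 3) (h : Fin (m + 2)) : ℝ :=
  if (i = 0 ∧ j = 1) ∨ (i = 1 ∧ j = 0) then
    Lobatto.coeff m h * G.kernelL (Lobatto.node m h) s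
  else 0

/-- The coefficient of `ρ_j(x_h)` in `(𝒲 ρ)_i(0)`. -/
def coeffW0 (m : ℕ) (i j : Fin 3) (h : Fin (m + 2)) : ℝ :=
  if i = j ∧ i ≠ 2 ∧ h = 0 then -Real.pi + (1 - G.χ) * Real.pi else 0

/-- The coefficient of `ρ_j(x_h)` in `(𝒲̃_m ρ)_i(s)`. -/
def coeffWmod (c ε : ℝ) (m : ℕ) (s : ℝ) (i j : Fin 3) (h : Fin (m + 2)) : ℝ :=
  if threshold c ε m ≤ s then G.coeffWm m s i j h
  else 1 / threshold c ε m *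
    (s * G.coeffWm m (threshold c ε m) i j h + (threshold c ε m - s) * G.coeffW0 m i j h)

/-- The matrix `A_m` of the linear system obtained by collocating
`(-π ℐ + 𝒲̃_m + 𝒮_m) ψ = g` at the nodes `x_l`, with unknowns `a_{j,h} = ψ_j(x_h)`. -/
def Sections.matrixA {G : CornerDomain} (Γ : G.Sections) (c ε : ℝ) (m : ℕ) :
    Matrix (Fin 3 × Fin (m + 2)) (Fin 3 × Fin (m + 2)) ℝ :=
  fun p q =>
    (if p = q then -Real.pi else 0) +
      G.coeffWmod c ε m (Lobatto.node m p.2) p.1 q.1 q.2 +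
      Lobatto.coeff m q.2 * Γ.kernelS p.1 q.1 (Lobatto.node m q.2) (Lobatto.node m p.2)

/-- `A_m` is the matrix of coefficients of the collocated system. -/
theorem Sections.matrixA_mulVec {G : CornerDomain} (Γ : G.Sections) {c : ℝ} (hc : 0 < c) (ε : ℝ)
    {m : ℕ} (hm : 1 ≤ m) (ρ : Fin 3 → ℝ → ℝ) (i : Fin 3) (l : Fin (m + 2)) :
    (Γ.matrixA c ε m).mulVec (fun q => ρ q.1 (Lobatto.node m q.2)) (i, l) =
      Γ.opNystrom c ε m ρ i (Lobatto.node m l) := by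
  have hn : Lobatto.node m 0 = 0 := by simp [Lobatto.node]
  have hs : 0 < threshold c ε m := by
    have : (0 : ℝ) < m := by exact_mod_cast hm
    unfold threshold
    positivity
  -- the three coefficient arrays represent the corresponding point functionals
  have h1 : ∀ s : ℝ, 0 < s → ∑ j : Fin 3, ∑ h : Fin (m + 2),
      G.coeffWm m s i j h * ρ j (Lobatto.node m h) = G.opWm m ρ i s := by
    intro s hs
    fin_cases i <;> simp [coeffWm, opWm, opLm, angleBar, hs.ne']
  have h0 : ∑ j : Fin 3, ∑ h : Fin (m + 2),
      G.coeffW0 m i j h * ρ j (Lobatto.node m h) = G.opW ρ i 0 := by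
    have hL : ∀ f : ℝ → ℝ, G.opL f 0 = 0 := by intro f; simp [opL, kernelL]
    fin_cases i <;>
      simp [coeffW0, opW, hL, angleBar, Fin.sum_univ_three, hn]
  have h2 : ∀ s : ℝ, ∑ j : Fin 3, ∑ h : Fin (m + 2),
      G.coeffWmod c ε m s i j h * ρ j (Lobatto.node m h) = G.opWmod c ε m ρ i s := by
    intro s
    unfold coeffWmod opWmod
    split_ifs with h
    · exact h1 s (hs.trans_le h)
    · rw [← h1 _ hs, ← h0]
      simp only [Finset.mul_sum, ← Finset.sum_add_distrib]
      refine Finset.sum_congr rfl fun j _ => Finset.sum_congr rfl fun h _ => ?_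
      ring
  rw [opNystrom, ← h2, opSm]
  simp only [Matrix.mulVec, dotProduct, matrixA, Fintype.sum_prod_type, add_mul,
    Finset.sum_add_distrib]
  congr 2
  have := Finset.sum_ite_eq (Finset.univ : Finset (Fin 3 × Fin (m + 2))) (i, l)
    (fun q => -Real.pi * ρ q.1 (Lobatto.node m q.2))
  simp only [Finset.mem_univ, if_true] at this
  rw [← this, Fintype.sum_prod_type]
  refine Finset.sum_congr rfl fun j _ => Finset.sum_congr rfl fun h _ => ?_
  split_ifs <;> simp

end CornerDomain

end

/-!
The operators `-π + 𝒲̃_m + 𝒮_m` are shown to be bounded below, uniformly for large `m`, by the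
theory of collectively compact perturbations.

*The Mellin part.* For fixed `s > 0` the kernel `L(t,s)` is the imaginary part of the Cauchy kernel
`1 / (t - z)` with the pole `z = -s e^{iχπ}`. It has constant sign, and its integral over `[0,1]`
is the difference `arg (1 - z) - χπ`, of absolute value at most `|χ| π < π`; its mass concentrates
at `t = 0` as `s → 0`. Hence `𝒲` maps `𝒳` to itself with norm at most `|χ| π`
(`CornerDomain.exists_operatorW`).

*The Lobatto rule.* It has nonnegative coefficients and is exact up to degree `2m + 1`
(`Lobatto.coeff_nonneg`, `Lobatto.quadrature_exact`). The prescribed values of the two extreme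
coefficients come from the differential equation `(v p)'' = -(m + 1)(m + 2) p` of the orthogonal
polynomials. Modulo polynomials of low degree, `p(t) / (t - z)` is
`p(z) / U(z) · U(t) / (t - z)`, where `U` is the Chebyshev polynomial of `[0,1]` of degree `m`, so
that the error of the rule for `L(·,s)` is bounded by `1 / (s |U(z)|)`, up to a constant. Since
`|U(z)| ≥ sinh (κ m √s)` with `κ = cos (χπ/2) > 0`, and `m √s ≥ √c m^ε` for `s` beyond the threshold
`c / m^(2 - 2ε)`, the error tends to zero uniformly beyond the threshold. By density of the
polynomials this gives the strong convergence of `𝒲̃_m` to `𝒲`, and, as the kernel has constant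
sign, also the bound `‖𝒲̃_m‖ ≤ q < π` for large `m`
(`CornerDomain.opWmod_error`, `CornerDomain.exists_operatorWmod`).

*The compact part.* Away from the corner, Taylor's formula removes the singularity of the double
layer kernels, so that all kernels `S^{i,j}` are continuous. The functions `𝒮_m f` with `‖f‖ ≤ 1`
are then sums of averages of `± S^{i,j}(t,·)`, and lie in one compact set
(`CornerDomain.Sections.exists_compact_opSm`).

*Stability.* If the operators were not bounded below, a subsequence of normalized approximate null
vectors would converge, by compactness and by the invertibility of `-π + 𝒲`, to a unit vector of
`Ker (-π + 𝒲 + 𝒮)` (`eventually_bounded_below`). Surjectivity follows from the Fredholm alternative.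

*The matrix.* Sampling at the nodes intertwines the operator with `A_m`, is a contraction, and has
norm preserving right inverses by Tietze's theorem; this transports invertibility and bounds the
condition number (`condNumber_le_of_intertwining`).
-/

open Set Filter Topology

/-! ### Orthogonal polynomials and the nodes -/

namespace Lobatto

open Polynomial

/-- The integral over `[0,1]`, as a linear functional on polynomials. -/
noncomputable def integral01 : ℝ[X] →ₗ[ℝ] ℝ where
  toFun p := ∫ x in (0 : ℝ)..1, p.eval x
  map_add' p q := by
    simp only [eval_add]
    exact intervalIntegral.integral_add (p.continuous.intervalIntegrable _ _)
      (q.continuous.intervalIntegrable _ _)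
  map_smul' a p := by simp

theorem integral01_apply (p : ℝ[X]) : integral01 p = ∫ x in (0 : ℝ)..1, p.eval x := rfl

/-- The weight `x (1 - x)` as a polynomial. -/
noncomputable def weightPoly : ℝ[X] := X * (1 - X)

theorem eval_weightPoly (x : ℝ) : weightPoly.eval x = weight x := by simp [weightPoly, weight]

theorem pairing_eq (p q : ℝ[X]) : pairing p q = integral01 (p * q * weightPoly) := by
  simp [pairing, integral01_apply, eval_weightPoly]

theorem weight_nonneg {x : ℝ} (hx : x ∈ Icc (0 : ℝ) 1) : 0 ≤ weight x :=
  mul_nonneg hx.1 (sub_nonneg.2 hx.2)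

theorem weight_pos {x : ℝ} (hx : x ∈ Ioo (0 : ℝ) 1) : 0 < weight x :=
  mul_pos hx.1 (sub_pos.2 hx.2)

theorem weightPoly_ne_zero : weightPoly ≠ 0 := by
  intro h
  have := eval_weightPoly (1 / 2)
  rw [h] at this
  norm_num [weight] at this

theorem natDegree_weightPoly : weightPoly.natDegree = 2 := by
  unfold weightPoly
  rw [show (X * (1 - X) : ℝ[X]) = -(X ^ 2) + X by ring]
  compute_degree!

/-- A polynomial that is nonnegative on `[0,1]` and has integral zero vanishes. -/
theorem eq_zero_of_integral01_eq_zero {p : ℝ[X]} (hp : ∀ x ∈ Icc (0 : ℝ) 1, 0 ≤ p.eval x)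
    (h : integral01 p = 0) : p = 0 := by
  by_contra hne
  have : ∃ c ∈ Icc (0 : ℝ) 1, 0 < p.eval c := by
    by_contra! hall
    refine hne (eq_zero_of_infinite_isRoot p ((Icc_infinite (zero_lt_one' ℝ)).mono ?_))
    exact fun x hx => le_antisymm (hall x hx) (hp x hx)
  have := intervalIntegral.integral_pos zero_lt_one p.continuous.continuousOn
    (fun x hx => hp x (Ioc_subset_Icc_self hx)) this
  exact this.ne' h

theorem integral01_nonneg {p : ℝ[X]} (hp : ∀ x ∈ Icc (0 : ℝ) 1, 0 ≤ p.eval x) :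
    0 ≤ integral01 p :=
  intervalIntegral.integral_nonneg zero_le_one hp

theorem pairing_comm (p q : ℝ[X]) : pairing p q = pairing q p := by
  rw [pairing_eq, pairing_eq, mul_comm p q]

theorem pairing_add_right (p q r : ℝ[X]) : pairing p (q + r) = pairing p q + pairing p r := by
  simp only [pairing_eq, ← map_add]; congr 1; ring

theorem pairing_C_mul_right (p q : ℝ[X]) (a : ℝ) : pairing p (C a * q) = a * pairing p q := by
  simp only [pairing_eq, ← smul_eq_mul (a := a), ← map_smul]
  congr 1
  rw [smul_eq_C_mul]; ring

theorem pairing_self_ne_zero {p : ℝ[X]} (hp : p ≠ 0) : pairing p p ≠ 0 := by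
  rw [pairing_eq]
  intro h
  have := eq_zero_of_integral01_eq_zero (fun x hx => ?_) h
  · simp [hp, weightPoly_ne_zero] at this
  · rw [eval_mul, eval_mul, eval_weightPoly]
    exact mul_nonneg (mul_self_nonneg _) (weight_nonneg hx)

theorem orthPoly_monic_natDegree (m : ℕ) : (orthPoly m).Monic ∧ (orthPoly m).natDegree = m := by
  induction m using Nat.strong_induction_on with
  | _ m ih =>
    have hdeg : (∑ k : Fin m, C (pairing (X ^ m) (orthPoly k) /
        pairing (orthPoly k) (orthPoly k)) * orthPoly k).degree < m := by
      rw [degree_lt_iff_coeff_zero]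
      intro n hn
      rw [finsetSum_coeff]
      refine Finset.sum_eq_zero fun k _ => ?_
      rw [coeff_C_mul, coeff_eq_zero_of_natDegree_lt, mul_zero]
      rw [(ih k k.2).2]
      exact k.2.trans_le hn
    rw [orthPoly]
    refine ⟨monic_X_pow_sub hdeg, ?_⟩
    rw [natDegree_eq_of_degree_eq_some]
    rw [degree_sub_eq_left_of_degree_lt] <;> simp [hdeg]

theorem orthPoly_monic (m : ℕ) : (orthPoly m).Monic := (orthPoly_monic_natDegree m).1

theorem natDegree_orthPoly (m : ℕ) : (orthPoly m).natDegree = m := (orthPoly_monic_natDegree m).2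

theorem degree_orthPoly (m : ℕ) : (orthPoly m).degree = m := by
  rw [degree_eq_natDegree (orthPoly_monic m).ne_zero, natDegree_orthPoly]

theorem pairing_orthPoly_of_lt (m : ℕ) : ∀ k < m, pairing (orthPoly k) (orthPoly m) = 0 := by
  induction m using Nat.strong_induction_on with
  | _ m ih =>
    intro j hj
    have key : pairing (orthPoly j) (orthPoly m) = pairing (orthPoly j) (X ^ m) -
        ∑ k : Fin m, pairing (X ^ m) (orthPoly k) / pairing (orthPoly k) (orthPoly k) *
          pairing (orthPoly j) (orthPoly k) := by
      have e : orthPoly m = X ^ m - ∑ k : Fin m, C (pairing (X ^ m) (orthPoly k) /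
          pairing (orthPoly k) (orthPoly k)) * orthPoly k := by rw [orthPoly]
      rw [e]
      simp only [← pairing_C_mul_right]
      simp only [pairing_eq, mul_sub, sub_mul, map_sub, Finset.mul_sum, Finset.sum_mul, map_sum]
    rw [key, Finset.sum_eq_single_of_mem (⟨j, hj⟩ : Fin m) (Finset.mem_univ _)]
    · have := pairing_self_ne_zero (orthPoly_monic j).ne_zero
      rw [div_mul_cancel₀ _ this, pairing_comm, sub_self]
    · rintro ⟨k, hk⟩ - hne
      have hne' : k ≠ j := fun h => hne (by simp [h])
      rcases lt_or_gt_of_ne hne' with h | h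
      · rw [pairing_comm (orthPoly j), ih j hj k h, mul_zero]
      · rw [ih k hk j h, mul_zero]

theorem pairing_orthPoly_of_degree_lt {m : ℕ} {q : ℝ[X]} (hq : q.degree < m) :
    pairing (orthPoly m) q = 0 := by
  suffices H : ∀ n ≤ m, ∀ q : ℝ[X], q.degree < n → pairing (orthPoly m) q = 0 from
    H m le_rfl q hq
  intro n
  induction n with
  | zero =>
    intro _ q hq
    have : q = 0 := by simpa using hq
    simp [this, pairing_eq]
  | succ n ih =>
    intro hn q hq
    have hr : (q - C (q.coeff n) * orthPoly n).degree < n := by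
      rw [degree_lt_iff_coeff_zero] at hq ⊢
      intro k hk
      rcases hk.eq_or_lt with rfl | hk
      · have : (orthPoly n).coeff n = 1 := by
          have := (orthPoly_monic n).coeff_natDegree
          rwa [natDegree_orthPoly] at this
        simp [this]
      · rw [coeff_sub, coeff_C_mul, hq k (by exact_mod_cast hk),
          coeff_eq_zero_of_natDegree_lt (p := orthPoly n) (by rwa [natDegree_orthPoly])]
        simp
    have := pairing_add_right (orthPoly m) (q - C (q.coeff n) * orthPoly n)
      (C (q.coeff n) * orthPoly n)
    rw [sub_add_cancel, ih (by omega) _ hr, pairing_C_mul_right, pairing_comm _ (orthPoly n),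
      pairing_orthPoly_of_lt m n (by omega)] at this
    simpa using this

/-- A nonconstant factor of the orthogonal polynomial takes both signs on `(0,1)`: if `d` has
constant sign and `d q = orthPoly m`, then `0 = ∫ (orthPoly m) q v = ∫ d q² v` is impossible. -/
theorem not_nonneg_of_mul_eq_orthPoly {m : ℕ} {d q : ℝ[X]} (h : d * q = orthPoly m)
    (hd : 0 < d.natDegree) : ¬ ∀ x ∈ Ioo (0 : ℝ) 1, 0 ≤ d.eval x := by
  intro hpos
  have hne : d * q ≠ 0 := h ▸ (orthPoly_monic m).ne_zero
  have hq0 : q ≠ 0 := right_ne_zero_of_mul hne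
  have hd0 : d ≠ 0 := left_ne_zero_of_mul hne
  have hq : q.degree < m := by
    have := natDegree_mul hd0 hq0
    rw [h, natDegree_orthPoly] at this
    rw [degree_eq_natDegree hq0]
    exact_mod_cast (by omega)
  have h0 := pairing_orthPoly_of_degree_lt hq
  rw [pairing_eq, ← h] at h0
  have := eq_zero_of_integral01_eq_zero (fun x hx => ?_) h0
  · simp [hd0, hq0, weightPoly_ne_zero] at this
  · simp only [eval_mul, eval_weightPoly]
    rcases hx.1.eq_or_lt with rfl | h1
    · simp [weight]
    rcases hx.2.eq_or_lt with rfl | h2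
    · simp [weight]
    have := hpos x ⟨h1, h2⟩
    have := weight_nonneg hx
    nlinarith [mul_nonneg (mul_nonneg ‹0 ≤ eval x d› (mul_self_nonneg (eval x q))) this]

/-- Every nonconstant factor of the orthogonal polynomial has a root in `(0,1)`, by the intermediate
value theorem. Applied to irreducible factors and to linear ones, this gives the splitting and the
location of the roots. -/
theorem exists_root_of_dvd_orthPoly {m : ℕ} {d : ℝ[X]} (h : d ∣ orthPoly m)
    (hd : 0 < d.natDegree) : ∃ x ∈ Ioo (0 : ℝ) 1, d.IsRoot x := by
  obtain ⟨q, hq⟩ := h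
  have h1 := not_nonneg_of_mul_eq_orthPoly hq.symm hd
  have h2 := not_nonneg_of_mul_eq_orthPoly (d := -d) (q := -q) (by rw [neg_mul_neg, hq])
    (by rwa [natDegree_neg])
  push Not at h1 h2
  obtain ⟨a, ha, ha'⟩ := h1
  obtain ⟨b, hb, hb'⟩ := h2
  rw [eval_neg, neg_lt_zero] at hb'
  have := isPreconnected_Ioo.intermediate_value ha hb (f := fun x => d.eval x)
    d.continuous.continuousOn
  exact this ⟨ha'.le, hb'.le⟩

theorem orthPoly_splits (m : ℕ) : (orthPoly m).Splits := by
  obtain ⟨u, hu⟩ := UniqueFactorizationMonoid.factors_prod (orthPoly_monic m).ne_zero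
  rw [← hu]
  refine (Splits.multisetProd fun g hg => ?_).mul u.isUnit.splits
  have hirr := UniqueFactorizationMonoid.irreducible_of_factor g hg
  obtain ⟨x, -, hx⟩ := exists_root_of_dvd_orthPoly
    (UniqueFactorizationMonoid.dvd_of_mem_factors hg) hirr.natDegree_pos
  exact Splits.of_degree_eq_one (degree_eq_one_of_irreducible_of_root hirr hx)

theorem mem_Ioo_of_mem_roots {m : ℕ} {x : ℝ} (hx : x ∈ (orthPoly m).roots) :
    x ∈ Ioo (0 : ℝ) 1 := by
  obtain ⟨y, hy, hy'⟩ := exists_root_of_dvd_orthPoly (m := m) (d := X - C x)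
    (dvd_iff_isRoot.2 (isRoot_of_mem_roots hx)) (by rw [natDegree_X_sub_C]; exact one_pos)
  rw [root_X_sub_C] at hy'
  rwa [hy']

/-- The roots are simple, as the square of a linear factor has constant sign. -/
theorem nodup_roots_orthPoly (m : ℕ) : (orthPoly m).roots.Nodup := by
  rw [Multiset.nodup_iff_count_le_one]
  intro x
  rw [count_roots]
  by_contra! h
  have hdvd := (le_rootMultiplicity_iff (orthPoly_monic m).ne_zero).1 (Nat.succ_le_of_lt h)
  obtain ⟨q, hq⟩ := hdvd
  refine not_nonneg_of_mul_eq_orthPoly hq.symm ?_ fun y _ => ?_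
  · rw [natDegree_pow, natDegree_X_sub_C]; norm_num
  · rw [eval_pow]; exact sq_nonneg _

theorem card_roots_orthPoly (m : ℕ) : (orthPoly m).roots.card = m := by
  rw [← (orthPoly_splits m).natDegree_eq_card_roots, natDegree_orthPoly]

theorem node_zero (m : ℕ) : node m 0 = 0 := by simp [node]

theorem node_last (m : ℕ) : node m (m + 1) = 1 := by simp [node]

theorem node_interior {m k : ℕ} (hk : k ∈ Finset.Icc 1 m) :
    ∃ h : k - 1 < ((orthPoly m).roots.sort (· ≤ ·)).length,
      node m k = ((orthPoly m).roots.sort (· ≤ ·))[k - 1] := by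
  rw [Finset.mem_Icc] at hk
  have h : k - 1 < ((orthPoly m).roots.sort (· ≤ ·)).length := by
    rw [Multiset.length_sort, card_roots_orthPoly]; omega
  refine ⟨h, ?_⟩
  rw [node, if_neg (by omega), if_neg (by omega), List.getD_eq_getElem _ _ h]

theorem node_mem_roots {m k : ℕ} (hk : k ∈ Finset.Icc 1 m) : node m k ∈ (orthPoly m).roots := by
  obtain ⟨h, e⟩ := node_interior hk
  rw [e, ← Multiset.mem_sort (r := (· ≤ ·))]
  exact List.getElem_mem h

theorem eval_orthPoly_node {m k : ℕ} (hk : k ∈ Finset.Icc 1 m) :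
    (orthPoly m).eval (node m k) = 0 :=
  isRoot_of_mem_roots (node_mem_roots hk)

theorem node_mem_Ioo {m k : ℕ} (hk : k ∈ Finset.Icc 1 m) : node m k ∈ Ioo (0 : ℝ) 1 :=
  mem_Ioo_of_mem_roots (node_mem_roots hk)

theorem node_injOn_interior (m : ℕ) : InjOn (node m) (Finset.Icc 1 m : Finset ℕ) := by
  intro k hk l hl hkl
  obtain ⟨h, e⟩ := node_interior hk
  obtain ⟨h', e'⟩ := node_interior hl
  rw [e, e'] at hkl
  have hnd : ((orthPoly m).roots.sort (· ≤ ·)).Nodup := by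
    rw [← Multiset.coe_nodup, Multiset.sort_eq]
    exact nodup_roots_orthPoly m
  have := (hnd.getElem_inj_iff).1 hkl
  have hk := Finset.mem_Icc.1 hk
  have hl := Finset.mem_Icc.1 hl
  omega

theorem interior_cases {m k : ℕ} (hk : k < m + 2) : k = 0 ∨ k = m + 1 ∨ k ∈ Finset.Icc 1 m := by
  rw [Finset.mem_Icc]; omega

theorem node_mem_Icc {m k : ℕ} (hk : k < m + 2) : node m k ∈ Icc (0 : ℝ) 1 := by
  rcases interior_cases hk with rfl | rfl | h
  · simp [node_zero]
  · simp [node_last]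
  · exact Ioo_subset_Icc_self (node_mem_Ioo h)

theorem node_injective (m : ℕ) : Function.Injective fun h : Fin (m + 2) => node m h := by
  rintro ⟨k, hk⟩ ⟨l, hl⟩ h
  simp only [Fin.mk.injEq] at h ⊢
  rcases interior_cases hk with rfl | rfl | hk' <;> rcases interior_cases hl with rfl | rfl | hl'
  · rfl
  · simp [node_zero, node_last] at h
  · have := node_mem_Ioo hl'
    rw [← h, node_zero] at this
    exact absurd this.1 (lt_irrefl _)
  · simp [node_zero, node_last] at h
  · rfl
  · have := node_mem_Ioo hl'
    rw [← h, node_last] at this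
    exact absurd this.2 (lt_irrefl _)
  · have := node_mem_Ioo hk'
    rw [h, node_zero] at this
    exact absurd this.1 (lt_irrefl _)
  · have := node_mem_Ioo hk'
    rw [h, node_last] at this
    exact absurd this.2 (lt_irrefl _)
  · exact node_injOn_interior m hk' hl' h

end Lobatto

/-! ### Exactness and convergence of the Lobatto rule -/

namespace Lobatto

open Polynomial

theorem integral01_derivative (f : ℝ[X]) :
    integral01 (derivative f) = f.eval 1 - f.eval 0 := by
  rw [integral01_apply]
  exact intervalIntegral.integral_eq_sub_of_hasDerivAt (fun x _ => f.hasDerivAt x)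
    ((derivative f).continuous.intervalIntegrable _ _)

theorem integral01_derivative_mul (f g : ℝ[X]) :
    integral01 (derivative f * g) =
      f.eval 1 * g.eval 1 - f.eval 0 * g.eval 0 - integral01 (f * derivative g) := by
  have := integral01_derivative (f * g)
  rw [derivative_mul, map_add, eval_mul, eval_mul] at this
  linarith

theorem eval_zero_weightPoly : weightPoly.eval 0 = 0 := by simp [weightPoly]

theorem eval_one_weightPoly : weightPoly.eval 1 = 0 := by simp [weightPoly]

theorem coeff_weightPoly_mul (p : ℝ[X]) (n : ℕ) :
    (weightPoly * p).coeff (n + 2) = p.coeff (n + 1) - p.coeff n := by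
  rw [weightPoly, show X * (1 - X) * p = X * p - X * (X * p) by ring, coeff_sub, coeff_X_mul,
    coeff_X_mul, coeff_X_mul]

theorem coeff_derivative_derivative (p : ℝ[X]) (n : ℕ) :
    (derivative (derivative p)).coeff n = p.coeff (n + 2) * ((n + 2) * (n + 1)) := by
  rw [coeff_derivative, coeff_derivative]
  push_cast
  ring

theorem degree_derivative_derivative_weightPoly_mul {m : ℕ} {q : ℝ[X]} (hq : q.degree < m) :
    (derivative (derivative (weightPoly * q))).degree < m := by
  rw [degree_lt_iff_coeff_zero] at hq ⊢
  intro n hn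
  rw [coeff_derivative_derivative, coeff_weightPoly_mul, hq n hn, hq (n + 1) (by omega)]
  simp

/-- The differential operator `q ↦ (v q)''` is symmetric for the weight `v`. -/
theorem pairing_derivative_derivative (p q : ℝ[X]) :
    pairing (derivative (derivative (weightPoly * p))) q =
      pairing p (derivative (derivative (weightPoly * q))) := by
  rw [pairing_eq, pairing_eq, mul_assoc, integral01_derivative_mul, integral01_derivative_mul,
    mul_comm q]
  simp only [eval_mul, eval_zero_weightPoly, eval_one_weightPoly, zero_mul, mul_zero, sub_self,
    zero_sub, neg_neg]
  congr 1
  ring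

/-- The differential equation of the orthogonal polynomials. -/
theorem derivative_derivative_weightPoly_mul_orthPoly (m : ℕ) :
    derivative (derivative (weightPoly * orthPoly m)) =
      C (-(((m : ℝ) + 1) * (m + 2))) * orthPoly m := by
  -- the difference `r` of the two sides has degree less than `m` and is orthogonal to itself
  set r := derivative (derivative (weightPoly * orthPoly m)) +
    C (((m : ℝ) + 1) * (m + 2)) * orthPoly m with hr
  have hp1 : (orthPoly m).coeff m = 1 := by
    have := (orthPoly_monic m).coeff_natDegree
    rwa [natDegree_orthPoly] at this
  have hp0 : ∀ n, m < n → (orthPoly m).coeff n = 0 := fun n hn =>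
    coeff_eq_zero_of_natDegree_lt (by rwa [natDegree_orthPoly])
  have hdeg : r.degree < m := by
    rw [degree_lt_iff_coeff_zero]
    intro n hn
    rw [hr, coeff_add, coeff_C_mul, coeff_derivative_derivative, coeff_weightPoly_mul,
      hp0 (n + 1) (by omega)]
    rcases hn.eq_or_lt with rfl | hn
    · rw [hp1]; ring
    · rw [hp0 n hn]; ring
  have h0 : r = 0 := by
    by_contra hne
    refine pairing_self_ne_zero hne ?_
    have h1 := pairing_derivative_derivative (orthPoly m) r
    rw [pairing_orthPoly_of_degree_lt (degree_derivative_derivative_weightPoly_mul hdeg)] at h1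
    have h2 := pairing_orthPoly_of_degree_lt hdeg
    conv_lhs => arg 1; rw [hr]
    rw [pairing_comm, pairing_add_right, pairing_C_mul_right, pairing_comm, h1, pairing_comm, h2]
    simp
  rw [map_neg, neg_mul]
  exact eq_neg_of_add_eq_zero_left h0

/-- Integration by parts in the differential equation. -/
theorem integral01_mul_orthPoly (m : ℕ) (g : ℝ[X]) :
    ((m : ℝ) + 1) * (m + 2) * integral01 (orthPoly m * g) =
      (orthPoly m).eval 1 * g.eval 1 + (orthPoly m).eval 0 * g.eval 0 +
        integral01 (derivative (weightPoly * orthPoly m) * derivative g) := by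
  have h := integral01_derivative_mul (derivative (weightPoly * orthPoly m)) g
  rw [derivative_derivative_weightPoly_mul_orthPoly, mul_assoc, ← smul_eq_C_mul, map_smul,
    smul_eq_mul] at h
  have h0 : (derivative (weightPoly * orthPoly m)).eval 0 = (orthPoly m).eval 0 := by
    simp [weightPoly, derivative_mul]
  have h1 : (derivative (weightPoly * orthPoly m)).eval 1 = -(orthPoly m).eval 1 := by
    simp [weightPoly, derivative_mul]
  rw [h0, h1] at h
  linarith

theorem integral01_derivative_weightPoly_mul (p : ℝ[X]) :
    integral01 (derivative (weightPoly * p)) = 0 := by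
  rw [integral01_derivative]
  simp [eval_zero_weightPoly, eval_one_weightPoly]

/-- Exactness on `(1 - x) p` determines the coefficient of the Lobatto rule at `0`. -/
theorem integral01_orthPoly_mul_one_sub_X (m : ℕ) :
    integral01 (orthPoly m * (1 - X)) =
      1 / (((m : ℝ) + 1) * (m + 2)) * (orthPoly m).eval 0 := by
  have h := integral01_mul_orthPoly m (1 - X)
  have e : derivative (weightPoly * orthPoly m) * derivative (1 - X : ℝ[X]) =
      -derivative (weightPoly * orthPoly m) := by simp
  rw [e, map_neg, integral01_derivative_weightPoly_mul] at h
  simp only [eval_sub, eval_one, eval_X, sub_self, mul_zero, sub_zero, mul_one, zero_add, neg_zero,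
    add_zero] at h
  rw [← h]
  have : ((m : ℝ) + 1) * (m + 2) ≠ 0 := by positivity
  field_simp

/-- Exactness on `x p` determines the coefficient of the Lobatto rule at `1`. -/
theorem integral01_orthPoly_mul_X (m : ℕ) :
    integral01 (orthPoly m * X) = 1 / (((m : ℝ) + 1) * (m + 2)) * (orthPoly m).eval 1 := by
  have h := integral01_mul_orthPoly m X
  rw [derivative_X, mul_one, integral01_derivative_weightPoly_mul] at h
  simp only [eval_X, mul_zero, mul_one, add_zero] at h
  rw [← h]
  have : ((m : ℝ) + 1) * (m + 2) ≠ 0 := by positivity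
  field_simp

/-- The Gauss rule at the interior nodes, for the weight `v`, is exact up to degree `2m - 1`. -/
theorem gauss_exact {m : ℕ} (hm : 1 ≤ m) {q : ℝ[X]} (hq : q.natDegree ≤ 2 * m - 1) :
    integral01 (weightPoly * q) = ∑ k ∈ Finset.Icc 1 m,
      q.eval (node m k) * integral01 (Lagrange.basis (Finset.Icc 1 m) (node m) k * weightPoly) := by
  set p := orthPoly m
  have hp : p.Monic := orthPoly_monic m
  -- divide by the orthogonal polynomial and interpolate the rest
  have hdiv : q %ₘ p + p * (q /ₘ p) = q := modByMonic_add_div q p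
  have ha : (q /ₘ p).degree < m := by
    refine lt_of_le_of_lt degree_le_natDegree ?_
    rw [natDegree_divByMonic q hp, natDegree_orthPoly]
    exact_mod_cast (by omega)
  have hr : (q %ₘ p).degree < (Finset.Icc 1 m).card := by
    have := degree_modByMonic_lt q hp
    rw [degree_orthPoly] at this
    simpa using this
  have hint := Lagrange.eq_interpolate (node_injOn_interior m) hr
  have h1 : integral01 (weightPoly * q) = integral01 ((q %ₘ p) * weightPoly) := by
    have h0 := pairing_orthPoly_of_degree_lt ha
    rw [pairing_eq] at h0
    conv_lhs => rw [← hdiv]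
    rw [mul_comm, add_mul, map_add, h0, add_zero]
  rw [h1, hint, Lagrange.interpolate_apply, Finset.sum_mul, map_sum]
  refine Finset.sum_congr rfl fun k hk => ?_
  rw [mul_assoc, ← smul_eq_C_mul, map_smul, smul_eq_mul]
  congr 1
  conv_rhs => rw [← hdiv]
  rw [eval_add, eval_mul, eval_orthPoly_node hk, zero_mul, add_zero]

theorem coeff_interior {m k : ℕ} (hk : k ∈ Finset.Icc 1 m) :
    coeff m k = integral01 (Lagrange.basis (Finset.Icc 1 m) (node m) k * weightPoly) /
      weight (node m k) := by
  have hk' := Finset.mem_Icc.1 hk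
  rw [coeff, if_neg (by omega), integral01_apply, intervalIntegral.integral_div]
  simp [eval_weightPoly]

theorem sum_nodes {E : Type*} [AddCommMonoid E] (m : ℕ) (f : ℕ → E) :
    ∑ h : Fin (m + 2), f h = f 0 + ∑ k ∈ Finset.Icc 1 m, f k + f (m + 1) := by
  rw [Fin.sum_univ_eq_sum_range, Finset.sum_range_succ, Finset.range_eq_Ico,
    Finset.sum_eq_sum_Ico_succ_bot (Nat.succ_pos m)]
  rfl

/-- The Lobatto rule is exact up to degree `2m + 1`. -/
theorem quadrature_exact {m : ℕ} (hm : 1 ≤ m) {f : ℝ[X]} (hf : f.natDegree ≤ 2 * m + 1) :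
    ∑ h : Fin (m + 2), coeff m h * f.eval (node m h) = integral01 f := by
  set p := orthPoly m
  have hp0 : p.eval 0 ≠ 0 := fun h =>
    absurd (mem_Ioo_of_mem_roots ((mem_roots (orthPoly_monic m).ne_zero).2 h)).1 (lt_irrefl _)
  have hp1 : p.eval 1 ≠ 0 := fun h =>
    absurd (mem_Ioo_of_mem_roots ((mem_roots (orthPoly_monic m).ne_zero).2 h)).2 (lt_irrefl _)
  -- subtract multiples of `(1 - x) p` and `x p`, so that the rest vanishes at both endpoints
  set u := C (f.eval 0 / p.eval 0) * (p * (1 - X)) + C (f.eval 1 / p.eval 1) * (p * X) with hu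
  have hu0 : u.eval 0 = f.eval 0 := by simp [hu, hp0]
  have hu1 : u.eval 1 = f.eval 1 := by simp [hu, hp1]
  have hudeg : u.natDegree ≤ 2 * m + 1 := by
    have hpd : p.natDegree ≤ m := (natDegree_orthPoly m).le
    have h1X : (1 - X : ℝ[X]).natDegree ≤ 1 := by compute_degree
    refine natDegree_add_le_of_degree_le ?_ ?_
    · refine (natDegree_C_mul_le _ _).trans (natDegree_mul_le.trans ?_); omega
    · refine (natDegree_C_mul_le _ _).trans (natDegree_mul_le.trans ?_)
      rw [natDegree_X]; omega
  have hdvd : weightPoly ∣ f - u := by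
    have h0 : (X : ℝ[X]) ∣ f - u := by
      rw [X_dvd_iff, coeff_zero_eq_eval_zero, eval_sub, hu0, sub_self]
    have h1 : (1 - X : ℝ[X]) ∣ f - u := by
      rw [← neg_dvd, neg_sub, show (X - 1 : ℝ[X]) = X - C 1 by simp, dvd_iff_isRoot, IsRoot,
        eval_sub, hu1, sub_self]
    refine IsCoprime.mul_dvd ⟨1, 1, by ring⟩ h0 h1
  obtain ⟨q, hq⟩ := hdvd
  have hqdeg : q.natDegree ≤ 2 * m - 1 := by
    rcases eq_or_ne q 0 with rfl | hq0
    · simp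
    have h1 := natDegree_mul weightPoly_ne_zero hq0
    rw [natDegree_weightPoly, ← hq] at h1
    have h2 := natDegree_sub_le_of_le hf hudeg
    omega
  have hfu : f = u + weightPoly * q := by rw [← hq]; ring
  have hIu : integral01 u = 1 / (((m : ℝ) + 1) * (m + 2)) * (f.eval 0 + f.eval 1) := by
    rw [hu, map_add, ← smul_eq_C_mul, ← smul_eq_C_mul, map_smul, map_smul, smul_eq_mul,
      smul_eq_mul, integral01_orthPoly_mul_one_sub_X, integral01_orthPoly_mul_X]
    change f.eval 0 / p.eval 0 * (_ * p.eval 0) + f.eval 1 / p.eval 1 * (_ * p.eval 1) = _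
    field_simp
  have hint : integral01 f = 1 / (((m : ℝ) + 1) * (m + 2)) * (f.eval 0 + f.eval 1) +
      ∑ k ∈ Finset.Icc 1 m, coeff m k * f.eval (node m k) := by
    rw [← hIu]
    conv_lhs => rw [hfu, map_add, gauss_exact hm hqdeg]
    congr 1
    refine Finset.sum_congr rfl fun k hk => ?_
    have hw := (weight_pos (node_mem_Ioo hk)).ne'
    have hek : f.eval (node m k) = weight (node m k) * q.eval (node m k) := by
      conv_lhs => rw [hfu]
      simp only [hu, eval_add, eval_mul, eval_weightPoly, p, eval_orthPoly_node hk]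
      ring
    rw [coeff_interior hk, hek]
    field_simp
  rw [hint, sum_nodes m fun k => coeff m k * f.eval (node m k), node_zero, node_last]
  have hc0 : coeff m 0 = 1 / (((m : ℝ) + 1) * (m + 2)) := by simp [coeff]
  have hc1 : coeff m (m + 1) = 1 / (((m : ℝ) + 1) * (m + 2)) := by simp [coeff]
  rw [hc0, hc1]
  ring

theorem natDegree_basis_interior {m k : ℕ} (hk : k ∈ Finset.Icc 1 m) :
    (Lagrange.basis (Finset.Icc 1 m) (node m) k).natDegree = m - 1 := by
  have := Lagrange.degree_basis (node_injOn_interior m) hk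
  rw [natDegree_eq_of_degree_eq_some this]
  simp

theorem coeff_nonneg {m k : ℕ} (hk : k < m + 2) : 0 ≤ coeff m k := by
  rcases interior_cases hk with rfl | rfl | hk
  · rw [coeff, if_pos (Or.inl rfl)]; positivity
  · rw [coeff, if_pos (Or.inr rfl)]; positivity
  have hk' := Finset.mem_Icc.1 hk
  set l := Lagrange.basis (Finset.Icc 1 m) (node m) k with hl
  have hdeg : (l ^ 2).natDegree ≤ 2 * m - 1 := by
    rw [natDegree_pow, hl, natDegree_basis_interior hk]; omega
  -- by exactness of the Gauss rule, `∫ l_k v = ∫ l_k² v`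
  have h := gauss_exact (by omega) hdeg
  rw [Finset.sum_eq_single_of_mem k hk, eval_pow, hl,
    Lagrange.eval_basis_self (node_injOn_interior m) hk, one_pow, one_mul] at h
  · rw [coeff_interior hk, ← h]
    refine div_nonneg (integral01_nonneg fun x hx => ?_) (weight_pos (node_mem_Ioo hk)).le
    rw [eval_mul, eval_weightPoly, eval_pow]
    exact mul_nonneg (weight_nonneg hx) (sq_nonneg _)
  · intro j hj hjk
    rw [eval_pow, hl, Lagrange.eval_basis_of_ne hjk.symm hj]
    simp

theorem sum_coeff {m : ℕ} (hm : 1 ≤ m) : ∑ h : Fin (m + 2), coeff m h = 1 := by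
  have := quadrature_exact hm (f := 1) (by simp)
  simpa [integral01_apply] using this

/-- The Lobatto rule does not increase the maximum norm. -/
theorem norm_quadrature_le {E : Type*} [NormedAddCommGroup E] [NormedSpace ℝ E] {m : ℕ}
    (hm : 1 ≤ m) {f : ℝ → E} {C : ℝ} (hf : ∀ x ∈ Icc (0 : ℝ) 1, ‖f x‖ ≤ C) :
    ‖∑ h : Fin (m + 2), coeff m h • f (node m h)‖ ≤ C := by
  calc ‖∑ h : Fin (m + 2), coeff m h • f (node m h)‖
      ≤ ∑ h : Fin (m + 2), coeff m h * C := by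
        refine norm_sum_le_of_le _ fun h _ => ?_
        rw [norm_smul, Real.norm_of_nonneg (coeff_nonneg h.2)]
        exact mul_le_mul_of_nonneg_left (hf _ (node_mem_Icc h.2)) (coeff_nonneg h.2)
    _ = C := by rw [← Finset.sum_mul, sum_coeff hm, one_mul]

/-- The Lobatto rule converges for every continuous function. -/
theorem tendsto_quadrature {f : ℝ → ℝ} (hf : ContinuousOn f (Icc 0 1)) :
    Tendsto (fun m : ℕ => ∑ h : Fin (m + 2), coeff m h * f (node m h)) atTop
      (𝓝 (∫ x in (0 : ℝ)..1, f x)) := by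
  rw [Metric.tendsto_atTop]
  intro ε hε
  obtain ⟨p, hp⟩ := exists_polynomial_near_of_continuousOn 0 1 f hf (ε / 3) (by positivity)
  refine ⟨p.natDegree + 1, fun m hm => ?_⟩
  have hm1 : 1 ≤ m := by omega
  have h1 := quadrature_exact hm1 (f := p) (by omega)
  have h2 : ‖∑ h : Fin (m + 2), coeff m h • (f (node m h) - p.eval (node m h))‖ ≤ ε / 3 :=
    norm_quadrature_le (f := fun x => f x - p.eval x) hm1 fun x hx => by
      rw [norm_sub_rev]; exact (hp x hx).le
  have h3 : ‖∫ x in (0 : ℝ)..1, (p.eval x - f x)‖ ≤ ε / 3 := by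
    have := intervalIntegral.norm_integral_le_of_norm_le_const (a := (0 : ℝ)) (b := 1)
      (f := fun x => p.eval x - f x) (C := ε / 3) fun x hx => by
        rw [uIoc_of_le zero_le_one] at hx
        exact (hp x (Ioc_subset_Icc_self hx)).le
    simpa using this
  rw [intervalIntegral.integral_sub (p.continuous.intervalIntegrable _ _)
    (hf.intervalIntegrable_of_Icc zero_le_one), ← integral01_apply, ← h1] at h3
  simp only [smul_eq_mul, mul_sub, Finset.sum_sub_distrib] at h2
  rw [dist_eq_norm]
  have := norm_add_le (∑ h : Fin (m + 2), coeff m h * f (node m h) -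
    ∑ h : Fin (m + 2), coeff m h * p.eval (node m h))
    (∑ h : Fin (m + 2), coeff m h * p.eval (node m h) - ∫ x in (0 : ℝ)..1, f x)
  rw [sub_add_sub_cancel] at this
  linarith

end Lobatto

/-! ### The Mellin kernel -/

namespace CornerDomain

variable (G : CornerDomain)

/-- The point `-s e^{iχπ}` of the complex plane; as a function of `t`, the Mellin kernel `L(t,s)`
is the imaginary part of the Cauchy kernel with this pole. -/
noncomputable def pole (s : ℝ) : ℂ := -((s : ℂ) * Complex.exp ((G.χ * Real.pi : ℝ) * Complex.I))

theorem pole_re (s : ℝ) : (G.pole s).re = -(s * Real.cos (G.χ * Real.pi)) := by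
  rw [pole, Complex.neg_re, Complex.re_ofReal_mul, Complex.exp_ofReal_mul_I_re]

theorem pole_im (s : ℝ) : (G.pole s).im = -(s * Real.sin (G.χ * Real.pi)) := by
  rw [pole, Complex.neg_im, Complex.im_ofReal_mul, Complex.exp_ofReal_mul_I_im]

theorem kernelL_eq (t s : ℝ) : G.kernelL t s = (((t : ℂ) - G.pole s)⁻¹).im := by
  rw [Complex.inv_im, Complex.normSq_apply, kernelL]
  simp only [Complex.sub_im, Complex.sub_re, Complex.ofReal_re, Complex.ofReal_im, pole_re,
    pole_im]
  have := Real.sin_sq_add_cos_sq (G.χ * Real.pi)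
  congr 1
  · ring
  · linear_combination s ^ 2 * (-this)

theorem kernelL_zero (t : ℝ) : G.kernelL t 0 = 0 := by simp [kernelL]

theorem sin_ne_zero : Real.sin (G.χ * Real.pi) ≠ 0 := by
  have h1 := G.χ_gt
  have h2 := G.χ_lt
  have hpi := Real.pi_pos
  rw [Ne, Real.sin_eq_zero_iff_of_lt_of_lt (by nlinarith) (by nlinarith)]
  exact mul_ne_zero G.χ_ne hpi.ne'

theorem abs_sin_pos : 0 < |Real.sin (G.χ * Real.pi)| := abs_pos.2 G.sin_ne_zero

theorem pole_im_ne_zero {s : ℝ} (hs : s ≠ 0) : (G.pole s).im ≠ 0 := by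
  rw [pole_im]
  exact neg_ne_zero.2 (mul_ne_zero hs G.sin_ne_zero)

theorem sub_pole_ne_zero (t : ℝ) {s : ℝ} (hs : s ≠ 0) : (t : ℂ) - G.pole s ≠ 0 := by
  intro h
  have := congrArg Complex.im h
  simp [G.pole_im_ne_zero hs] at this

theorem sub_pole_mem_slitPlane (t : ℝ) {s : ℝ} (hs : s ≠ 0) :
    (t : ℂ) - G.pole s ∈ Complex.slitPlane := by
  rw [Complex.mem_slitPlane_iff]
  right
  simpa using G.pole_im_ne_zero hs

theorem continuous_pole : Continuous G.pole := by unfold pole; fun_prop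

theorem continuous_kernelL {s : ℝ} (hs : s ≠ 0) : Continuous fun t => G.kernelL t s := by
  simp only [kernelL_eq]
  exact Complex.continuous_im.comp ((by fun_prop : Continuous fun t : ℝ => (t : ℂ) - G.pole s).inv₀
    fun t => G.sub_pole_ne_zero t hs)

theorem continuous_kernelL_left (s : ℝ) : Continuous fun t => G.kernelL t s := by
  rcases eq_or_ne s 0 with rfl | hs
  · simp only [kernelL_zero]; exact continuous_const
  · exact G.continuous_kernelL hs

theorem continuousOn_kernelL_right (t : ℝ) : ContinuousOn (fun s => G.kernelL t s) {0}ᶜ := by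
  simp only [kernelL_eq]
  refine Complex.continuous_im.comp_continuousOn (ContinuousOn.inv₀ ?_ fun s hs =>
    G.sub_pole_ne_zero t hs)
  exact (continuous_const.sub G.continuous_pole).continuousOn

theorem integral_kernelL {s : ℝ} (hs : 0 < s) :
    ∫ t in (0 : ℝ)..1, G.kernelL t s = Complex.arg (1 - G.pole s) - G.χ * Real.pi := by
  have hd : ∀ t ∈ uIcc (0 : ℝ) 1, HasDerivAt (fun t : ℝ => Complex.log ((t : ℂ) - G.pole s))
      (1 / ((t : ℂ) - G.pole s)) t := fun t _ =>
    ((Complex.ofRealCLM.hasDerivAt (x := t)).sub_const _).clog_real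
      (G.sub_pole_mem_slitPlane t hs.ne')
  have hc : Continuous fun t : ℝ => ((t : ℂ) - G.pole s)⁻¹ :=
    (by fun_prop : Continuous fun t : ℝ => (t : ℂ) - G.pole s).inv₀
      fun t => G.sub_pole_ne_zero t hs.ne'
  simp only [one_div] at hd
  have h := intervalIntegral.integral_eq_sub_of_hasDerivAt hd (hc.intervalIntegrable _ _)
  have him := Complex.imCLM.intervalIntegral_comp_comm (hc.intervalIntegrable
    (μ := MeasureTheory.volume) 0 1)
  simp only [Complex.imCLM_apply] at him
  simp only [kernelL_eq]
  rw [him, h, Complex.sub_im, Complex.log_im, Complex.log_im]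
  have harg : Complex.arg (((0 : ℝ) : ℂ) - G.pole s) = G.χ * Real.pi := by
    have h1 := G.χ_gt
    have h2 := G.χ_lt
    have hpi := Real.pi_pos
    rw [pole, Complex.ofReal_zero, zero_sub, neg_neg, Complex.arg_real_mul _ hs,
      Complex.exp_mul_I, Complex.arg_cos_add_sin_mul_I]
    constructor <;> nlinarith
  rw [harg, Complex.ofReal_one]

/-- The kernel has constant sign. -/
theorem abs_kernelL {s : ℝ} (hs : 0 < s) (t : ℝ) :
    |G.kernelL t s| = -SignType.sign (Real.sin (G.χ * Real.pi)) * G.kernelL t s := by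
  have hD : 0 ≤ s ^ 2 + 2 * t * s * Real.cos (G.χ * Real.pi) + t ^ 2 := by
    have := Real.sin_sq_add_cos_sq (G.χ * Real.pi)
    nlinarith [sq_nonneg (t + s * Real.cos (G.χ * Real.pi)),
      sq_nonneg (s * Real.sin (G.χ * Real.pi))]
  rw [kernelL, abs_div, abs_of_nonneg hD, abs_neg, abs_mul, abs_of_pos hs]
  rcases lt_or_gt_of_ne G.sin_ne_zero with h | h
  · simp [sign_neg h, abs_of_neg h]
  · simp [sign_pos h, abs_of_pos h, neg_div]

/-- The two angles whose difference is the integral of the kernel have the same sign. -/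
theorem integral_abs_kernelL_le {s : ℝ} (hs : 0 < s) :
    ∫ t in (0 : ℝ)..1, |G.kernelL t s| ≤ |G.χ| * Real.pi := by
  simp only [G.abs_kernelL hs]
  rw [intervalIntegral.integral_const_mul, G.integral_kernelL hs]
  have hpi := Real.pi_pos
  have h1 := G.χ_gt
  have h2 := G.χ_lt
  have him : (1 - G.pole s).im = s * Real.sin (G.χ * Real.pi) := by simp [pole_im]
  rcases lt_or_gt_of_ne G.χ_ne with h | h
  · have hsin : Real.sin (G.χ * Real.pi) < 0 :=
      Real.sin_neg_of_neg_of_neg_pi_lt (by nlinarith) (by nlinarith)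
    have harg : Complex.arg (1 - G.pole s) < 0 := by
      rw [Complex.arg_neg_iff, him]; nlinarith
    rw [sign_neg hsin, abs_of_neg h, SignType.coe_neg_one]
    linarith
  · have hsin : 0 < Real.sin (G.χ * Real.pi) :=
      Real.sin_pos_of_pos_of_lt_pi (by nlinarith) (by nlinarith)
    have harg : 0 ≤ Complex.arg (1 - G.pole s) := by
      rw [Complex.arg_nonneg_iff, him]; positivity
    rw [sign_pos hsin, abs_of_pos h, SignType.coe_one]
    linarith

theorem intervalIntegrable_kernelL_mul (s : ℝ) {f : ℝ → ℝ} (hf : ContinuousOn f (Icc 0 1)) :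
    IntervalIntegrable (fun t => G.kernelL t s * f t) MeasureTheory.volume 0 1 :=
  ((G.continuous_kernelL_left s).continuousOn.mul hf).intervalIntegrable_of_Icc zero_le_one

theorem abs_opL_le {s : ℝ} (hs : 0 < s) {f : ℝ → ℝ} (hf : ContinuousOn f (Icc 0 1)) {C : ℝ}
    (hC : ∀ t ∈ Icc (0 : ℝ) 1, |f t| ≤ C) : |G.opL f s| ≤ |G.χ| * Real.pi * C := by
  have hC0 : 0 ≤ C := (abs_nonneg _).trans (hC 0 (by simp))
  calc |G.opL f s| ≤ ∫ t in (0 : ℝ)..1, |G.kernelL t s * f t| :=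
        intervalIntegral.abs_integral_le_integral_abs zero_le_one
    _ ≤ ∫ t in (0 : ℝ)..1, |G.kernelL t s| * C := by
        refine intervalIntegral.integral_mono_on zero_le_one
          (G.intervalIntegrable_kernelL_mul s hf).abs
          (((G.continuous_kernelL_left s).abs.mul continuous_const).intervalIntegrable _ _)
          fun t ht => ?_
        rw [abs_mul]
        exact mul_le_mul_of_nonneg_left (hC t ht) (abs_nonneg _)
    _ ≤ |G.χ| * Real.pi * C := by
        rw [intervalIntegral.integral_mul_const]
        exact mul_le_mul_of_nonneg_right (G.integral_abs_kernelL_le hs) hC0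

theorem opL_zero (f : ℝ → ℝ) : G.opL f 0 = 0 := by simp [opL, kernelL_zero]

theorem continuousOn_opL {f : ℝ → ℝ} (hf : Continuous f) : ContinuousOn (G.opL f) (Ioi 0) := by
  intro s₀ (hs₀ : 0 < s₀)
  refine ContinuousAt.continuousWithinAt ?_
  -- near `s₀` the operator agrees with one whose kernel is continuous everywhere
  have hc : Continuous fun s => G.opL f (max s (s₀ / 2)) := by
    unfold opL
    refine intervalIntegral.continuous_parametric_intervalIntegral_of_continuous'
      (f := fun s t => G.kernelL t (max s (s₀ / 2)) * f t) ?_ 0 1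
    simp only [kernelL_eq]
    refine (Complex.continuous_im.comp (Continuous.inv₀ ?_ ?_)).mul (hf.comp continuous_snd)
    · exact (Complex.continuous_ofReal.comp continuous_snd).sub (G.continuous_pole.comp
        (continuous_fst.max continuous_const))
    · rintro ⟨s, t⟩
      exact G.sub_pole_ne_zero t (lt_max_of_lt_right (by positivity)).ne'
  refine hc.continuousAt.congr ?_
  filter_upwards [lt_mem_nhds (show s₀ / 2 < s₀ by linarith)] with s hs
  rw [max_eq_left hs.le]

theorem sq_mul_abs_kernelL_le {s t : ℝ} (hs : 0 < s) :
    t ^ 2 * |G.kernelL t s| ≤ s / |Real.sin (G.χ * Real.pi)| := by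
  set S := Real.sin (G.χ * Real.pi)
  have hS := G.abs_sin_pos
  have hS2 : |S| ^ 2 = S ^ 2 := sq_abs S
  have h1 := Real.sin_sq_add_cos_sq (G.χ * Real.pi)
  have hD : t ^ 2 * S ^ 2 ≤ s ^ 2 + 2 * t * s * Real.cos (G.χ * Real.pi) + t ^ 2 := by
    nlinarith [sq_nonneg (s + t * Real.cos (G.χ * Real.pi))]
  have hD0 : 0 < s ^ 2 + 2 * t * s * Real.cos (G.χ * Real.pi) + t ^ 2 := by
    have : 0 < s ^ 2 * S ^ 2 := by have := sq_pos_of_pos hS; rw [hS2] at this; positivity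
    nlinarith [sq_nonneg (t + s * Real.cos (G.χ * Real.pi))]
  rw [kernelL, abs_div, abs_of_pos hD0, abs_neg, abs_mul, abs_of_pos hs, ← mul_div_assoc,
    div_le_div_iff₀ hD0 hS]
  have : t ^ 2 * (s * |S|) * |S| = s * (t ^ 2 * S ^ 2) := by rw [← hS2]; ring
  rw [this]
  exact mul_le_mul_of_nonneg_left hD hs.le

/-- The mass of the kernel concentrates at `t = 0` as `s → 0`. -/
theorem tendsto_opL {f : ℝ → ℝ} (hf : Continuous f) :
    Tendsto (G.opL f) (𝓝[>] 0) (𝓝 (-(G.χ * Real.pi) * f 0)) := by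
  -- the limit for `f = 1` is the limit of an argument
  have hone : Tendsto (fun s => ∫ t in (0 : ℝ)..1, G.kernelL t s) (𝓝[>] 0)
      (𝓝 (-(G.χ * Real.pi))) := by
    have h1 : Tendsto (fun s => Complex.arg (1 - G.pole s) - G.χ * Real.pi) (𝓝 0)
        (𝓝 (-(G.χ * Real.pi))) := by
      have hc : ContinuousAt (fun s => Complex.arg (1 - G.pole s)) 0 := by
        refine ContinuousAt.comp (f := fun s => 1 - G.pole s) (g := Complex.arg)
          (Complex.continuousAt_arg ?_) (continuous_const.sub G.continuous_pole).continuousAt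
        simp [pole]
      have := hc.tendsto.sub_const (G.χ * Real.pi)
      simpa [pole] using this
    refine (h1.mono_left nhdsWithin_le_nhds).congr' ?_
    filter_upwards [self_mem_nhdsWithin] with s hs
    exact (G.integral_kernelL hs).symm
  have hdiff : Tendsto (fun s => G.opL (fun t => f t - f 0) s) (𝓝[>] 0) (𝓝 0) := by
    rw [Metric.tendsto_nhds]
    intro ε hε
    have hpi := Real.pi_pos
    set η := ε / (2 * (|G.χ| * Real.pi + 1)) with hη
    have hη0 : 0 < η := by positivity
    obtain ⟨δ, hδ, hδf⟩ := Metric.continuousAt_iff.1 (hf.continuousAt (x := (0 : ℝ))) η hη0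
    obtain ⟨B, hB⟩ := isCompact_Icc.exists_bound_of_continuousOn (s := Icc (0 : ℝ) 1)
      (f := fun t => f t - f 0) (by fun_prop)
    have hB0 : 0 ≤ B := (norm_nonneg _).trans (hB 0 (by simp))
    set S := |Real.sin (G.χ * Real.pi)| with hS
    have hS0 : 0 < S := G.abs_sin_pos
    -- a pointwise bound that is small near `0` and integrates to `O(s)` away from `0`
    have hpt : ∀ t ∈ Icc (0 : ℝ) 1, |f t - f 0| ≤ η + B / δ ^ 2 * t ^ 2 := by
      intro t ht
      rcases lt_or_ge t δ with h | h
      · have := hδf (x := t) (by rwa [Real.dist_eq, sub_zero, abs_of_nonneg ht.1])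
        rw [Real.dist_eq] at this
        have : 0 ≤ B / δ ^ 2 * t ^ 2 := by positivity
        linarith
      · have h1 := hB t ht
        rw [Real.norm_eq_abs] at h1
        have h2 : B ≤ B / δ ^ 2 * t ^ 2 := by
          rw [div_mul_eq_mul_div, le_div_iff₀ (by positivity)]
          exact mul_le_mul_of_nonneg_left (pow_le_pow_left₀ hδ.le h 2) hB0
        linarith
    have hsmall : ∀ᶠ s in 𝓝[>] (0 : ℝ), B / δ ^ 2 * (s / S) < ε / 2 := by
      have : Tendsto (fun s : ℝ => B / δ ^ 2 * (s / S)) (𝓝 0) (𝓝 (B / δ ^ 2 * (0 / S))) :=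
        (by fun_prop : Continuous fun s : ℝ => B / δ ^ 2 * (s / S)).tendsto 0
      rw [zero_div, mul_zero] at this
      exact (this.mono_left nhdsWithin_le_nhds).eventually (gt_mem_nhds (by positivity))
    filter_upwards [self_mem_nhdsWithin, hsmall] with s (hs : 0 < s) hs2
    rw [Real.dist_eq, sub_zero]
    have hk : Continuous fun t => |G.kernelL t s| := (G.continuous_kernelL_left s).abs
    calc |G.opL (fun t => f t - f 0) s|
        ≤ ∫ t in (0 : ℝ)..1, |G.kernelL t s * (f t - f 0)| :=
          intervalIntegral.abs_integral_le_integral_abs zero_le_one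
      _ ≤ ∫ t in (0 : ℝ)..1, (η * |G.kernelL t s| + B / δ ^ 2 * (s / S)) := by
          refine intervalIntegral.integral_mono_on zero_le_one ?_ ?_ fun t ht => ?_
          · exact ((G.continuous_kernelL_left s).mul
              (hf.sub continuous_const)).abs.intervalIntegrable _ _
          · exact ((hk.const_mul η).add continuous_const).intervalIntegrable _ _
          · have h1 := mul_le_mul_of_nonneg_left (hpt t ht) (abs_nonneg (G.kernelL t s))
            have h2 := mul_le_mul_of_nonneg_left (G.sq_mul_abs_kernelL_le (t := t) hs)
              (show 0 ≤ B / δ ^ 2 by positivity)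
            rw [abs_mul]
            linarith
      _ = η * (∫ t in (0 : ℝ)..1, |G.kernelL t s|) + B / δ ^ 2 * (s / S) := by
          rw [intervalIntegral.integral_add ((hk.const_mul η).intervalIntegrable _ _)
            (continuous_const.intervalIntegrable _ _), intervalIntegral.integral_const_mul]
          simp
      _ < ε := by
          have h1 := mul_le_mul_of_nonneg_left (G.integral_abs_kernelL_le hs) hη0.le
          have h2 : η * (|G.χ| * Real.pi) ≤ ε / 2 := by
            rw [hη, div_mul_eq_mul_div, div_le_div_iff₀ (by positivity) two_pos]
            nlinarith [abs_nonneg G.χ]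
          linarith
  have := (hone.mul_const (f 0)).add hdiff
  rw [add_zero] at this
  refine this.congr fun s => ?_
  unfold opL
  rw [← intervalIntegral.integral_mul_const, ← intervalIntegral.integral_add]
  · congr 1; ext t; ring
  · exact ((G.continuous_kernelL_left s).mul continuous_const).intervalIntegrable _ _
  · exact ((G.continuous_kernelL_left s).mul (hf.sub continuous_const)).intervalIntegrable _ _

end CornerDomain

/-! ### The quadrature error for the Mellin kernel -/

namespace Lobatto

open Polynomial

theorem quadrature_exact_complex {m : ℕ} (hm : 1 ≤ m) {q : ℂ[X]} (hq : q.natDegree ≤ 2 * m + 1) :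
    ∑ h : Fin (m + 2), coeff m h • q.eval ((node m h : ℝ) : ℂ) =
      ∫ x in (0 : ℝ)..1, q.eval (x : ℂ) := by
  have hpow : ∀ i ∈ Finset.range (2 * m + 2), ∑ h : Fin (m + 2),
      coeff m h • ((node m h : ℝ) : ℂ) ^ i = ∫ x in (0 : ℝ)..1, (x : ℂ) ^ i := by
    intro i hi
    rw [Finset.mem_range] at hi
    have := quadrature_exact hm (f := X ^ i) (by rw [natDegree_X_pow]; omega)
    simp only [integral01_apply, eval_pow, eval_X] at this
    have h2 := congrArg (fun r : ℝ => (r : ℂ)) this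
    rw [← intervalIntegral.integral_ofReal] at h2
    push_cast at h2
    simpa using h2
  simp only [eval_eq_sum_range' (show q.natDegree < 2 * m + 2 by omega), Finset.smul_sum]
  rw [Finset.sum_comm, intervalIntegral.integral_finsetSum]
  · refine Finset.sum_congr rfl fun i hi => ?_
    rw [intervalIntegral.integral_const_mul, ← hpow i hi, Finset.mul_sum]
    refine Finset.sum_congr rfl fun h _ => ?_
    rw [mul_smul_comm]
  · intro i _
    exact (by fun_prop : Continuous fun x : ℝ => q.coeff i * (x : ℂ) ^ i).intervalIntegrable _ _

/-- The error of the Lobatto rule for `p(t) / (t - z)`: modulo a polynomial of degree at most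
`2m + 1` this function is a multiple of `U(t) / (t - z)`, for any polynomial `U` with
`U(z) ≠ 0`. -/
theorem quadrature_cauchy_error {m : ℕ} (hm : 1 ≤ m) {p U : ℂ[X]} (hp : p.natDegree ≤ 2 * m + 2)
    (hU : U.natDegree ≤ 2 * m + 2) {z : ℂ} (hz : z.im ≠ 0) (hUz : U.eval z ≠ 0)
    (hU1 : ∀ t ∈ Icc (0 : ℝ) 1, ‖U.eval (t : ℂ)‖ ≤ 1) :
    ‖∑ h : Fin (m + 2), coeff m h • (p.eval ((node m h : ℝ) : ℂ) * ((node m h : ℝ) - z)⁻¹) -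
      ∫ t in (0 : ℝ)..1, p.eval (t : ℂ) * ((t : ℂ) - z)⁻¹‖ ≤
      2 * (‖p.eval z‖ / (‖U.eval z‖ * |z.im|)) := by
  set a := p.eval z / U.eval z with ha
  obtain ⟨q, hq⟩ : X - C z ∣ p - C a * U := by
    rw [dvd_iff_isRoot, IsRoot, eval_sub, eval_mul, eval_C, ha, div_mul_cancel₀ _ hUz, sub_self]
  have hqdeg : q.natDegree ≤ 2 * m + 1 := by
    rcases eq_or_ne q 0 with rfl | hq0
    · simp
    have h1 := natDegree_mul (X_sub_C_ne_zero z) hq0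
    have h2 := natDegree_sub_le_of_le hp ((natDegree_C_mul_le a U).trans hU)
    rw [← hq, natDegree_X_sub_C] at h1
    omega
  have hne : ∀ t : ℝ, (t : ℂ) - z ≠ 0 := fun t h => by
    have := congrArg Complex.im h
    simp [hz] at this
  have hdec : ∀ t : ℝ, p.eval (t : ℂ) * ((t : ℂ) - z)⁻¹ =
      q.eval (t : ℂ) + a * U.eval (t : ℂ) * ((t : ℂ) - z)⁻¹ := by
    intro t
    have h := congrArg (eval (t : ℂ)) hq
    simp only [eval_sub, eval_mul, eval_C, eval_X] at h
    have := hne t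
    field_simp
    linear_combination h
  set B := ‖p.eval z‖ / (‖U.eval z‖ * |z.im|) with hB
  have hbound : ∀ t ∈ Icc (0 : ℝ) 1, ‖a * U.eval (t : ℂ) * ((t : ℂ) - z)⁻¹‖ ≤ B := by
    intro t ht
    have h1 : |z.im| ≤ ‖(t : ℂ) - z‖ := by
      have := Complex.abs_im_le_norm ((t : ℂ) - z)
      simpa using this
    have h2 : 0 < |z.im| := abs_pos.2 hz
    rw [norm_mul, norm_mul, norm_inv, ha, norm_div, hB, ← div_div, div_eq_mul_inv _ |z.im|]
    have := mul_le_mul_of_nonneg_left (hU1 t ht)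
      (show 0 ≤ ‖p.eval z‖ / ‖U.eval z‖ by positivity)
    rw [mul_one] at this
    exact mul_le_mul this (inv_anti₀ h2 h1) (by positivity) (by positivity)
  have hint1 : Continuous fun t : ℝ => q.eval (t : ℂ) := by fun_prop
  have hint2 : Continuous fun t : ℝ => a * U.eval (t : ℂ) * ((t : ℂ) - z)⁻¹ :=
    (by fun_prop : Continuous fun t : ℝ => a * U.eval (t : ℂ)).mul
      ((by fun_prop : Continuous fun t : ℝ => (t : ℂ) - z).inv₀ hne)
  simp only [hdec, smul_add, Finset.sum_add_distrib]
  rw [intervalIntegral.integral_add (hint1.intervalIntegrable _ _) (hint2.intervalIntegrable _ _),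
    quadrature_exact_complex hm hqdeg, add_sub_add_left_eq_sub]
  have h1 := norm_quadrature_le (f := fun t : ℝ => a * U.eval (t : ℂ) * ((t : ℂ) - z)⁻¹) hm hbound
  have h2 := intervalIntegral.norm_integral_le_of_norm_le_const (a := (0 : ℝ)) (b := 1)
    (f := fun t : ℝ => a * U.eval (t : ℂ) * ((t : ℂ) - z)⁻¹) (C := B) fun t ht => by
      rw [uIoc_of_le zero_le_one] at ht
      exact hbound t (Ioc_subset_Icc_self ht)
  rw [sub_zero, abs_one, mul_one] at h2
  have := norm_sub_le (∑ h : Fin (m + 2), coeff m h •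
    (a * U.eval ((node m h : ℝ) : ℂ) * (((node m h : ℝ) : ℂ) - z)⁻¹))
    (∫ t in (0 : ℝ)..1, a * U.eval (t : ℂ) * ((t : ℂ) - z)⁻¹)
  linarith

end Lobatto

theorem Complex.sinh_abs_im_le_norm_cos (ζ : ℂ) : Real.sinh |ζ.im| ≤ ‖Complex.cos ζ‖ := by
  refine abs_le_of_sq_le_sq' ?_ (norm_nonneg _) |>.2
  have h : Complex.cos ζ = ⟨Real.cos ζ.re * Real.cosh ζ.im, -(Real.sin ζ.re * Real.sinh ζ.im)⟩ := by
    rw [Complex.cos_eq]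
    apply Complex.ext <;> simp [← Complex.ofReal_cos, ← Complex.ofReal_sin, ← Complex.ofReal_cosh,
      ← Complex.ofReal_sinh]
  rw [← Complex.normSq_eq_norm_sq, h, Complex.normSq_mk, ← Real.abs_sinh, sq_abs]
  have h1 := Real.sin_sq_add_cos_sq ζ.re
  have h2 := Real.cosh_sq ζ.im
  nlinarith [sq_nonneg (Real.cos ζ.re)]

theorem Complex.abs_im_cos_le (ζ : ℂ) : |(Complex.cos ζ).im| ≤ Real.sinh |ζ.im| := by
  have h : (Complex.cos ζ).im = -(Real.sin ζ.re * Real.sinh ζ.im) := by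
    rw [Complex.cos_eq]
    simp [← Complex.ofReal_cos, ← Complex.ofReal_sin, ← Complex.ofReal_cosh,
      ← Complex.ofReal_sinh]
  rw [h, abs_neg, abs_mul, Real.abs_sinh]
  have h0 : 0 ≤ Real.sinh |ζ.im| := Real.sinh_nonneg_iff.2 (abs_nonneg _)
  nlinarith [Real.abs_sin_le_one ζ.re]

theorem Real.sinh_le_two_mul {x : ℝ} (h0 : 0 ≤ x) (h1 : x ≤ 1) : Real.sinh x ≤ 2 * x := by
  have h2 := Real.abs_exp_sub_one_le (x := x) (by rwa [abs_of_nonneg h0])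
  rw [abs_of_nonneg h0] at h2
  have h3 := Real.add_one_le_exp (-x)
  have h4 := le_abs_self (Real.exp x - 1)
  rw [Real.sinh_eq]
  linarith

open Polynomial in
/-- The Chebyshev polynomial of `[0,1]` of degree `m` grows exponentially in `m |Im w|` at the
point `w²`, because `2w² - 1 = cos 2θ` if `w = cos θ`. -/
theorem Polynomial.Chebyshev.sinh_le_norm_eval (m : ℕ) {w : ℂ} (hw : |w.im| ≤ 1) :
    Real.sinh (m * |w.im|) ≤ ‖(Chebyshev.T ℂ m).eval (2 * w ^ 2 - 1)‖ := by
  obtain ⟨θ, rfl⟩ := Complex.cos_surjective w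
  rw [← Complex.cos_two_mul, Chebyshev.T_complex_cos]
  refine le_trans ?_ (Complex.sinh_abs_im_le_norm_cos _)
  rw [Real.sinh_le_sinh]
  have h1 := Complex.abs_im_cos_le θ
  have h2 : |(Complex.cos θ).im| ≤ 2 * |θ.im| := by
    rcases le_or_gt |θ.im| 1 with h | h
    · exact h1.trans (Real.sinh_le_two_mul (abs_nonneg _) h)
    · linarith
  have h3 : (((m : ℤ) : ℂ) * (2 * θ)).im = m * (2 * θ.im) := by simp
  rw [h3, abs_mul, abs_mul, Nat.abs_cast, abs_two]
  exact mul_le_mul_of_nonneg_left h2 (Nat.cast_nonneg m)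

namespace CornerDomain

open Polynomial

variable (G : CornerDomain)

/-- The cosine of half the angle `χπ`: the square root of the pole at distance `s` from the corner
has imaginary part `halfCos * √s`. -/
noncomputable def halfCos : ℝ := Real.cos (G.χ * Real.pi / 2)

theorem halfCos_pos : 0 < G.halfCos := by
  have hpi := Real.pi_pos
  have h1 := G.χ_gt
  have h2 := G.χ_lt
  exact Real.cos_pos_of_mem_Ioo ⟨by nlinarith, by nlinarith⟩

theorem pole_eq_sq {s : ℝ} (hs : 0 ≤ s) :
    ∃ w : ℂ, w ^ 2 = G.pole s ∧ w.im = G.halfCos * √s := by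
  refine ⟨Complex.I * ((√s : ℝ) * Complex.exp ((G.χ * Real.pi / 2 : ℝ) * Complex.I)), ?_, ?_⟩
  · rw [mul_pow, mul_pow, Complex.I_sq, ← Complex.ofReal_pow, Real.sq_sqrt hs, ← Complex.exp_nat_mul,
      pole]
    push_cast
    rw [neg_one_mul]
    congr 3
    ring
  · rw [Complex.I_mul_im, Complex.re_ofReal_mul, Complex.exp_ofReal_mul_I_re, halfCos, mul_comm]

/-- The error of the discrete Mellin operator on polynomials. -/
theorem abs_opLm_sub_opL_le {m : ℕ} (hm : 1 ≤ m) {p : ℝ[X]} (hp : p.natDegree ≤ 2 * m + 2)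
    {s : ℝ} (hs : 0 < s) (hs1 : s ≤ 1) :
    |G.opLm m (fun t => p.eval t) s - G.opL (fun t => p.eval t) s| ≤
      2 * (‖(p.map (algebraMap ℝ ℂ)).eval (G.pole s)‖ /
        (Real.sinh (m * (G.halfCos * √s)) * (s * |Real.sin (G.χ * Real.pi)|))) := by
  have hκ := G.halfCos_pos
  have hκ1 : G.halfCos ≤ 1 := Real.cos_le_one _
  have hsqrt : 0 < √s := Real.sqrt_pos.2 hs
  have hsqrt1 : √s ≤ 1 := Real.sqrt_le_one.2 hs1
  obtain ⟨w, hw2, hwim⟩ := G.pole_eq_sq hs.le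
  have hwabs : |w.im| = G.halfCos * √s := by rw [hwim, abs_of_pos (by positivity)]
  set U : ℂ[X] := (Chebyshev.T ℂ m).comp (C 2 * X - C 1) with hU
  have hUdeg : U.natDegree ≤ 2 * m + 2 := by
    have h1 : (C 2 * X - C 1 : ℂ[X]).natDegree ≤ 1 := by compute_degree
    have h2 := natDegree_comp_le (p := Chebyshev.T ℂ m) (q := C 2 * X - C 1)
    rw [Chebyshev.natDegree_T, Int.natAbs_natCast] at h2
    exact h2.trans ((Nat.mul_le_mul_left m h1).trans (by omega))
  have hUeval : ∀ x : ℂ, U.eval x = (Chebyshev.T ℂ m).eval (2 * x - 1) := by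
    intro x; simp [hU]
  have hU1 : ∀ t ∈ Icc (0 : ℝ) 1, ‖U.eval (t : ℂ)‖ ≤ 1 := by
    intro t ht
    have e : (2 * (t : ℂ) - 1) = ((2 * t - 1 : ℝ) : ℂ) := by push_cast; ring
    rw [hUeval, e, ← Chebyshev.complex_ofReal_eval_T, Complex.norm_real, Real.norm_eq_abs]
    exact Chebyshev.abs_eval_T_real_le_one _ (abs_le.2 ⟨by linarith [ht.1], by linarith [ht.2]⟩)
  have hsinh : Real.sinh (m * (G.halfCos * √s)) ≤ ‖U.eval (G.pole s)‖ := by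
    rw [hUeval, ← hw2, ← hwabs]
    refine Chebyshev.sinh_le_norm_eval m ?_
    rw [hwabs]
    exact mul_le_one₀ hκ1 hsqrt.le hsqrt1
  have hm0 : (0 : ℝ) < m := by exact_mod_cast hm
  have hsinh0 : 0 < Real.sinh (m * (G.halfCos * √s)) := Real.sinh_pos_iff.2 (by positivity)
  have hUz : U.eval (G.pole s) ≠ 0 := norm_pos_iff.1 (hsinh0.trans_le hsinh)
  have him : |(G.pole s).im| = s * |Real.sin (G.χ * Real.pi)| := by
    rw [pole_im, abs_neg, abs_mul, abs_of_pos hs]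
  have hreal : ∀ t : ℝ, (p.map (algebraMap ℝ ℂ)).eval (t : ℂ) = (p.eval t : ℝ) := fun t => by
    rw [eval_map]; exact eval₂_at_apply (algebraMap ℝ ℂ) t
  have herr := Lobatto.quadrature_cauchy_error hm (p := p.map (algebraMap ℝ ℂ))
    (natDegree_map_le.trans hp) hUdeg (G.pole_im_ne_zero hs.ne') hUz hU1
  have himpart : ∀ t : ℝ, G.kernelL t s * p.eval t =
      (((p.map (algebraMap ℝ ℂ)).eval (t : ℂ)) * ((t : ℂ) - G.pole s)⁻¹).im := by
    intro t
    rw [hreal, Complex.im_ofReal_mul, kernelL_eq, mul_comm]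
  have hLm : G.opLm m (fun t => p.eval t) s = (∑ h : Fin (m + 2), Lobatto.coeff m h •
      ((p.map (algebraMap ℝ ℂ)).eval ((Lobatto.node m h : ℝ) : ℂ) *
        ((Lobatto.node m h : ℝ) - G.pole s)⁻¹)).im := by
    rw [opLm, Complex.im_sum]
    refine Finset.sum_congr rfl fun h _ => ?_
    rw [Complex.smul_im, smul_eq_mul, ← himpart, mul_assoc]
  have hcont : Continuous fun t : ℝ => (p.map (algebraMap ℝ ℂ)).eval (t : ℂ) *
      ((t : ℂ) - G.pole s)⁻¹ :=
    (by fun_prop : Continuous fun t : ℝ => (p.map (algebraMap ℝ ℂ)).eval (t : ℂ)).mul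
      ((by fun_prop : Continuous fun t : ℝ => (t : ℂ) - G.pole s).inv₀
        fun t => G.sub_pole_ne_zero t hs.ne')
  have hL : G.opL (fun t => p.eval t) s = (∫ t in (0 : ℝ)..1,
      (p.map (algebraMap ℝ ℂ)).eval (t : ℂ) * ((t : ℂ) - G.pole s)⁻¹).im := by
    have := Complex.imCLM.intervalIntegral_comp_comm
      (hcont.intervalIntegrable (μ := MeasureTheory.volume) 0 1)
    simp only [Complex.imCLM_apply, ← himpart] at this
    exact this
  rw [hLm, hL, ← Complex.sub_im]
  refine (Complex.abs_im_le_norm _).trans (herr.trans ?_)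
  rw [him]
  have hS := G.abs_sin_pos
  gcongr

theorem threshold_pos {c : ℝ} (hc : 0 < c) (ε : ℝ) {m : ℕ} (hm : 1 ≤ m) :
    0 < threshold c ε m := by
  have : (0 : ℝ) < m := by exact_mod_cast hm
  unfold threshold
  positivity

theorem tendsto_threshold (c : ℝ) {ε : ℝ} (hε : ε < 1) :
    Tendsto (threshold c ε) atTop (𝓝 0) := by
  have h := (tendsto_rpow_atTop (show 0 < 2 - 2 * ε by linarith)).comp
    (tendsto_natCast_atTop_atTop (R := ℝ))
  exact h.const_div_atTop c

/-- The threshold is large enough for the growth of the Chebyshev polynomials, as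
`m √(threshold) = √c m^ε`. -/
theorem tendsto_inv_threshold_mul_sinh {κ c ε : ℝ} (hκ : 0 < κ) (hc : 0 < c) (hε : 0 < ε) :
    Tendsto (fun m : ℕ => (threshold c ε m * Real.sinh (m * (κ * √(threshold c ε m))))⁻¹) atTop
      (𝓝 0) := by
  set b := κ * √c with hb
  have hb0 : 0 < b := by positivity
  have hlim : Tendsto (fun m : ℕ => 4 / c * (((m : ℝ) ^ ε) ^ ((2 - 2 * ε) / ε) *
      Real.exp (-b * (m : ℝ) ^ ε))) atTop (𝓝 0) := by
    have h1 := (tendsto_rpow_mul_exp_neg_mul_atTop_nhds_zero ((2 - 2 * ε) / ε) b hb0).comp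
      ((tendsto_rpow_atTop hε).comp (tendsto_natCast_atTop_atTop (R := ℝ)))
    have := h1.const_mul (4 / c)
    rw [mul_zero] at this
    exact this
  have hlarge : ∀ᶠ m : ℕ in atTop, 1 ≤ b * (m : ℝ) ^ ε :=
    (((tendsto_rpow_atTop hε).comp (tendsto_natCast_atTop_atTop (R := ℝ))).const_mul_atTop
      hb0).eventually_ge_atTop 1
  refine squeeze_zero' ?_ ?_ hlim
  · filter_upwards [eventually_ge_atTop 1] with m hm
    have := threshold_pos hc ε hm
    have : 0 ≤ Real.sinh (m * (κ * √(threshold c ε m))) := Real.sinh_nonneg_iff.2 (by positivity)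
    positivity
  · filter_upwards [eventually_ge_atTop 1, hlarge] with m hm hm1
    have hm0 : (0 : ℝ) < m := by exact_mod_cast hm
    have harg : m * (κ * √(threshold c ε m)) = b * (m : ℝ) ^ ε := by
      have : √(threshold c ε m) = √c / (m : ℝ) ^ (1 - ε) := by
        rw [threshold, Real.sqrt_div hc.le, show 2 - 2 * ε = (1 - ε) * 2 by ring,
          Real.rpow_mul hm0.le, Real.rpow_two, Real.sqrt_sq (by positivity)]
      rw [this, Real.rpow_sub hm0, Real.rpow_one, hb]
      field_simp
    rw [harg, ← Real.rpow_mul hm0.le, mul_div_cancel₀ _ hε.ne', threshold]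
    have hsinh : Real.exp (b * (m : ℝ) ^ ε) / 4 ≤ Real.sinh (b * (m : ℝ) ^ ε) := by
      rw [Real.sinh_eq]
      have h1 : Real.exp (-(b * (m : ℝ) ^ ε)) ≤ 1 := Real.exp_le_one_iff.2 (by linarith)
      have h2 : (2 : ℝ) ≤ Real.exp (b * (m : ℝ) ^ ε) := by
        linarith [Real.add_one_le_exp (b * (m : ℝ) ^ ε)]
      linarith
    have hx : (0 : ℝ) < (m : ℝ) ^ (2 - 2 * ε) := by positivity
    calc (c / (m : ℝ) ^ (2 - 2 * ε) * Real.sinh (b * (m : ℝ) ^ ε))⁻¹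
        ≤ (c / (m : ℝ) ^ (2 - 2 * ε) * (Real.exp (b * (m : ℝ) ^ ε) / 4))⁻¹ := by gcongr
      _ = 4 / c * ((m : ℝ) ^ (2 - 2 * ε) * Real.exp (-b * (m : ℝ) ^ ε)) := by
          rw [neg_mul, Real.exp_neg]
          field_simp

/-- The discrete Mellin operators converge uniformly beyond the threshold, for every polynomial. -/
theorem opLm_error_polynomial {c ε : ℝ} (hc : 0 < c) (hε : 0 < ε) (p : ℝ[X])
    {η : ℝ} (hη : 0 < η) : ∀ᶠ m : ℕ in atTop, ∀ s ∈ Icc (threshold c ε m) 1,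
      |G.opLm m (fun t => p.eval t) s - G.opL (fun t => p.eval t) s| ≤ η := by
  have hκ := G.halfCos_pos
  have hS := G.abs_sin_pos
  obtain ⟨B, hB⟩ := isCompact_Icc.exists_bound_of_continuousOn (s := Icc (0 : ℝ) 1)
    (f := fun s => (p.map (algebraMap ℝ ℂ)).eval (G.pole s))
    ((p.map (algebraMap ℝ ℂ)).continuous.comp G.continuous_pole).continuousOn
  have hB0 : 0 ≤ B := (norm_nonneg _).trans (hB 0 (by simp))
  have hlim := (tendsto_inv_threshold_mul_sinh hκ hc hε).const_mul
    (2 * B / |Real.sin (G.χ * Real.pi)|)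
  rw [mul_zero] at hlim
  filter_upwards [hlim.eventually (gt_mem_nhds hη), eventually_ge_atTop 1,
    eventually_ge_atTop p.natDegree] with m hm hm1 hmp s hs
  have hm0 : (0 : ℝ) < m := by exact_mod_cast hm1
  have hth := threshold_pos hc ε hm1
  have hs0 : 0 < s := hth.trans_le hs.1
  have hsinh : 0 < Real.sinh (m * (G.halfCos * √(threshold c ε m))) :=
    Real.sinh_pos_iff.2 (by positivity)
  refine (G.abs_opLm_sub_opL_le hm1 (by omega) hs0 hs.2).trans (le_trans ?_ hm.le)
  calc 2 * (‖(p.map (algebraMap ℝ ℂ)).eval (G.pole s)‖ /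
        (Real.sinh (m * (G.halfCos * √s)) * (s * |Real.sin (G.χ * Real.pi)|)))
      ≤ 2 * (B / (Real.sinh (m * (G.halfCos * √(threshold c ε m))) *
          (threshold c ε m * |Real.sin (G.χ * Real.pi)|))) := by
        have h1 := hB s ⟨hs0.le, hs.2⟩
        have h2 : Real.sinh (m * (G.halfCos * √(threshold c ε m))) ≤
            Real.sinh (m * (G.halfCos * √s)) := by
          rw [Real.sinh_le_sinh]
          gcongr
          exact hs.1
        have h3 := hs.1
        gcongr
    _ = _ := by field_simp

/-- Since the kernel has constant sign, the sum of the absolute values is controlled by the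
quadrature error for the constant function `1`. -/
theorem sum_abs_kernelL_le {m : ℕ} {s : ℝ} (hs : 0 < s) {η : ℝ}
    (h : |G.opLm m (fun _ => 1) s - G.opL (fun _ => 1) s| ≤ η) :
    ∑ h : Fin (m + 2), Lobatto.coeff m h * |G.kernelL (Lobatto.node m h) s| ≤
      |G.χ| * Real.pi + η := by
  have h1 : ∑ h : Fin (m + 2), Lobatto.coeff m h * |G.kernelL (Lobatto.node m h) s| =
      -SignType.sign (Real.sin (G.χ * Real.pi)) * G.opLm m (fun _ => 1) s := by
    simp only [G.abs_kernelL hs, opLm, mul_one, Finset.mul_sum]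
    exact Finset.sum_congr rfl fun _ _ => by ring
  have h2 : |(-(SignType.sign (Real.sin (G.χ * Real.pi)) : ℝ))| = 1 := by
    rcases lt_or_gt_of_ne G.sin_ne_zero with h | h
    · simp [sign_neg h]
    · simp [sign_pos h]
  have h3 := G.abs_opL_le hs (f := fun _ => 1) continuousOn_const (C := 1) (by simp)
  rw [mul_one] at h3
  rw [h1]
  refine (le_abs_self _).trans ?_
  rw [abs_mul, h2, one_mul]
  have := abs_sub_abs_le_abs_sub (G.opLm m (fun _ => 1) s) (G.opL (fun _ => 1) s)
  linarith

theorem abs_opLm_le {m : ℕ} {s : ℝ} {A C : ℝ} {f : ℝ → ℝ}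
    (hf : ∀ t ∈ Icc (0 : ℝ) 1, |f t| ≤ C)
    (h : ∑ h : Fin (m + 2), Lobatto.coeff m h * |G.kernelL (Lobatto.node m h) s| ≤ A) :
    |G.opLm m f s| ≤ A * C := by
  have hC : 0 ≤ C := (abs_nonneg _).trans (hf 0 (by simp))
  refine le_trans ?_ (mul_le_mul_of_nonneg_right h hC)
  rw [opLm, Finset.sum_mul]
  refine (Finset.abs_sum_le_sum_abs _ _).trans (Finset.sum_le_sum fun h _ => ?_)
  rw [abs_mul, abs_mul, abs_of_nonneg (Lobatto.coeff_nonneg h.2)]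
  exact mul_le_mul_of_nonneg_left (hf _ (Lobatto.node_mem_Icc h.2))
    (mul_nonneg (Lobatto.coeff_nonneg h.2) (abs_nonneg _))

theorem sum_abs_kernelL_eventually_le {c ε : ℝ} (hc : 0 < c) (hε : 0 < ε)
    {η : ℝ} (hη : 0 < η) : ∀ᶠ m : ℕ in atTop, ∀ s ∈ Icc (threshold c ε m) 1,
      ∑ h : Fin (m + 2), Lobatto.coeff m h * |G.kernelL (Lobatto.node m h) s| ≤
        |G.χ| * Real.pi + η := by
  filter_upwards [G.opLm_error_polynomial hc hε 1 hη, eventually_ge_atTop 1] with m hm hm1 s hs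
  refine G.sum_abs_kernelL_le ((threshold_pos hc ε hm1).trans_le hs.1) ?_
  simpa using hm s hs

/-- The discrete Mellin operators converge uniformly beyond the threshold, for every continuous
function. -/
theorem opLm_error {c ε : ℝ} (hc : 0 < c) (hε : 0 < ε) {f : ℝ → ℝ}
    (hf : Continuous f) {η : ℝ} (hη : 0 < η) :
    ∀ᶠ m : ℕ in atTop, ∀ s ∈ Icc (threshold c ε m) 1, |G.opLm m f s - G.opL f s| ≤ η := by
  have hpi := Real.pi_pos
  have hχ := abs_nonneg G.χ
  set A := |G.χ| * Real.pi + 1 with hA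
  have hA0 : 0 < A := by positivity
  obtain ⟨p, hp⟩ := exists_polynomial_near_of_continuousOn 0 1 f hf.continuousOn (η / (3 * A))
    (by positivity)
  have hp' : ∀ t ∈ Icc (0 : ℝ) 1, |f t - p.eval t| ≤ η / (3 * A) := fun t ht => by
    rw [abs_sub_comm]; exact (hp t ht).le
  filter_upwards [G.opLm_error_polynomial hc hε p (show 0 < η / 3 by positivity),
    G.sum_abs_kernelL_eventually_le hc hε one_pos, eventually_ge_atTop 1] with m hm hsum hm1 s hs
  have hs0 : 0 < s := (threshold_pos hc ε hm1).trans_le hs.1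
  have h1 := G.abs_opLm_le hp' (hsum s hs)
  have h2 := G.abs_opL_le hs0 (f := fun t => f t - p.eval t) (by fun_prop) hp'
  have h3 := hm s hs
  have e1 : G.opLm m (fun t => f t - p.eval t) s = G.opLm m f s - G.opLm m (fun t => p.eval t) s := by
    simp only [opLm, mul_sub, Finset.sum_sub_distrib]
  have e2 : G.opL (fun t => f t - p.eval t) s = G.opL f s - G.opL (fun t => p.eval t) s := by
    unfold opL
    simp only [mul_sub]
    exact intervalIntegral.integral_sub (G.intervalIntegrable_kernelL_mul s hf.continuousOn)
      (G.intervalIntegrable_kernelL_mul s p.continuous.continuousOn)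
  have e3 : A * (η / (3 * A)) = η / 3 := by field_simp
  have h4 : |G.χ| * Real.pi * (η / (3 * A)) ≤ η / 3 := by
    rw [← e3]
    gcongr
    linarith
  rw [e3] at h1
  rw [e1] at h1
  rw [e2] at h2
  rw [abs_le] at *
  constructor <;> linarith [h1.1, h1.2, h2.1, h2.2, h3.1, h3.2]

end CornerDomain

/-! ### Continuity of the double layer kernels away from the corner -/

/-- The mean of `γ'` over the segment between `u` and `v`. -/
noncomputable def meanDeriv (γ : ℝ → ℂ) (u v : ℝ) : ℂ :=
  ∫ τ in (0 : ℝ)..1, deriv γ (u + τ * (v - u))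

/-- The second order Taylor remainder of `γ` at `u`, divided by `(v - u)²`. -/
noncomputable def taylorRemainder (γ : ℝ → ℂ) (u v : ℝ) : ℂ :=
  ∫ τ in (0 : ℝ)..1, ((1 - τ : ℝ) : ℂ) * deriv (deriv γ) (u + τ * (v - u))

theorem ContDiff.continuous_deriv_two {γ : ℝ → ℂ} (hγ : ContDiff ℝ 2 γ) :
    Continuous (deriv γ) := hγ.continuous_deriv (by norm_num)

theorem ContDiff.contDiff_deriv_two {γ : ℝ → ℂ} (hγ : ContDiff ℝ 2 γ) : ContDiff ℝ 1 (deriv γ) := by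
  have h : ContDiff ℝ (1 + 1) γ := by convert hγ using 1; norm_num
  exact (contDiff_succ_iff_deriv.1 h).2.2

theorem ContDiff.continuous_deriv_deriv {γ : ℝ → ℂ} (hγ : ContDiff ℝ 2 γ) :
    Continuous (deriv (deriv γ)) :=
  hγ.contDiff_deriv_two.continuous_deriv le_rfl

theorem ContDiff.hasDerivAt_two {γ : ℝ → ℂ} (hγ : ContDiff ℝ 2 γ) (u : ℝ) :
    HasDerivAt γ (deriv γ u) u :=
  (hγ.differentiable (by norm_num) u).hasDerivAt

theorem ContDiff.hasDerivAt_deriv_two {γ : ℝ → ℂ} (hγ : ContDiff ℝ 2 γ) (u : ℝ) :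
    HasDerivAt (deriv γ) (deriv (deriv γ) u) u :=
  (hγ.contDiff_deriv_two.differentiable (by norm_num) u).hasDerivAt

theorem continuous_meanDeriv {γ : ℝ → ℂ} (hγ : ContDiff ℝ 2 γ) :
    Continuous fun p : ℝ × ℝ => meanDeriv γ p.1 p.2 := by
  refine intervalIntegral.continuous_parametric_intervalIntegral_of_continuous'
    (f := fun (p : ℝ × ℝ) τ => deriv γ (p.1 + τ * (p.2 - p.1))) ?_ 0 1
  have := hγ.continuous_deriv_two
  fun_prop

theorem continuous_taylorRemainder {γ : ℝ → ℂ} (hγ : ContDiff ℝ 2 γ) :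
    Continuous fun p : ℝ × ℝ => taylorRemainder γ p.1 p.2 := by
  refine intervalIntegral.continuous_parametric_intervalIntegral_of_continuous'
    (f := fun (p : ℝ × ℝ) τ => ((1 - τ : ℝ) : ℂ) * deriv (deriv γ) (p.1 + τ * (p.2 - p.1))) ?_ 0 1
  have := hγ.continuous_deriv_deriv
  fun_prop

theorem sub_eq_mul_meanDeriv {γ : ℝ → ℂ} (hγ : ContDiff ℝ 2 γ) (u v : ℝ) :
    γ v - γ u = ((v - u : ℝ) : ℂ) * meanDeriv γ u v := by
  have hd : ∀ τ ∈ uIcc (0 : ℝ) 1, HasDerivAt (fun τ => γ (u + τ * (v - u)))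
      (((v - u : ℝ) : ℂ) * deriv γ (u + τ * (v - u))) τ := fun τ _ => by
    have h1 : HasDerivAt (fun τ : ℝ => u + τ * (v - u)) (v - u) τ := by
      simpa using ((hasDerivAt_id τ).mul_const (v - u)).const_add u
    have := (hγ.hasDerivAt_two (u + τ * (v - u))).scomp τ h1
    simpa [Function.comp_def] using this
  have hc := hγ.continuous_deriv_two
  have := intervalIntegral.integral_eq_sub_of_hasDerivAt hd
    ((by fun_prop : Continuous _).intervalIntegrable _ _)
  rw [intervalIntegral.integral_const_mul] at this
  rw [meanDeriv, this]
  simp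

theorem sub_eq_add_taylorRemainder {γ : ℝ → ℂ} (hγ : ContDiff ℝ 2 γ) (u v : ℝ) :
    γ v - γ u = ((v - u : ℝ) : ℂ) * deriv γ u + (((v - u) ^ 2 : ℝ) : ℂ) * taylorRemainder γ u v := by
  have hd : ∀ τ ∈ uIcc (0 : ℝ) 1, HasDerivAt
      (fun τ => ((1 - τ : ℝ) : ℂ) * (((v - u : ℝ) : ℂ) * deriv γ (u + τ * (v - u))) +
        γ (u + τ * (v - u)))
      ((((v - u) ^ 2 : ℝ) : ℂ) * (((1 - τ : ℝ) : ℂ) * deriv (deriv γ) (u + τ * (v - u)))) τ :=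
    fun τ _ => by
    have h1 : HasDerivAt (fun τ : ℝ => u + τ * (v - u)) (v - u) τ := by
      simpa using ((hasDerivAt_id τ).mul_const (v - u)).const_add u
    have h2 := (hγ.hasDerivAt_two (u + τ * (v - u))).scomp τ h1
    have h3 := (hγ.hasDerivAt_deriv_two (u + τ * (v - u))).scomp τ h1
    have h4 : HasDerivAt (fun τ : ℝ => ((1 - τ : ℝ) : ℂ)) ((-1 : ℝ) : ℂ) τ :=
      ((hasDerivAt_id τ).const_sub 1).ofReal_comp
    have h5 := (h4.mul (h3.const_mul ((v - u : ℝ) : ℂ))).add h2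
    refine h5.congr_deriv ?_
    simp only [Function.comp_apply, Complex.real_smul]
    push_cast
    ring
  have hc := hγ.continuous_deriv_deriv
  have := intervalIntegral.integral_eq_sub_of_hasDerivAt hd
    ((by fun_prop : Continuous _).intervalIntegrable _ _)
  rw [intervalIntegral.integral_const_mul] at this
  rw [taylorRemainder, this]
  simp only [sub_self, sub_zero, one_mul, zero_mul, add_zero, add_sub_cancel, Complex.ofReal_zero,
    Complex.ofReal_one, zero_add]
  ring

theorem meanDeriv_self (γ : ℝ → ℂ) (u : ℝ) : meanDeriv γ u u = deriv γ u := by simp [meanDeriv]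

theorem taylorRemainder_self (γ : ℝ → ℂ) (u : ℝ) :
    taylorRemainder γ u u = 1 / 2 * deriv (deriv γ) u := by
  have : ∫ τ in (0 : ℝ)..1, (1 - τ) = 1 / 2 := by
    rw [intervalIntegral.integral_sub (by simp) (by simp)]
    norm_num
  simp only [taylorRemainder, sub_self, mul_zero, add_zero]
  rw [intervalIntegral.integral_mul_const, intervalIntegral.integral_ofReal, this]
  norm_num


namespace CornerDomain

variable {G : CornerDomain}

theorem eq_or_corner_of_γ_eq {u v : ℝ} (hu : u ∈ Icc (0 : ℝ) 1) (hv : v ∈ Icc (0 : ℝ) 1)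
    (h : G.γ u = G.γ v) : u = v ∨ (u = 0 ∧ v = 1) ∨ (u = 1 ∧ v = 0) := by
  have h0 : (0 : ℝ) ∈ Ico (0 : ℝ) 1 := by simp
  rcases hu.2.lt_or_eq with hu1 | rfl <;> rcases hv.2.lt_or_eq with hv1 | rfl
  · exact Or.inl (G.injOn ⟨hu.1, hu1⟩ ⟨hv.1, hv1⟩ h)
  · rw [← G.closed] at h
    exact Or.inr (Or.inl ⟨G.injOn ⟨hu.1, hu1⟩ h0 h, rfl⟩)
  · rw [← G.closed] at h
    exact Or.inr (Or.inr ⟨rfl, (G.injOn h0 ⟨hv.1, hv1⟩ h).symm⟩)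
  · exact Or.inl rfl

theorem meanDeriv_γ_ne_zero {u v : ℝ} (hu : u ∈ Icc (0 : ℝ) 1) (h : G.γ u = G.γ v → u = v) :
    meanDeriv G.γ u v ≠ 0 := by
  intro h0
  have h1 := sub_eq_mul_meanDeriv G.contDiff u v
  rw [h0, mul_zero] at h1
  obtain rfl := h (sub_eq_zero.1 h1).symm
  rw [meanDeriv_self] at h0
  exact G.deriv_ne_zero u hu h0

namespace Sections

variable (Γ : G.Sections)

theorem deriv_ne_zero (i : Fin 3) {s : ℝ} (hs : s ∈ Icc (0 : ℝ) 1) : deriv (Γ.θ i) s ≠ 0 := by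
  fin_cases i
  · exact (Γ.deriv_neg s hs).ne
  · exact (Γ.deriv_pos₁ s hs).ne'
  · exact (Γ.deriv_pos₂ s hs).ne'

theorem strictAntiOn_θ : StrictAntiOn (Γ.θ 0) (Icc 0 1) :=
  strictAntiOn_of_deriv_neg (convex_Icc 0 1) (Γ.contDiff 0).continuous.continuousOn fun s hs =>
    Γ.deriv_neg s (interior_subset hs)

theorem strictMonoOn_θ₁ : StrictMonoOn (Γ.θ 1) (Icc 0 1) :=
  strictMonoOn_of_deriv_pos (convex_Icc 0 1) (Γ.contDiff 1).continuous.continuousOn fun s hs =>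
    Γ.deriv_pos₁ s (interior_subset hs)

theorem strictMonoOn_θ₂ : StrictMonoOn (Γ.θ 2) (Icc 0 1) :=
  strictMonoOn_of_deriv_pos (convex_Icc 0 1) (Γ.contDiff 2).continuous.continuousOn fun s hs =>
    Γ.deriv_pos₂ s (interior_subset hs)

/-- The parameter intervals of the three sections. -/
theorem exists_partition : ∃ a b : ℝ, 0 < a ∧ a < b ∧ b < 1 ∧ ∀ s ∈ Icc (0 : ℝ) 1,
    Γ.θ 0 s ∈ Icc b 1 ∧ Γ.θ 1 s ∈ Icc 0 a ∧ Γ.θ 2 s ∈ Icc a b := by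
  have h0 : (0 : ℝ) ∈ Icc (0 : ℝ) 1 := by simp
  have h1 : (1 : ℝ) ∈ Icc (0 : ℝ) 1 := by simp
  refine ⟨Γ.θ 1 1, Γ.θ 0 1, ?_, ?_, ?_, fun s hs => ⟨⟨?_, ?_⟩, ⟨?_, ?_⟩, ⟨?_, ?_⟩⟩⟩
  · rw [← Γ.start₁]; exact Γ.strictMonoOn_θ₁ h0 h1 one_pos
  · rw [← Γ.start₂, ← Γ.end₂]; exact Γ.strictMonoOn_θ₂ h0 h1 one_pos
  · conv_rhs => rw [← Γ.start₀]
    exact Γ.strictAntiOn_θ h0 h1 one_pos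
  · exact Γ.strictAntiOn_θ.antitoneOn hs h1 hs.2
  · conv_rhs => rw [← Γ.start₀]
    exact Γ.strictAntiOn_θ.antitoneOn h0 hs hs.1
  · rw [← Γ.start₁]; exact Γ.strictMonoOn_θ₁.monotoneOn h0 hs hs.1
  · exact Γ.strictMonoOn_θ₁.monotoneOn hs h1 hs.2
  · rw [← Γ.start₂]; exact Γ.strictMonoOn_θ₂.monotoneOn h0 hs hs.1
  · rw [← Γ.end₂]; exact Γ.strictMonoOn_θ₂.monotoneOn hs h1 hs.2

theorem θ_mem (i : Fin 3) {s : ℝ} (hs : s ∈ Icc (0 : ℝ) 1) : Γ.θ i s ∈ Icc (0 : ℝ) 1 := by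
  obtain ⟨a, b, ha, hab, hb, h⟩ := Γ.exists_partition
  obtain ⟨⟨h1, h2⟩, ⟨h3, h4⟩, ⟨h5, h6⟩⟩ := h s hs
  fin_cases i <;> constructor <;> simp only [Fin.zero_eta, Fin.mk_one, Fin.reduceFinMk] <;> linarith

/-- Only the two sections that meet at the corner meet with different parameters. -/
theorem θ_eq_of_σ_eq {i j : Fin 3} (h01 : ¬(i = 0 ∧ j = 1)) (h10 : ¬(i = 1 ∧ j = 0))
    {t s : ℝ} (ht : t ∈ Icc (0 : ℝ) 1) (hs : s ∈ Icc (0 : ℝ) 1)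
    (h : G.γ (Γ.θ j t) = G.γ (Γ.θ i s)) : Γ.θ j t = Γ.θ i s := by
  obtain ⟨a, b, ha, hab, hb, hp⟩ := Γ.exists_partition
  obtain ⟨⟨h1, h2⟩, ⟨h3, h4⟩, ⟨h5, h6⟩⟩ := hp s hs
  obtain ⟨⟨k1, k2⟩, ⟨k3, k4⟩, ⟨k5, k6⟩⟩ := hp t ht
  rcases eq_or_corner_of_γ_eq (Γ.θ_mem j ht) (Γ.θ_mem i hs) h with h | ⟨e1, e2⟩ | ⟨e1, e2⟩
  · exact h
  all_goals
    exfalso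
    fin_cases i <;> fin_cases j <;>
      simp only [Fin.zero_eta, Fin.mk_one, Fin.reduceFinMk, not_true_eq_false, and_self,
        true_and, and_true] at h01 h10 e1 e2 <;> linarith

theorem hasDerivAt_σ (j : Fin 3) (t : ℝ) :
    HasDerivAt (Γ.σ j) (((deriv (Γ.θ j) t : ℝ) : ℂ) * deriv G.γ (Γ.θ j t)) t := by
  have h1 := ((Γ.contDiff j).differentiable (by norm_num) t).hasDerivAt
  have := (G.contDiff.hasDerivAt_two (Γ.θ j t)).scomp t h1
  rw [Complex.real_smul] at this
  exact this

theorem deriv_σ (j : Fin 3) :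
    deriv (Γ.σ j) = fun t => ((deriv (Γ.θ j) t : ℝ) : ℂ) * deriv G.γ (Γ.θ j t) :=
  funext fun t => (Γ.hasDerivAt_σ j t).deriv

theorem deriv_deriv_σ (j : Fin 3) (t : ℝ) : deriv (deriv (Γ.σ j)) t =
    ((deriv (deriv (Γ.θ j)) t : ℝ) : ℂ) * deriv G.γ (Γ.θ j t) +
      ((deriv (Γ.θ j) t ^ 2 : ℝ) : ℂ) * deriv (deriv G.γ) (Γ.θ j t) := by
  rw [deriv_σ]
  have hθ : ContDiff ℝ (1 + 1) (Γ.θ j) := by convert Γ.contDiff j using 1; norm_num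
  have hθ' := (contDiff_succ_iff_deriv.1 hθ).2.2
  have h1 := ((Γ.contDiff j).differentiable (by norm_num) t).hasDerivAt
  have h2 := (hθ'.differentiable (by norm_num) t).hasDerivAt.ofReal_comp
  have h3 := (G.contDiff.hasDerivAt_deriv_two (Γ.θ j t)).scomp t h1
  refine ((h2.mul h3).congr_deriv ?_).deriv
  simp only [Function.comp_apply, Complex.real_smul]
  push_cast
  ring

/-- Away from the corner, the double layer kernel has a form without singularity: the factor
`(v - u)²` cancels. -/
theorem kernelK_eq {i j : Fin 3} {t s : ℝ} (ht : t ∈ Icc (0 : ℝ) 1)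
    (h : G.γ (Γ.θ j t) = G.γ (Γ.θ i s) → Γ.θ j t = Γ.θ i s) :
    Γ.kernelK i j t s = orientation j * (deriv (Γ.θ j) t *
      ((deriv G.γ (Γ.θ j t)).im * (taylorRemainder G.γ (Γ.θ j t) (Γ.θ i s)).re -
        (deriv G.γ (Γ.θ j t)).re * (taylorRemainder G.γ (Γ.θ j t) (Γ.θ i s)).im) /
      Complex.normSq (meanDeriv G.γ (Γ.θ j t) (Γ.θ i s))) := by
  have hθ := Γ.deriv_ne_zero j ht
  rw [kernelK]
  congr 1
  split_ifs with hPQ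
  · rw [← h hPQ.symm, meanDeriv_self, taylorRemainder_self, deriv_deriv_σ,
      deriv_σ]
    have hn : Complex.normSq (deriv G.γ (Γ.θ j t)) ≠ 0 :=
      Complex.normSq_eq_zero.not.2 (G.deriv_ne_zero _ (Γ.θ_mem j ht))
    rw [Complex.normSq_apply] at hn ⊢
    have h2 : (1 / 2 * deriv (deriv G.γ) (Γ.θ j t)) =
        ((1 / 2 : ℝ) : ℂ) * deriv (deriv G.γ) (Γ.θ j t) := by push_cast; ring
    simp only [h2, Complex.add_re, Complex.add_im, Complex.re_ofReal_mul, Complex.im_ofReal_mul]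
    have hn' : (deriv (Γ.θ j) t * (deriv G.γ (Γ.θ j t)).re) ^ 2 +
        (deriv (Γ.θ j) t * (deriv G.γ (Γ.θ j t)).im) ^ 2 ≠ 0 := by
      have := mul_ne_zero (pow_ne_zero 2 hθ) hn
      intro h0
      apply this
      linear_combination h0
    rw [mul_div_assoc', div_eq_div_iff hn' hn]
    ring
  · set u := Γ.θ j t with hu
    set v := Γ.θ i s with hv
    have hne : v - u ≠ 0 := by
      intro h0
      apply hPQ
      change G.γ v = G.γ u
      rw [sub_eq_zero.1 h0]
    have hA := sub_eq_mul_meanDeriv G.contDiff u v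
    have hB := sub_eq_add_taylorRemainder G.contDiff u v
    have hre : (Γ.σ i s).re - (Γ.σ j t).re = (G.γ v - G.γ u).re := rfl
    have him : (Γ.σ i s).im - (Γ.σ j t).im = (G.γ v - G.γ u).im := rfl
    have hden : ((Γ.σ i s).re - (Γ.σ j t).re) ^ 2 + ((Γ.σ i s).im - (Γ.σ j t).im) ^ 2 =
        (v - u) ^ 2 * Complex.normSq (meanDeriv G.γ u v) := by
      rw [hre, him, hA, Complex.re_ofReal_mul, Complex.im_ofReal_mul, Complex.normSq_apply]
      ring
    have hnum : (deriv (Γ.σ j) t).im * ((Γ.σ i s).re - (Γ.σ j t).re) -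
        (deriv (Γ.σ j) t).re * ((Γ.σ i s).im - (Γ.σ j t).im) = (v - u) ^ 2 * (deriv (Γ.θ j) t *
          ((deriv G.γ u).im * (taylorRemainder G.γ u v).re -
            (deriv G.γ u).re * (taylorRemainder G.γ u v).im)) := by
      rw [hre, him, hB, deriv_σ]
      simp only [Complex.add_re, Complex.add_im, Complex.re_ofReal_mul, Complex.im_ofReal_mul]
      ring
    rw [hden, hnum, mul_div_mul_left _ _ (pow_ne_zero 2 hne)]

theorem continuousOn_kernelK {i j : Fin 3} (h01 : ¬(i = 0 ∧ j = 1)) (h10 : ¬(i = 1 ∧ j = 0)) :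
    ContinuousOn (fun p : ℝ × ℝ => Γ.kernelK i j p.1 p.2) (Icc 0 1 ×ˢ Icc 0 1) := by
  have hi := (Γ.contDiff i).continuous
  have hj := (Γ.contDiff j).continuous
  have hj' := (Γ.contDiff j).continuous_deriv (by norm_num)
  have hγ' := G.contDiff.continuous_deriv_two
  have hpair : Continuous fun p : ℝ × ℝ => (Γ.θ j p.1, Γ.θ i p.2) := by fun_prop
  have hA := (continuous_meanDeriv G.contDiff).comp hpair
  have hB := (continuous_taylorRemainder G.contDiff).comp hpair
  simp only [Function.comp_def] at hA hB
  have hBre := Complex.continuous_re.comp hB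
  have hBim := Complex.continuous_im.comp hB
  have hdre : Continuous fun p : ℝ × ℝ => (deriv G.γ (Γ.θ j p.1)).re :=
    Complex.continuous_re.comp (hγ'.comp (hj.comp continuous_fst))
  have hdim : Continuous fun p : ℝ × ℝ => (deriv G.γ (Γ.θ j p.1)).im :=
    Complex.continuous_im.comp (hγ'.comp (hj.comp continuous_fst))
  have hnum := (hj'.comp (continuous_fst (Y := ℝ))).mul ((hdim.mul hBre).sub (hdre.mul hBim))
  have hden := Complex.continuous_normSq.comp hA
  refine ContinuousOn.congr (f := fun p : ℝ × ℝ => orientation j * (deriv (Γ.θ j) p.1 *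
      ((deriv G.γ (Γ.θ j p.1)).im * (taylorRemainder G.γ (Γ.θ j p.1) (Γ.θ i p.2)).re -
        (deriv G.γ (Γ.θ j p.1)).re * (taylorRemainder G.γ (Γ.θ j p.1) (Γ.θ i p.2)).im) /
      Complex.normSq (meanDeriv G.γ (Γ.θ j p.1) (Γ.θ i p.2)))) ?_ ?_
  · refine continuousOn_const.mul (hnum.continuousOn.div hden.continuousOn fun p hp => ?_)
    exact Complex.normSq_eq_zero.not.2 (meanDeriv_γ_ne_zero (Γ.θ_mem j hp.1)
      (Γ.θ_eq_of_σ_eq h01 h10 hp.1 hp.2))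
  · intro p hp
    exact Γ.kernelK_eq hp.1 (Γ.θ_eq_of_σ_eq h01 h10 hp.1 hp.2)

theorem continuousOn_kernelS
    (hM₁₂ : ContinuousOn (fun p : ℝ × ℝ => Γ.kernelM 0 1 p.1 p.2) (Icc 0 1 ×ˢ Icc 0 1))
    (hM₂₁ : ContinuousOn (fun p : ℝ × ℝ => Γ.kernelM 1 0 p.1 p.2) (Icc 0 1 ×ˢ Icc 0 1))
    (i j : Fin 3) :
    ContinuousOn (fun p : ℝ × ℝ => Γ.kernelS i j p.1 p.2) (Icc 0 1 ×ˢ Icc 0 1) := by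
  fin_cases i <;> fin_cases j
  · exact Γ.continuousOn_kernelK (i := 0) (j := 0) (by decide) (by decide)
  · exact hM₁₂
  · exact Γ.continuousOn_kernelK (i := 0) (j := 2) (by decide) (by decide)
  · exact hM₂₁
  · exact Γ.continuousOn_kernelK (i := 1) (j := 1) (by decide) (by decide)
  · exact Γ.continuousOn_kernelK (i := 1) (j := 2) (by decide) (by decide)
  · exact Γ.continuousOn_kernelK (i := 2) (j := 0) (by decide) (by decide)
  · exact Γ.continuousOn_kernelK (i := 2) (j := 1) (by decide) (by decide)
  · exact Γ.continuousOn_kernelK (i := 2) (j := 2) (by decide) (by decide)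

theorem σ_zero : Γ.σ 0 0 = Γ.σ 1 0 := by
  rw [σ, σ, Γ.start₀, Γ.start₁, G.closed]

/-- Both arms give the same compact part at the corner, where they meet and `L` vanishes. -/
theorem kernelS_corner (j : Fin 3) (t : ℝ) : Γ.kernelS 0 j t 0 = Γ.kernelS 1 j t 0 := by
  have hK : ∀ j, Γ.kernelK 0 j t 0 = Γ.kernelK 1 j t 0 := by
    intro j; simp only [kernelK, σ_zero]
  fin_cases j <;> simp [kernelS, kernelM, kernelL_zero, hK]

end Sections

end CornerDomain

/-! ### Collectively compact perturbations -/

section Perturbation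

variable {X : Type*} [NormedAddCommGroup X] [NormedSpace ℝ X]

theorem sub_mul_norm_le_norm_neg_smul_add {a q : ℝ} (ha : 0 ≤ a) {W : X →L[ℝ] X}
    (hW : ∀ f, ‖W f‖ ≤ q * ‖f‖) (f : X) : (a - q) * ‖f‖ ≤ ‖-(a • f) + W f‖ := by
  have h1 := hW f
  have h2 : ‖a • f‖ = a * ‖f‖ := by rw [norm_smul, Real.norm_of_nonneg ha]
  have h3 := norm_sub_norm_le (a • f) (W f)
  have h4 : ‖-(a • f) + W f‖ = ‖a • f - W f‖ := by rw [← norm_neg]; congr 1; abel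
  rw [h4]
  linarith

/-- The Neumann series inverts `-a + W` if `‖W‖ < a`. -/
theorem exists_equiv_neg_smul_add [CompleteSpace X] {a q : ℝ} (hq : 0 ≤ q) (hqa : q < a)
    {W : X →L[ℝ] X} (hW : ∀ f, ‖W f‖ ≤ q * ‖f‖) :
    ∃ E : X ≃L[ℝ] X, ∀ f, E f = -(a • f) + W f := by
  have ha : 0 < a := hq.trans_lt hqa
  have hnorm : ‖a⁻¹ • W‖ < 1 := by
    rw [norm_smul, norm_inv, Real.norm_of_nonneg ha.le, inv_mul_lt_iff₀ ha, mul_one]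
    exact (W.opNorm_le_bound hq hW).trans_lt hqa
  refine ⟨(ContinuousLinearEquiv.unitsEquiv ℝ X (Units.oneSub _ hnorm)).trans
    (ContinuousLinearEquiv.smulLeft (Units.mk0 (-a) (neg_ne_zero.2 ha.ne'))), fun f => ?_⟩
  change (-a) • (f - a⁻¹ • W f) = _
  rw [smul_sub, neg_smul, neg_smul, smul_smul, mul_inv_cancel₀ ha.ne', one_smul, sub_neg_eq_add]

/-- Uniform stability of `-a + W_m + S_m`, when the `W_m` converge strongly to `W` with norms less
than `a`, and the `S_m` are collectively compact. -/
theorem eventually_bounded_below [CompleteSpace X] {a q : ℝ} (hq : 0 ≤ q) (hqa : q < a)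
    {W : X →L[ℝ] X} (hW : ∀ f, ‖W f‖ ≤ q * ‖f‖) {Wm Sm : ℕ → X →L[ℝ] X}
    (hWm : ∀ᶠ m in atTop, ∀ f, ‖Wm m f‖ ≤ q * ‖f‖)
    (hlim : ∀ f, Tendsto (fun m => Wm m f) atTop (𝓝 (W f))) {K : Set X} (hK : IsCompact K)
    (hS : ∀ᶠ m in atTop, ∀ f, ‖f‖ ≤ 1 → Sm m f ∈ K)
    (hker : ∀ (f g : X) (φ : ℕ → ℕ), Tendsto φ atTop atTop →
      Tendsto (fun n => Sm (φ n) f) atTop (𝓝 g) → -(a • f) + W f + g = 0 → f = 0) :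
    ∃ δ : ℝ, 0 < δ ∧ ∀ᶠ m in atTop, ∀ f, δ * ‖f‖ ≤ ‖-(a • f) + Wm m f + Sm m f‖ := by
  by_contra! hcon
  have ha : 0 < a := hq.trans_lt hqa
  obtain ⟨R, hR⟩ := hK.isBounded.exists_norm_le
  have hseq : ∀ n : ℕ, ∃ m, n ≤ m ∧ (∀ f, ‖Wm m f‖ ≤ q * ‖f‖) ∧ (∀ f, ‖f‖ ≤ 1 → Sm m f ∈ K) ∧
      ∃ e : X, ‖e‖ = 1 ∧ ‖-(a • e) + Wm m e + Sm m e‖ < 1 / ((n : ℝ) + 1) := by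
    intro n
    obtain ⟨m, ⟨f, hf⟩, ⟨h1, h2⟩, hnm⟩ := ((hcon (1 / ((n : ℝ) + 1)) (by positivity)).and_eventually
      ((hWm.and hS).and (eventually_ge_atTop n))).exists
    refine ⟨m, hnm, h1, h2, ‖f‖⁻¹ • f, ?_, ?_⟩
    all_goals
      have hf0 : 0 < ‖f‖ := by
        rw [norm_pos_iff]
        rintro rfl
        simp at hf
    · rw [norm_smul, norm_inv, norm_norm, inv_mul_cancel₀ hf0.ne']
    · rw [map_smul, map_smul, smul_comm a, ← smul_neg, ← smul_add, ← smul_add, norm_smul, norm_inv,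
        norm_norm, inv_mul_lt_iff₀ hf0, mul_comm]
      exact hf
  choose φ hφ hWφ hSφ e he hTe using hseq
  obtain ⟨g, -, ψ, hψ, hg⟩ := hK.tendsto_subseq fun n => hSφ n (e n) (he n).le
  have hφψ : Tendsto (fun n => φ (ψ n)) atTop atTop :=
    (tendsto_atTop_mono hφ tendsto_id).comp hψ.tendsto_atTop
  have hT0 : Tendsto (fun n => -(a • e (ψ n)) + Wm (φ (ψ n)) (e (ψ n)) + Sm (φ (ψ n)) (e (ψ n)))
      atTop (𝓝 0) := by
    have h1 : Tendsto (fun n => -(a • e n) + Wm (φ n) (e n) + Sm (φ n) (e n)) atTop (𝓝 0) :=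
      squeeze_zero_norm (fun n => (hTe n).le) tendsto_one_div_add_atTop_nhds_zero_nat
    exact h1.comp hψ.tendsto_atTop
  -- the limit of `e (ψ n)` solves the equation with `g` in place of the compact part
  obtain ⟨E, hE⟩ := exists_equiv_neg_smul_add hq hqa hW
  obtain ⟨ρ, hρ⟩ := E.surjective (-g)
  rw [hE] at hρ
  have hdiff : Tendsto (fun n => -(a • (e (ψ n) - ρ)) + Wm (φ (ψ n)) (e (ψ n) - ρ)) atTop
      (𝓝 0) := by
    have h1 := (hT0.sub hg).sub (((hlim ρ).comp hφψ).const_add (-(a • ρ)))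
    rw [hρ, zero_sub, sub_neg_eq_add, neg_add_cancel] at h1
    refine h1.congr fun n => ?_
    simp only [Function.comp_apply, map_sub, smul_sub]
    abel
  have heρ : Tendsto (fun n => e (ψ n)) atTop (𝓝 ρ) := by
    rw [tendsto_iff_norm_sub_tendsto_zero]
    have h1 := hdiff.norm.const_mul (a - q)⁻¹
    rw [norm_zero, mul_zero] at h1
    refine squeeze_zero (fun _ => norm_nonneg _) (fun n => ?_) h1
    rw [le_inv_mul_iff₀ (by linarith)]
    exact sub_mul_norm_le_norm_neg_smul_add ha.le (hWφ (ψ n)) _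
  have hρ1 : ‖ρ‖ = 1 := by
    refine tendsto_nhds_unique heρ.norm ?_
    simp only [he]
    exact tendsto_const_nhds
  have hSρ : Tendsto (fun n => Sm (φ (ψ n)) ρ) atTop (𝓝 g) := by
    have h1 : Tendsto (fun n => Sm (φ (ψ n)) (e (ψ n) - ρ)) atTop (𝓝 0) := by
      have h2 := (tendsto_iff_norm_sub_tendsto_zero.1 heρ).const_mul (max R 0)
      rw [mul_zero] at h2
      refine squeeze_zero_norm (fun n => ?_) h2
      refine (Sm (φ (ψ n))).le_of_opNorm_le ((Sm (φ (ψ n))).opNorm_le_of_unit_norm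
        (le_max_right _ _) fun f hf => ?_) _
      exact (hR _ (hSφ (ψ n) f hf.le)).trans (le_max_left _ _)
    have h2 := hg.sub h1
    rw [sub_zero] at h2
    refine h2.congr fun n => ?_
    simp
  have := hker ρ g _ hφψ hSρ (by rw [hρ]; simp)
  rw [this, norm_zero] at hρ1
  exact zero_ne_one hρ1

/-- By the Fredholm alternative, injectivity of `-a + W + S` implies bijectivity. -/
theorem exists_equiv_of_bounded_below [CompleteSpace X] {a q : ℝ} (hq : 0 ≤ q) (hqa : q < a)
    {W S : X →L[ℝ] X} (hW : ∀ f, ‖W f‖ ≤ q * ‖f‖) {K : Set X} (hK : IsCompact K)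
    (hS : ∀ f, ‖f‖ ≤ 1 → S f ∈ K) {δ : ℝ} (hδ : 0 < δ)
    (hT : ∀ f, δ * ‖f‖ ≤ ‖-(a • f) + W f + S f‖) :
    ∃ T : X ≃L[ℝ] X, (∀ f, T f = -(a • f) + W f + S f) ∧ ∀ f, ‖T.symm f‖ ≤ δ⁻¹ * ‖f‖ := by
  obtain ⟨E, hE⟩ := exists_equiv_neg_smul_add hq hqa hW
  set F : X →L[ℝ] X := (E : X →L[ℝ] X) + S with hF
  have hFapp : ∀ f, F f = -(a • f) + W f + S f := fun f => by
    rw [hF, add_apply, ContinuousLinearEquiv.coe_coe, hE]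
  have hinj : ∀ f, F f = 0 → f = 0 := by
    intro f hf
    have := hT f
    rw [← hFapp, hf, norm_zero] at this
    exact norm_le_zero_iff.1 (by nlinarith [norm_nonneg f])
  have hScomp : IsCompactOperator S := by
    rw [isCompactOperator_iff_exists_mem_nhds_image_subset_compact]
    refine ⟨Metric.closedBall 0 1, Metric.closedBall_mem_nhds _ one_pos, K, hK, ?_⟩
    rintro _ ⟨f, hf, rfl⟩
    exact hS f (mem_closedBall_zero_iff.1 hf)
  have hcomp : IsCompactOperator ((E.symm : X →L[ℝ] X).comp S) :=
    hScomp.clm_comp (E.symm : X →L[ℝ] X)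
  have hunit : IsUnit (algebraMap ℝ (X →L[ℝ] X) (-1) - (E.symm : X →L[ℝ] X).comp S) := by
    rcases hcomp.hasEigenvalue_or_mem_resolventSet (μ := -1) (by norm_num) with h | h
    · exfalso
      obtain ⟨f, hf⟩ := h.exists_hasEigenvector
      have h1 : E.symm (S f) = (-1 : ℝ) • f := hf.apply_eq_smul
      refine hf.2 (hinj f ?_)
      rw [hF, add_apply, ContinuousLinearEquiv.coe_coe,
        ← E.apply_symm_apply (S f), h1, map_smul]
      simp
    · exact h
  have hsurj : Function.Surjective F := by
    intro y
    obtain ⟨u, hu⟩ := hunit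
    refine ⟨(-(↑u⁻¹ : X →L[ℝ] X)) (E.symm y), ?_⟩
    set x := (-(↑u⁻¹ : X →L[ℝ] X)) (E.symm y) with hx
    have h1 : (u : X →L[ℝ] X) x = -E.symm y := by
      rw [hx, neg_apply, map_neg, ← mul_apply_eq_comp,
        Units.mul_inv]
      rfl
    rw [hu] at h1
    have h2 : -x - E.symm (S x) = -E.symm y := by
      rw [← h1]
      simp [Algebra.algebraMap_eq_smul_one]
    have h3 := congrArg E h2
    rw [map_sub, map_neg, map_neg, E.apply_symm_apply, E.apply_symm_apply] at h3
    rw [hF, add_apply, ContinuousLinearEquiv.coe_coe]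
    rw [← neg_inj, ← h3]
    abel
  have hker : LinearMap.ker (F : X →ₗ[ℝ] X) = ⊥ := LinearMap.ker_eq_bot'.2 hinj
  have hrange : LinearMap.range (F : X →ₗ[ℝ] X) = ⊤ := LinearMap.range_eq_top.2 hsurj
  refine ⟨ContinuousLinearEquiv.ofBijective F hker hrange, hFapp, ?_⟩
  intro y
  set x := (ContinuousLinearEquiv.ofBijective F hker hrange).symm y with hx
  have h1 : F x = y := (ContinuousLinearEquiv.ofBijective F hker hrange).apply_symm_apply y
  have h2 := hT x
  rw [← hFapp, h1] at h2
  rwa [le_inv_mul_iff₀ hδ]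

/-- `eventually_bounded_below` on a subspace. The operators are continuous and linear for the
subspace topology and the inherited module structure, rather than for those of the normed space. -/
theorem Submodule.eventually_bounded_below (p : Submodule ℝ X) [CompleteSpace p] {a q : ℝ}
    (hq : 0 ≤ q) (hqa : q < a) {W : p →L[ℝ] p} (hW : ∀ f, ‖W f‖ ≤ q * ‖f‖)
    {Wm Sm : ℕ → p →L[ℝ] p} (hWm : ∀ᶠ m in atTop, ∀ f, ‖Wm m f‖ ≤ q * ‖f‖)
    (hlim : ∀ f, Tendsto (fun m => Wm m f) atTop (𝓝 (W f))) {K : Set p} (hK : IsCompact K)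
    (hS : ∀ᶠ m in atTop, ∀ f, ‖f‖ ≤ 1 → Sm m f ∈ K)
    (hker : ∀ (f g : p) (φ : ℕ → ℕ), Tendsto φ atTop atTop →
      Tendsto (fun n => Sm (φ n) f) atTop (𝓝 g) → -(a • f) + W f + g = 0 → f = 0) :
    ∃ δ : ℝ, 0 < δ ∧ ∀ᶠ m in atTop, ∀ f, δ * ‖f‖ ≤ ‖-(a • f) + Wm m f + Sm m f‖ :=
  _root_.eventually_bounded_below hq hqa hW hWm hlim hK hS hker

/-- `exists_equiv_of_bounded_below` on a subspace. -/
theorem Submodule.exists_equiv_of_bounded_below (p : Submodule ℝ X) [CompleteSpace p] {a q : ℝ}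
    (hq : 0 ≤ q) (hqa : q < a) {W S : p →L[ℝ] p} (hW : ∀ f, ‖W f‖ ≤ q * ‖f‖) {K : Set p}
    (hK : IsCompact K) (hS : ∀ f, ‖f‖ ≤ 1 → S f ∈ K) {δ : ℝ} (hδ : 0 < δ)
    (hT : ∀ f, δ * ‖f‖ ≤ ‖-(a • f) + W f + S f‖) :
    ∃ T : p ≃L[ℝ] p, (∀ f, T f = -(a • f) + W f + S f) ∧ ∀ f, ‖T.symm f‖ ≤ δ⁻¹ * ‖f‖ :=
  _root_.exists_equiv_of_bounded_below hq hqa hW hK hS hδ hT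

theorem Submodule.norm_neg_smul_add_add_le (p : Submodule ℝ X) {a : ℝ} (ha : 0 ≤ a) (f x y : p) :
    ‖-(a • f) + x + y‖ ≤ a * ‖f‖ + ‖x‖ + ‖y‖ := by
  refine (norm_add₃_le).trans_eq ?_
  rw [norm_neg, norm_smul, Real.norm_of_nonneg ha]

end Perturbation

/-- The images of the unit ball under all averages `∑ w_h f(x_h) k(x_h)` of a continuous family `k`
lie in one compact set. -/
theorem exists_compact_of_averages {E : Type*} [NormedAddCommGroup E] [NormedSpace ℝ E]
    [CompleteSpace E] {Y : Type*} [TopologicalSpace Y] [CompactSpace Y] {k : Y → E}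
    (hk : Continuous k) :
    ∃ K : Set E, IsCompact K ∧ ∀ (n : ℕ) (w b : Fin n → ℝ) (x : Fin n → Y), (∀ h, 0 ≤ w h) →
      ∑ h, w h = 1 → (∀ h, |b h| ≤ 1) → ∑ h, w h • b h • k (x h) ∈ K := by
  set A := (fun p : ℝ × Y => p.1 • k p.2) '' (Icc (-1) 1 ×ˢ univ)
  have hA : IsCompact A := (isCompact_Icc.prod isCompact_univ).image (by fun_prop)
  refine ⟨closure (convexHull ℝ A), ?_, fun n w b x hw hsum hb => subset_closure ?_⟩
  · exact hA.totallyBounded.convexHull.closure.isCompact_of_isClosed isClosed_closure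
  · refine (convex_convexHull ℝ A).sum_mem (fun h _ => hw h) hsum fun h _ =>
      subset_convexHull ℝ A ⟨(b h, x h), ⟨abs_le.1 (hb h), mem_univ _⟩, rfl⟩

/-! ### Operators on the space of continuous triples -/

theorem isClosed_spaceX : IsClosed (spaceX : Set (Fin 3 → C(unitInterval, ℝ))) := by
  refine isClosed_eq (f := fun f : Fin 3 → C(unitInterval, ℝ) => f 0 0)
    (g := fun f : Fin 3 → C(unitInterval, ℝ) => f 1 0) ?_ ?_
  · exact (continuous_eval_const 0).comp (continuous_apply 0)
  · exact (continuous_eval_const 0).comp (continuous_apply 1)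

instance completeSpace_spaceX : CompleteSpace spaceX := isClosed_spaceX.completeSpace_coe

theorem extendReal_coe (f : Fin 3 → C(unitInterval, ℝ)) (i : Fin 3) (s : unitInterval) :
    extendReal f i s = f i s := IccExtend_val _ _ _

theorem extendReal_of_mem (f : Fin 3 → C(unitInterval, ℝ)) (i : Fin 3) {s : ℝ}
    (hs : s ∈ Icc (0 : ℝ) 1) : extendReal f i s = f i ⟨s, hs⟩ := IccExtend_of_mem _ _ hs

theorem continuous_extendReal (f : Fin 3 → C(unitInterval, ℝ)) (i : Fin 3) :
    Continuous (extendReal f i) := (f i).continuous.Icc_extend'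

theorem extendReal_add (f g : Fin 3 → C(unitInterval, ℝ)) (i : Fin 3) (t : ℝ) :
    extendReal (f + g) i t = extendReal f i t + extendReal g i t := rfl

theorem extendReal_smul (a : ℝ) (f : Fin 3 → C(unitInterval, ℝ)) (i : Fin 3) (t : ℝ) :
    extendReal (a • f) i t = a * extendReal f i t := rfl

theorem abs_extendReal_le (f : spaceX) (i : Fin 3) (t : ℝ) :
    |extendReal (f : Fin 3 → C(unitInterval, ℝ)) i t| ≤ ‖f‖ :=
  ((f : Fin 3 → C(unitInterval, ℝ)) i).norm_coe_le_norm _ |>.trans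
    (norm_le_pi_norm (f : Fin 3 → C(unitInterval, ℝ)) i)

theorem extendReal_corner (f : spaceX) :
    extendReal (f : Fin 3 → C(unitInterval, ℝ)) 0 0 =
      extendReal (f : Fin 3 → C(unitInterval, ℝ)) 1 0 := by
  rw [extendReal_of_mem _ _ (by simp), extendReal_of_mem _ _ (by simp)]
  exact f.2

theorem norm_spaceX_le {f : spaceX} {C : ℝ} (hC : 0 ≤ C)
    (h : ∀ i s, |(f : Fin 3 → C(unitInterval, ℝ)) i s| ≤ C) : ‖f‖ ≤ C :=
  (pi_norm_le_iff_of_nonneg hC).2 fun i => (ContinuousMap.norm_le _ hC).2 (h i)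

/-- A formula on `[0,1]` that is linear and bounded in the triple of functions, gives continuous
functions, and respects the condition at the corner, defines a bounded operator on `𝒳`. -/
theorem exists_operator_spaceX (F : (Fin 3 → ℝ → ℝ) → Fin 3 → ℝ → ℝ)
    (hadd : ∀ (f g : spaceX) (i : Fin 3), ∀ s ∈ Icc (0 : ℝ) 1,
      F (extendReal (f + g : spaceX)) i s = F (extendReal f) i s + F (extendReal g) i s)
    (hsmul : ∀ (a : ℝ) (f : spaceX) (i : Fin 3), ∀ s ∈ Icc (0 : ℝ) 1,
      F (extendReal (a • f : spaceX)) i s = a * F (extendReal f) i s)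
    (hcont : ∀ (f : spaceX) (i : Fin 3), ContinuousOn (F (extendReal f) i) (Icc 0 1))
    (hcorner : ∀ f : spaceX, F (extendReal f) 0 0 = F (extendReal f) 1 0)
    {C : ℝ} (hC : 0 ≤ C)
    (hbound : ∀ (f : spaceX) (i : Fin 3), ∀ s ∈ Icc (0 : ℝ) 1, |F (extendReal f) i s| ≤ C * ‖f‖) :
    ∃ B : spaceX →L[ℝ] spaceX, (∀ (f : spaceX) (i : Fin 3) (s : unitInterval),
      (B f : Fin 3 → C(unitInterval, ℝ)) i s = F (extendReal f) i s) ∧ ∀ f, ‖B f‖ ≤ C * ‖f‖ := by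
  set L : spaceX →ₗ[ℝ] spaceX :=
    { toFun := fun f => ⟨fun i => ⟨fun s => F (extendReal f) i s, (hcont f i).domRestrict⟩,
        hcorner f⟩
      map_add' := fun f g => Subtype.ext <| funext fun i => ContinuousMap.ext fun s =>
        hadd f g i s s.2
      map_smul' := fun a f => Subtype.ext <| funext fun i => ContinuousMap.ext fun s =>
        hsmul a f i s s.2 }
  have hL : ∀ f, ‖L f‖ ≤ C * ‖f‖ := fun f =>
    norm_spaceX_le (by positivity) fun i s => hbound f i s s.2
  exact ⟨L.mkContinuous C hL, fun _ _ _ => rfl, hL⟩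

namespace CornerDomain

variable (G : CornerDomain)

/-- The index of the other section at the corner; the third section is not involved. -/
def otherArm (i : Fin 3) : Fin 3 := if i = 0 then 1 else if i = 1 then 0 else 2

theorem opW_of_pos (ρ : Fin 3 → ℝ → ℝ) (i : Fin 3) {s : ℝ} (hs : 0 < s) :
    G.opW ρ i s = if i = 2 then 0 else G.opL (ρ (otherArm i)) s := by
  fin_cases i <;> simp [opW, angleBar, hs.ne', otherArm]

theorem opWm_of_pos (m : ℕ) (ρ : Fin 3 → ℝ → ℝ) (i : Fin 3) {s : ℝ} (hs : 0 < s) :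
    G.opWm m ρ i s = if i = 2 then 0 else G.opLm m (ρ (otherArm i)) s := by
  fin_cases i <;> simp [opWm, angleBar, hs.ne', otherArm]

/-- At the corner the integral part vanishes, since `L(t,0) = 0` also for `t = 0`. -/
theorem opW_at_zero (ρ : Fin 3 → ℝ → ℝ) (i : Fin 3) :
    G.opW ρ i 0 = if i = 2 then 0 else -(G.χ * Real.pi) * ρ i 0 := by
  fin_cases i <;> simp [opW, angleBar, opL_zero] <;> ring

theorem opW_corner (f : spaceX) : G.opW (extendReal f) 0 0 = G.opW (extendReal f) 1 0 := by
  rw [opW_at_zero, opW_at_zero, extendReal_corner]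
  simp

theorem continuousOn_opW (f : spaceX) (i : Fin 3) :
    ContinuousOn (G.opW (extendReal f) i) (Icc 0 1) := by
  intro s hs
  rcases hs.1.eq_or_lt with rfl | hs0
  · refine ContinuousWithinAt.mono (t := Ici 0) ?_ Icc_subset_Ici_self
    rw [← continuousWithinAt_Ioi_iff_Ici]
    have hev : ∀ᶠ s in 𝓝[>] (0 : ℝ), (if i = 2 then 0 else
        G.opL (extendReal (f : Fin 3 → C(unitInterval, ℝ)) (otherArm i)) s) =
        G.opW (extendReal f) i s := by
      filter_upwards [self_mem_nhdsWithin] with s hs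
      exact (G.opW_of_pos _ i hs).symm
    rw [ContinuousWithinAt, opW_at_zero]
    refine Tendsto.congr' hev ?_
    split_ifs with hi
    · exact tendsto_const_nhds
    · have hlim := G.tendsto_opL (continuous_extendReal (f : Fin 3 → C(unitInterval, ℝ)) (otherArm i))
      have hcorner : extendReal (f : Fin 3 → C(unitInterval, ℝ)) (otherArm i) 0 =
          extendReal (f : Fin 3 → C(unitInterval, ℝ)) i 0 := by
        have := extendReal_corner f
        fin_cases i
        · exact this.symm
        · exact this
        · exact absurd rfl hi
      rwa [hcorner] at hlim
  · refine ContinuousAt.continuousWithinAt ?_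
    have hev : (fun s => if i = 2 then 0 else
        G.opL (extendReal (f : Fin 3 → C(unitInterval, ℝ)) (otherArm i)) s) =ᶠ[𝓝 s]
        G.opW (extendReal f) i := by
      filter_upwards [lt_mem_nhds hs0] with s hs
      exact (G.opW_of_pos _ i hs).symm
    refine ContinuousAt.congr ?_ hev
    split_ifs
    · exact continuousAt_const
    · exact (G.continuousOn_opL (continuous_extendReal _ _)).continuousAt (Ioi_mem_nhds hs0)

theorem abs_opW_le (f : spaceX) (i : Fin 3) {s : ℝ} (hs : s ∈ Icc (0 : ℝ) 1) :
    |G.opW (extendReal f) i s| ≤ |G.χ| * Real.pi * ‖f‖ := by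
  have hpi := Real.pi_pos
  rcases hs.1.eq_or_lt with rfl | hs0
  · rw [opW_at_zero]
    split_ifs
    · rw [abs_zero]; positivity
    · rw [abs_mul, abs_neg, abs_mul, abs_of_pos hpi]
      exact mul_le_mul_of_nonneg_left (abs_extendReal_le f i 0) (by positivity)
  · rw [G.opW_of_pos _ _ hs0]
    split_ifs
    · rw [abs_zero]; positivity
    · exact G.abs_opL_le hs0 (continuous_extendReal _ _).continuousOn
        fun t _ => abs_extendReal_le f _ t

theorem opL_add {f g : ℝ → ℝ} (hf : Continuous f) (hg : Continuous g) (s : ℝ) :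
    G.opL (fun t => f t + g t) s = G.opL f s + G.opL g s := by
  unfold opL
  simp only [mul_add]
  exact intervalIntegral.integral_add (G.intervalIntegrable_kernelL_mul s hf.continuousOn)
    (G.intervalIntegrable_kernelL_mul s hg.continuousOn)

theorem opL_const_mul (a : ℝ) (f : ℝ → ℝ) (s : ℝ) :
    G.opL (fun t => a * f t) s = a * G.opL f s := by
  unfold opL
  simp only [mul_left_comm _ a]
  exact intervalIntegral.integral_const_mul _ _

theorem opLm_add (m : ℕ) (f g : ℝ → ℝ) (s : ℝ) :
    G.opLm m (fun t => f t + g t) s = G.opLm m f s + G.opLm m g s := by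
  simp only [opLm, mul_add, Finset.sum_add_distrib]

theorem opLm_const_mul (m : ℕ) (a : ℝ) (f : ℝ → ℝ) (s : ℝ) :
    G.opLm m (fun t => a * f t) s = a * G.opLm m f s := by
  simp only [opLm, mul_left_comm _ a, Finset.mul_sum]

theorem opW_add (f g : spaceX) (i : Fin 3) (s : ℝ) :
    G.opW (extendReal (f + g : spaceX)) i s =
      G.opW (extendReal f) i s + G.opW (extendReal g) i s := by
  have h : ∀ j, extendReal ((f : Fin 3 → C(unitInterval, ℝ)) + g) j = fun t =>
      extendReal (f : Fin 3 → C(unitInterval, ℝ)) j t + extendReal g j t := fun j => rfl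
  have hL := fun j => G.opL_add (continuous_extendReal (f : Fin 3 → C(unitInterval, ℝ)) j)
    (continuous_extendReal (g : Fin 3 → C(unitInterval, ℝ)) j) s
  fin_cases i <;> simp [opW, h, hL] <;> ring

theorem opW_smul (a : ℝ) (f : spaceX) (i : Fin 3) (s : ℝ) :
    G.opW (extendReal (a • f : spaceX)) i s = a * G.opW (extendReal f) i s := by
  have h : ∀ j, extendReal (a • (f : Fin 3 → C(unitInterval, ℝ))) j = fun t =>
      a * extendReal (f : Fin 3 → C(unitInterval, ℝ)) j t := fun j => rfl
  fin_cases i <;> simp [opW, h, opL_const_mul] <;> ring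

theorem opWm_add (m : ℕ) (f g : spaceX) (i : Fin 3) (s : ℝ) :
    G.opWm m (extendReal (f + g : spaceX)) i s =
      G.opWm m (extendReal f) i s + G.opWm m (extendReal g) i s := by
  have h : ∀ j, extendReal ((f : Fin 3 → C(unitInterval, ℝ)) + g) j = fun t =>
      extendReal (f : Fin 3 → C(unitInterval, ℝ)) j t + extendReal g j t := fun j => rfl
  fin_cases i <;> simp [opWm, h, opLm_add] <;> ring

theorem opWm_smul (m : ℕ) (a : ℝ) (f : spaceX) (i : Fin 3) (s : ℝ) :
    G.opWm m (extendReal (a • f : spaceX)) i s = a * G.opWm m (extendReal f) i s := by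
  have h : ∀ j, extendReal (a • (f : Fin 3 → C(unitInterval, ℝ))) j = fun t =>
      a * extendReal (f : Fin 3 → C(unitInterval, ℝ)) j t := fun j => rfl
  fin_cases i <;> simp [opWm, h, opLm_const_mul] <;> ring

/-- The operator `𝒲` on `𝒳`. -/
theorem exists_operatorW : ∃ W : spaceX →L[ℝ] spaceX,
    (∀ (f : spaceX) (i : Fin 3) (s : unitInterval),
      (W f : Fin 3 → C(unitInterval, ℝ)) i s = G.opW (extendReal f) i s) ∧
    ∀ f, ‖W f‖ ≤ |G.χ| * Real.pi * ‖f‖ := by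
  have hpi := Real.pi_pos
  exact exists_operator_spaceX G.opW (fun f g i s _ => G.opW_add f g i s)
    (fun a f i s _ => G.opW_smul a f i s) G.continuousOn_opW G.opW_corner (by positivity)
    fun f i s hs => G.abs_opW_le f i hs

/-- The modified operator is an interpolation between the discrete operator, at a point not below
the threshold, and the value at the corner. -/
theorem opWmod_eq {c ε : ℝ} {m : ℕ} (hth : 0 < threshold c ε m) (ρ : Fin 3 → ℝ → ℝ) (i : Fin 3)
    (s : ℝ) : G.opWmod c ε m ρ i s =
      min (s / threshold c ε m) 1 * G.opWm m ρ i (max s (threshold c ε m)) +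
        (1 - min (s / threshold c ε m) 1) * G.opW ρ i 0 := by
  rw [opWmod]
  split_ifs with h
  · rw [min_eq_right ((one_le_div hth).2 h), max_eq_left h]
    ring
  · rw [not_le] at h
    rw [min_eq_left ((div_le_one hth).2 h.le), max_eq_right h.le]
    field_simp

theorem continuousOn_opLm (m : ℕ) (f : ℝ → ℝ) : ContinuousOn (G.opLm m f) (Ioi 0) := by
  unfold opLm
  refine continuousOn_finsetSum _ fun h _ => (continuousOn_const.mul ?_).mul continuousOn_const
  exact (G.continuousOn_kernelL_right _).mono fun s (hs : 0 < s) => hs.ne'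

theorem continuousOn_opWm (m : ℕ) (ρ : Fin 3 → ℝ → ℝ) (i : Fin 3) :
    ContinuousOn (G.opWm m ρ i) (Ioi 0) := by
  refine ContinuousOn.congr (f := fun s => if i = 2 then 0 else G.opLm m (ρ (otherArm i)) s) ?_
    fun s hs => G.opWm_of_pos m ρ i hs
  split_ifs
  · exact continuousOn_const
  · exact G.continuousOn_opLm m _

theorem continuous_opWmod {c ε : ℝ} {m : ℕ} (hth : 0 < threshold c ε m) (ρ : Fin 3 → ℝ → ℝ)
    (i : Fin 3) : Continuous (G.opWmod c ε m ρ i) := by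
  rw [show G.opWmod c ε m ρ i = _ from funext (G.opWmod_eq hth ρ i)]
  have h1 : Continuous fun s => min (s / threshold c ε m) 1 := by fun_prop
  have h2 : Continuous fun s => G.opWm m ρ i (max s (threshold c ε m)) :=
    (G.continuousOn_opWm m ρ i).comp_continuous (by fun_prop) fun s => lt_max_of_lt_right hth
  exact (h1.mul h2).add ((continuous_const.sub h1).mul continuous_const)

theorem opWmod_zero {c ε : ℝ} {m : ℕ} (hth : 0 < threshold c ε m) (ρ : Fin 3 → ℝ → ℝ)
    (i : Fin 3) : G.opWmod c ε m ρ i 0 = G.opW ρ i 0 := by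
  rw [G.opWmod_eq hth]
  simp

theorem abs_convex_combination_le {l x y C : ℝ} (h0 : 0 ≤ l) (h1 : l ≤ 1)
    (hx : |x| ≤ C) (hy : |y| ≤ C) :
    |l * x + (1 - l) * y| ≤ C := by
  have := abs_add_le (l * x) ((1 - l) * y)
  rw [abs_mul, abs_mul, abs_of_nonneg h0, abs_of_nonneg (sub_nonneg.2 h1)] at this
  nlinarith [mul_le_mul_of_nonneg_left hx h0, mul_le_mul_of_nonneg_left hy (sub_nonneg.2 h1)]

theorem abs_opWmod_le {c ε : ℝ} {m : ℕ} (hth : 0 < threshold c ε m) (hth1 : threshold c ε m ≤ 1)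
    {A : ℝ} (hA : |G.χ| * Real.pi ≤ A)
    (h : ∀ s ∈ Icc (threshold c ε m) 1,
      ∑ h : Fin (m + 2), Lobatto.coeff m h * |G.kernelL (Lobatto.node m h) s| ≤ A)
    (f : spaceX) (i : Fin 3) {s : ℝ} (hs : s ∈ Icc (0 : ℝ) 1) :
    |G.opWmod c ε m (extendReal f) i s| ≤ A * ‖f‖ := by
  have hpi := Real.pi_pos
  have hA0 : 0 ≤ A := le_trans (by positivity) hA
  rw [G.opWmod_eq hth]
  refine abs_convex_combination_le (le_min (div_nonneg hs.1 hth.le) zero_le_one) (min_le_right _ _) ?_ ?_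
  · have hmax : max s (threshold c ε m) ∈ Icc (threshold c ε m) 1 :=
      ⟨le_max_right _ _, max_le hs.2 hth1⟩
    rw [G.opWm_of_pos _ _ _ (hth.trans_le hmax.1)]
    split_ifs
    · rw [abs_zero]; positivity
    · exact G.abs_opLm_le (fun t _ => abs_extendReal_le f _ t) (h _ hmax)
  · exact (G.abs_opW_le f i (by simp)).trans (mul_le_mul_of_nonneg_right hA (norm_nonneg f))

theorem opWmod_add {c ε : ℝ} {m : ℕ} (hth : 0 < threshold c ε m) (f g : spaceX) (i : Fin 3)
    (s : ℝ) : G.opWmod c ε m (extendReal (f + g : spaceX)) i s =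
      G.opWmod c ε m (extendReal f) i s + G.opWmod c ε m (extendReal g) i s := by
  simp only [G.opWmod_eq hth, opWm_add, opW_add]
  ring

theorem opWmod_smul {c ε : ℝ} {m : ℕ} (hth : 0 < threshold c ε m) (a : ℝ) (f : spaceX)
    (i : Fin 3) (s : ℝ) : G.opWmod c ε m (extendReal (a • f : spaceX)) i s =
      a * G.opWmod c ε m (extendReal f) i s := by
  simp only [G.opWmod_eq hth, opWm_smul, opW_smul]
  ring

/-- The operator `𝒲̃_m` on `𝒳`. -/
theorem exists_operatorWmod {c ε : ℝ} {m : ℕ} (hth : 0 < threshold c ε m)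
    (hth1 : threshold c ε m ≤ 1) {A : ℝ} (hA : |G.χ| * Real.pi ≤ A)
    (h : ∀ s ∈ Icc (threshold c ε m) 1,
      ∑ h : Fin (m + 2), Lobatto.coeff m h * |G.kernelL (Lobatto.node m h) s| ≤ A) :
    ∃ B : spaceX →L[ℝ] spaceX, (∀ (f : spaceX) (i : Fin 3) (s : unitInterval),
      (B f : Fin 3 → C(unitInterval, ℝ)) i s = G.opWmod c ε m (extendReal f) i s) ∧
      ∀ f, ‖B f‖ ≤ A * ‖f‖ := by
  have hpi := Real.pi_pos
  refine exists_operator_spaceX (G.opWmod c ε m) (fun f g i s _ => G.opWmod_add hth f g i s)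
    (fun a f i s _ => G.opWmod_smul hth a f i s)
    (fun f i => (G.continuous_opWmod hth _ i).continuousOn) (fun f => ?_)
    (le_trans (by positivity) hA) fun f i s hs => G.abs_opWmod_le hth hth1 hA h f i hs
  rw [G.opWmod_zero hth, G.opWmod_zero hth, opW_corner]

/-- The modified operators converge strongly: beyond the threshold by the convergence of the
quadrature, below it by the continuity of the limit at the corner. -/
theorem opWmod_error {c ε : ℝ} (hc : 0 < c) (hε : 0 < ε) (hε1 : ε < 1) (f : spaceX) {η : ℝ}
    (hη : 0 < η) : ∀ᶠ m : ℕ in atTop, ∀ (i : Fin 3), ∀ s ∈ Icc (0 : ℝ) 1,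
      |G.opWmod c ε m (extendReal f) i s - G.opW (extendReal f) i s| ≤ η := by
  have hη2 : 0 < η / 2 := by positivity
  have hL : ∀ᶠ m : ℕ in atTop, ∀ j : Fin 3, ∀ s ∈ Icc (threshold c ε m) 1,
      |G.opLm m (extendReal (f : Fin 3 → C(unitInterval, ℝ)) j) s -
        G.opL (extendReal (f : Fin 3 → C(unitInterval, ℝ)) j) s| ≤ η / 2 :=
    eventually_all.2 fun j => G.opLm_error hc hε (continuous_extendReal _ j) hη2
  have hδ : ∀ i : Fin 3, ∃ δ > 0, ∀ s ∈ Icc (0 : ℝ) 1, s < δ →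
      |G.opW (extendReal f) i s - G.opW (extendReal f) i 0| < η / 4 := by
    intro i
    obtain ⟨δ, hδ, h⟩ := Metric.continuousWithinAt_iff.1 (G.continuousOn_opW f i 0 (by simp))
      (η / 4) (by positivity)
    refine ⟨δ, hδ, fun s hs hsδ => h hs ?_⟩
    rwa [Real.dist_eq, sub_zero, abs_of_nonneg hs.1]
  choose δ hδ0 hδ using hδ
  have hth0 := tendsto_threshold c hε1
  have hthδ : ∀ᶠ m : ℕ in atTop, ∀ i, threshold c ε m < δ i :=
    eventually_all.2 fun i => hth0.eventually (gt_mem_nhds (hδ0 i))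
  filter_upwards [hL, hthδ, hth0.eventually (gt_mem_nhds one_pos), eventually_ge_atTop 1]
    with m hL hthδ hth1 hm i s hs
  have hth := threshold_pos hc ε hm
  have hW : ∀ s ∈ Icc (threshold c ε m) 1,
      |G.opWm m (extendReal f) i s - G.opW (extendReal f) i s| ≤ η / 2 := by
    intro s hs
    have hs0 := hth.trans_le hs.1
    rw [G.opWm_of_pos _ _ _ hs0, G.opW_of_pos _ _ hs0]
    split_ifs
    · rw [sub_self, abs_zero]; exact hη2.le
    · exact hL _ s hs
  rw [G.opWmod_eq hth]
  set l := min (s / threshold c ε m) 1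
  set r := max s (threshold c ε m) with hr
  have hmax : r ∈ Icc (threshold c ε m) 1 := ⟨le_max_right _ _, max_le hs.2 hth1.le⟩
  have h1 := hW r hmax
  rcases le_or_gt (threshold c ε m) s with h | h
  · have hl : l = 1 := min_eq_right ((one_le_div hth).2 h)
    rw [hl, one_mul, sub_self, zero_mul, add_zero]
    have : r = s := max_eq_left h
    rw [this] at h1 ⊢
    linarith
  · have hrth : r = threshold c ε m := max_eq_right h.le
    have h2 := hδ i r ⟨hth.le.trans hmax.1, hmax.2⟩ (hrth ▸ hthδ i)
    have h3 := hδ i s hs (h.trans (hthδ i))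
    have e : l * G.opWm m (extendReal f) i r + (1 - l) * G.opW (extendReal f) i 0 -
        G.opW (extendReal f) i s = l * (G.opWm m (extendReal f) i r - G.opW (extendReal f) i s) +
          (1 - l) * (G.opW (extendReal f) i 0 - G.opW (extendReal f) i s) := by ring
    rw [e]
    refine abs_convex_combination_le (le_min (div_nonneg hs.1 hth.le) zero_le_one) (min_le_right _ _) ?_ ?_
    · rw [abs_le] at h1 ⊢
      rw [abs_lt] at h2 h3
      constructor <;> linarith [h1.1, h1.2, h2.1, h2.2, h3.1, h3.2]
    · rw [abs_lt] at h3
      rw [abs_le]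
      constructor <;> linarith [h3.1, h3.2]

end CornerDomain

/-! ### Sampling at the nodes and the collocation matrix -/

theorem condNumber_le_mul {E : Type*} [NormedAddCommGroup E] [NormedSpace ℝ E] {T : E ≃L[ℝ] E}
    {a b : ℝ} (ha : 0 ≤ a) (hb : 0 ≤ b) (hT : ∀ f, ‖T f‖ ≤ a * ‖f‖)
    (hT' : ∀ f, ‖T.symm f‖ ≤ b * ‖f‖) : condNumber T ≤ a * b :=
  mul_le_mul (ContinuousLinearMap.opNorm_le_bound _ ha hT)
    (ContinuousLinearMap.opNorm_le_bound _ hb hT') (norm_nonneg _) ha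

/-- If `R` is a contraction that intertwines `T` and `A`, and every vector has a preimage under `R`
of no larger norm, then `A` is not worse conditioned than `T`. -/
theorem condNumber_le_of_intertwining {E F : Type*} [NormedAddCommGroup E] [NormedSpace ℝ E]
    [NormedAddCommGroup F] [NormedSpace ℝ F] {T : E ≃L[ℝ] E} {A : F ≃L[ℝ] F} {R : E → F}
    (hR : ∀ f, ‖R f‖ ≤ ‖f‖) (hAR : ∀ f, A (R f) = R (T f))
    (hlift : ∀ v, ∃ f, R f = v ∧ ‖f‖ ≤ ‖v‖) : condNumber A ≤ condNumber T := by
  refine condNumber_le_mul (norm_nonneg _) (norm_nonneg _) (fun v => ?_) fun w => ?_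
  · obtain ⟨f, rfl, hf⟩ := hlift v
    rw [hAR]
    calc ‖R (T f)‖ ≤ ‖T f‖ := hR _
      _ ≤ ‖(T : E →L[ℝ] E)‖ * ‖f‖ := (T : E →L[ℝ] E).le_opNorm f
      _ ≤ ‖(T : E →L[ℝ] E)‖ * ‖R f‖ := mul_le_mul_of_nonneg_left hf (norm_nonneg _)
  · obtain ⟨g, rfl, hg⟩ := hlift w
    have h : A.symm (R g) = R (T.symm g) := by
      rw [A.symm_apply_eq, hAR, T.apply_symm_apply]
    rw [h]
    calc ‖R (T.symm g)‖ ≤ ‖T.symm g‖ := hR _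
      _ ≤ ‖(T.symm : E →L[ℝ] E)‖ * ‖g‖ := (T.symm : E →L[ℝ] E).le_opNorm g
      _ ≤ ‖(T.symm : E →L[ℝ] E)‖ * ‖R g‖ := mul_le_mul_of_nonneg_left hg (norm_nonneg _)

/-- The values of a triple of functions at the nodes of the Lobatto rule. -/
noncomputable def sampleNodes (m : ℕ) (f : spaceX) : arraySpace m :=
  ⟨fun p => extendReal f p.1 (Lobatto.node m p.2), by
    change extendReal f 0 (Lobatto.node m ((0 : Fin (m + 2)) : ℕ)) =
      extendReal f 1 (Lobatto.node m ((0 : Fin (m + 2)) : ℕ))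
    rw [Fin.val_zero, Lobatto.node_zero, extendReal_corner]⟩

theorem norm_sampleNodes_le (m : ℕ) (f : spaceX) : ‖sampleNodes m f‖ ≤ ‖f‖ :=
  (pi_norm_le_iff_of_nonneg (norm_nonneg f)).2 fun p => abs_extendReal_le f p.1 _

/-- Every array is interpolated by a triple of functions with the same norm, by the Tietze
extension theorem. -/
theorem exists_sampleNodes_eq (m : ℕ) (v : arraySpace m) :
    ∃ f : spaceX, sampleNodes m f = v ∧ ‖f‖ ≤ ‖v‖ := by
  set e : Fin (m + 2) → unitInterval := fun h => ⟨Lobatto.node m h, Lobatto.node_mem_Icc h.2⟩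
    with he_def
  have he : IsClosedEmbedding e := by
    refine IsClosedEmbedding.of_continuous_injective_isClosedMap continuous_of_discreteTopology
      (fun a b hab => Lobatto.node_injective m (congrArg Subtype.val hab)) ?_
    exact (continuous_of_discreteTopology (f := e)).isClosedMap
  have hext : ∀ j : Fin 3, ∃ g : C(unitInterval, ℝ),
      (∀ h, g (e h) = (v : Fin 3 × Fin (m + 2) → ℝ) (j, h)) ∧ ∀ s, |g s| ≤ ‖v‖ := by
    intro j
    set u : BoundedContinuousFunction (Fin (m + 2)) ℝ := BoundedContinuousFunction.mkOfCompact
      ⟨fun h => (v : Fin 3 × Fin (m + 2) → ℝ) (j, h), continuous_of_discreteTopology⟩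
    obtain ⟨g, hg, hge⟩ := BoundedContinuousFunction.exists_extension_norm_eq_of_isClosedEmbedding
      u he
    refine ⟨g.toContinuousMap, fun h => congrFun hge h, fun s => ?_⟩
    refine (g.norm_coe_le_norm s).trans ?_
    rw [hg]
    exact (BoundedContinuousFunction.norm_le (norm_nonneg v)).2 fun h =>
      norm_le_pi_norm (v : Fin 3 × Fin (m + 2) → ℝ) (j, h)
  choose g hg hgv using hext
  have he0 : e 0 = 0 := Subtype.ext (by simp [he_def, Lobatto.node_zero])
  have hmem : g ∈ spaceX := by
    change g 0 0 = g 1 0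
    rw [← he0, hg, hg]
    exact v.2
  refine ⟨⟨g, hmem⟩, Subtype.ext (funext fun p => ?_), norm_spaceX_le (norm_nonneg v) hgv⟩
  change extendReal g p.1 (e p.2 : ℝ) = _
  rw [extendReal_coe, hg]

namespace CornerDomain.Sections

variable {G : CornerDomain} (Γ : G.Sections)

/-- The collocation matrix inherits invertibility and the condition number from the operator. -/
theorem exists_matrix_equiv {c ε : ℝ} (hc : 0 < c) {m : ℕ} (hm : 1 ≤ m) {T : spaceX ≃L[ℝ] spaceX}
    (hT : ∀ (ρ : spaceX) (i : Fin 3) (s : unitInterval),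
      (T ρ : Fin 3 → C(unitInterval, ℝ)) i s = Γ.opNystrom c ε m (extendReal ρ) i s) :
    ∃ A : arraySpace m ≃L[ℝ] arraySpace m, (∀ v : arraySpace m,
      (A v : Fin 3 × Fin (m + 2) → ℝ) = (Γ.matrixA c ε m).mulVec v) ∧
      condNumber A ≤ condNumber T := by
  have hsample : ∀ f : spaceX, (Γ.matrixA c ε m).mulVec (sampleNodes m f) =
      (sampleNodes m (T f) : Fin 3 × Fin (m + 2) → ℝ) := by
    intro f
    funext p
    have hnode := Lobatto.node_mem_Icc p.2.2
    refine (Γ.matrixA_mulVec hc ε hm (extendReal f) p.1 p.2).trans ?_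
    refine (hT f p.1 ⟨_, hnode⟩).symm.trans ?_
    exact (extendReal_of_mem _ _ hnode).symm
  have hmaps : ∀ v ∈ arraySpace m, (Γ.matrixA c ε m).mulVecLin v ∈ arraySpace m := by
    intro v hv
    obtain ⟨f, hf, -⟩ := exists_sampleNodes_eq m ⟨v, hv⟩
    have : v = (sampleNodes m f : Fin 3 × Fin (m + 2) → ℝ) := by rw [hf]
    rw [Matrix.mulVecLin_apply, this, hsample]
    exact (sampleNodes m (T f)).2
  set M : arraySpace m →ₗ[ℝ] arraySpace m := (Γ.matrixA c ε m).mulVecLin.restrict hmaps with hM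
  have hMR : ∀ f, M (sampleNodes m f) = sampleNodes m (T f) := fun f => Subtype.ext (hsample f)
  have hsurj : Function.Surjective M := by
    intro w
    obtain ⟨g, rfl, -⟩ := exists_sampleNodes_eq m w
    exact ⟨sampleNodes m (T.symm g), by rw [hMR, T.apply_symm_apply]⟩
  have hinj : Function.Injective M := LinearMap.injective_iff_surjective.2 hsurj
  refine ⟨(LinearEquiv.ofBijective M ⟨hinj, hsurj⟩).toContinuousLinearEquiv, fun v => rfl, ?_⟩
  exact condNumber_le_of_intertwining (norm_sampleNodes_le m) hMR (exists_sampleNodes_eq m)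

/-! ### The operators with continuous kernels -/

theorem kernelS_decomposition (i : Fin 3) (t s : ℝ) (j : Fin 3) :
    Γ.kernelK i j t s = Γ.kernelS i j t s +
      if (i = 0 ∧ j = 1) ∨ (i = 1 ∧ j = 0) then G.kernelL t s else 0 := by
  fin_cases i <;> fin_cases j <;> simp [kernelS, kernelM]

theorem continuousOn_kernelS_mul {i j : Fin 3}
    (hS : ContinuousOn (fun p : ℝ × ℝ => Γ.kernelS i j p.1 p.2) (Icc 0 1 ×ˢ Icc 0 1))
    {f : ℝ → ℝ} (hf : Continuous f) {s : ℝ} (hs : s ∈ Icc (0 : ℝ) 1) :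
    ContinuousOn (fun t => Γ.kernelS i j t s * f t) (Icc 0 1) := by
  refine ContinuousOn.mul ?_ hf.continuousOn
  exact hS.comp (f := fun t : ℝ => (t, s)) (by fun_prop) fun t ht => ⟨ht, hs⟩

/-- The operator `𝒮 = 𝒦 - 𝒲` is the integral operator with the kernels `S^{i,j}`. -/
theorem opS_eq (hS : ∀ i j : Fin 3,
      ContinuousOn (fun p : ℝ × ℝ => Γ.kernelS i j p.1 p.2) (Icc 0 1 ×ˢ Icc 0 1))
    {ρ : Fin 3 → ℝ → ℝ} (hρ : ∀ j, Continuous (ρ j)) (i : Fin 3) {s : ℝ}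
    (hs : s ∈ Icc (0 : ℝ) 1) :
    Γ.opS ρ i s = ∑ j : Fin 3, ∫ t in (0 : ℝ)..1, Γ.kernelS i j t s * ρ j t := by
  have hK : ∀ j, ∫ t in (0 : ℝ)..1, Γ.kernelK i j t s * ρ j t =
      (∫ t in (0 : ℝ)..1, Γ.kernelS i j t s * ρ j t) +
        if (i = 0 ∧ j = 1) ∨ (i = 1 ∧ j = 0) then G.opL (ρ j) s else 0 := by
    intro j
    simp only [Γ.kernelS_decomposition i _ s j, add_mul]
    split_ifs
    · rw [intervalIntegral.integral_add]
      · rfl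
      · exact (Γ.continuousOn_kernelS_mul (hS i j) (hρ j) hs).intervalIntegrable_of_Icc
          zero_le_one
      · exact G.intervalIntegrable_kernelL_mul s (hρ j).continuousOn
    · simp
  rw [opS, opK]
  simp only [hK, Finset.sum_add_distrib]
  have hsum : ∑ j : Fin 3, (if (i = 0 ∧ j = 1) ∨ (i = 1 ∧ j = 0) then G.opL (ρ j) s else 0) =
      G.opW ρ i s - (-Real.pi + G.angleBar i s) * ρ i s := by
    fin_cases i <;> simp [opW, angleBar]
  rw [hsum]
  ring

theorem tendsto_opSm (hS : ∀ i j : Fin 3,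
      ContinuousOn (fun p : ℝ × ℝ => Γ.kernelS i j p.1 p.2) (Icc 0 1 ×ˢ Icc 0 1))
    {ρ : Fin 3 → ℝ → ℝ} (hρ : ∀ j, Continuous (ρ j)) (i : Fin 3) {s : ℝ}
    (hs : s ∈ Icc (0 : ℝ) 1) :
    Tendsto (fun m => Γ.opSm m ρ i s) atTop (𝓝 (Γ.opS ρ i s)) := by
  rw [Γ.opS_eq hS hρ i hs]
  unfold opSm
  refine tendsto_finsetSum _ fun j _ => ?_
  refine (Lobatto.tendsto_quadrature
    (Γ.continuousOn_kernelS_mul (hS i j) (hρ j) hs)).congr fun m => ?_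
  exact Finset.sum_congr rfl fun h _ => (mul_assoc _ _ _).symm

theorem opSm_add (m : ℕ) (f g : spaceX) (i : Fin 3) (s : ℝ) :
    Γ.opSm m (extendReal (f + g : spaceX)) i s =
      Γ.opSm m (extendReal f) i s + Γ.opSm m (extendReal g) i s := by
  simp only [opSm, Submodule.coe_add, extendReal_add, mul_add, Finset.sum_add_distrib]

theorem opSm_smul (m : ℕ) (a : ℝ) (f : spaceX) (i : Fin 3) (s : ℝ) :
    Γ.opSm m (extendReal (a • f : spaceX)) i s = a * Γ.opSm m (extendReal f) i s := by
  simp only [opSm, Submodule.coe_smul, extendReal_smul, mul_left_comm _ a, Finset.mul_sum]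

theorem opSm_corner (m : ℕ) (ρ : Fin 3 → ℝ → ℝ) : Γ.opSm m ρ 0 0 = Γ.opSm m ρ 1 0 := by
  simp only [opSm, kernelS_corner]

theorem continuousOn_opSm (hS : ∀ i j : Fin 3,
      ContinuousOn (fun p : ℝ × ℝ => Γ.kernelS i j p.1 p.2) (Icc 0 1 ×ˢ Icc 0 1))
    (m : ℕ) (ρ : Fin 3 → ℝ → ℝ) (i : Fin 3) : ContinuousOn (Γ.opSm m ρ i) (Icc 0 1) := by
  unfold opSm
  refine continuousOn_finsetSum _ fun j _ => continuousOn_finsetSum _ fun h _ =>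
    (continuousOn_const.mul ?_).mul continuousOn_const
  exact (hS i j).comp (f := fun s : ℝ => (Lobatto.node m h, s)) (by fun_prop)
    fun s hs => ⟨Lobatto.node_mem_Icc h.2, hs⟩

/-- The operators `𝒮_m` on `𝒳`, with a common bound. -/
theorem exists_operatorSm (hS : ∀ i j : Fin 3,
      ContinuousOn (fun p : ℝ × ℝ => Γ.kernelS i j p.1 p.2) (Icc 0 1 ×ˢ Icc 0 1)) :
    ∃ C : ℝ, 0 ≤ C ∧ ∀ m : ℕ, 1 ≤ m → ∃ B : spaceX →L[ℝ] spaceX,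
      (∀ (f : spaceX) (i : Fin 3) (s : unitInterval),
        (B f : Fin 3 → C(unitInterval, ℝ)) i s = Γ.opSm m (extendReal f) i s) ∧
      ∀ f, ‖B f‖ ≤ C * ‖f‖ := by
  have hb : ∀ i j : Fin 3, ∃ b, ∀ p ∈ Icc (0 : ℝ) 1 ×ˢ Icc (0 : ℝ) 1,
      ‖Γ.kernelS i j p.1 p.2‖ ≤ b := fun i j =>
    (isCompact_Icc.prod isCompact_Icc).exists_bound_of_continuousOn (hS i j)
  choose b hb using hb
  have hb0 : ∀ i j, 0 ≤ b i j := fun i j => (norm_nonneg _).trans (hb i j (0, 0) (by simp))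
  have hC : 0 ≤ ∑ i, ∑ j, b i j := Finset.sum_nonneg fun i _ => Finset.sum_nonneg fun j _ => hb0 i j
  refine ⟨∑ i, ∑ j, b i j, hC, fun m hm => ?_⟩
  refine exists_operator_spaceX (Γ.opSm m) (fun f g i s _ => Γ.opSm_add m f g i s)
    (fun a f i s _ => Γ.opSm_smul m a f i s) (fun f i => Γ.continuousOn_opSm hS m _ i)
    (fun f => Γ.opSm_corner m _) hC fun f i s hs => ?_
  have hrow : |Γ.opSm m (extendReal f) i s| ≤ ∑ j, b i j * ‖f‖ := by
    refine (Finset.abs_sum_le_sum_abs _ _).trans (Finset.sum_le_sum fun j _ => ?_)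
    have := Lobatto.norm_quadrature_le (f := fun t => Γ.kernelS i j t s *
      extendReal (f : Fin 3 → C(unitInterval, ℝ)) j t) (C := b i j * ‖f‖) hm fun t ht => by
        rw [norm_mul]
        exact mul_le_mul (hb i j (t, s) ⟨ht, hs⟩) (abs_extendReal_le f j t) (norm_nonneg _)
          (hb0 i j)
    simpa only [smul_eq_mul, mul_assoc, Real.norm_eq_abs] using this
  rw [← Finset.sum_mul] at hrow
  refine hrow.trans (mul_le_mul_of_nonneg_right ?_ (norm_nonneg f))
  exact Finset.single_le_sum (f := fun i => ∑ j, b i j)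
    (fun i _ => Finset.sum_nonneg fun j _ => hb0 i j) (Finset.mem_univ i)

open scoped Pointwise in
/-- The operators `𝒮_m` are collectively compact. -/
theorem exists_compact_opSm (hS : ∀ i j : Fin 3,
      ContinuousOn (fun p : ℝ × ℝ => Γ.kernelS i j p.1 p.2) (Icc 0 1 ×ˢ Icc 0 1)) :
    ∃ K : Set spaceX, IsCompact K ∧ ∀ m : ℕ, 1 ≤ m → ∀ f g : spaceX, ‖f‖ ≤ 1 →
      (∀ (i : Fin 3) (s : unitInterval),
        (g : Fin 3 → C(unitInterval, ℝ)) i s = Γ.opSm m (extendReal f) i s) → g ∈ K := by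
  set k : Fin 3 → Fin 3 → C(unitInterval, C(unitInterval, ℝ)) := fun i j => ContinuousMap.curry
    ⟨fun p : unitInterval × unitInterval => Γ.kernelS i j p.1 p.2,
      (hS i j).comp_continuous (f := fun p : unitInterval × unitInterval => ((p.1 : ℝ), (p.2 : ℝ)))
        (by fun_prop) fun p => ⟨p.1.2, p.2.2⟩⟩ with hk
  have hK := fun i j => exists_compact_of_averages (k i j).continuous
  choose K hKc hK using hK
  have hsum : ∀ i, IsCompact (K i 0 + K i 1 + K i 2) := fun i =>
    ((hKc i 0).add (hKc i 1)).add (hKc i 2)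
  refine ⟨Subtype.val ⁻¹' univ.pi fun i => K i 0 + K i 1 + K i 2,
    isClosed_spaceX.isClosedEmbedding_subtypeVal.isCompact_preimage
      (isCompact_univ_pi hsum), fun m hm f g hf hg => ?_⟩
  set x : Fin (m + 2) → unitInterval := fun h => ⟨Lobatto.node m h, Lobatto.node_mem_Icc h.2⟩
  intro i _
  have hterm : ∀ j, ∑ h : Fin (m + 2), Lobatto.coeff m h •
      extendReal (f : Fin 3 → C(unitInterval, ℝ)) j (Lobatto.node m h) • k i j (x h) ∈ K i j :=
    fun j => hK i j (m + 2) (fun h => Lobatto.coeff m h)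
      (fun h => extendReal (f : Fin 3 → C(unitInterval, ℝ)) j (Lobatto.node m h)) x
      (fun h => Lobatto.coeff_nonneg h.2) (Lobatto.sum_coeff hm)
      fun h => (abs_extendReal_le f j _).trans hf
  have hgi : (g : Fin 3 → C(unitInterval, ℝ)) i = ∑ j : Fin 3, ∑ h : Fin (m + 2),
      Lobatto.coeff m h • extendReal (f : Fin 3 → C(unitInterval, ℝ)) j (Lobatto.node m h) •
        k i j (x h) := by
    ext s
    rw [hg]
    simp only [opSm, ContinuousMap.sum_apply, ContinuousMap.smul_apply, smul_eq_mul]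
    refine Finset.sum_congr rfl fun j _ => Finset.sum_congr rfl fun h _ => ?_
    change _ = _ * (_ * Γ.kernelS i j (Lobatto.node m h) s)
    ring
  rw [hgi, Fin.sum_univ_three]
  exact add_mem_add (add_mem_add (hterm 0) (hterm 1)) (hterm 2)

end CornerDomain.Sections

/-! ### Uniform stability -/

theorem continuous_eval_spaceX (i : Fin 3) (s : unitInterval) :
    Continuous fun f : spaceX => (f : Fin 3 → C(unitInterval, ℝ)) i s :=
  (continuous_eval_const s).comp ((continuous_apply i).comp continuous_subtype_val)

theorem theorem3p5 (G : CornerDomain) (Γ : G.Sections)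
    (hM₁₂ : ContinuousOn (fun p : ℝ × ℝ => Γ.kernelM 0 1 p.1 p.2) (Icc 0 1 ×ˢ Icc 0 1))
    (hM₂₁ : ContinuousOn (fun p : ℝ × ℝ => Γ.kernelM 1 0 p.1 p.2) (Icc 0 1 ×ˢ Icc 0 1))
    (hker : ∀ ρ ∈ spaceX, (∀ i, ∀ s ∈ Icc (0 : ℝ) 1, Γ.opExact (extendReal ρ) i s = 0) → ρ = 0)
    (c ε : ℝ) (hc : 0 < c) (hε : 0 < ε) (hε₁ : ε < 1) :
    ∃ (m₀ : ℕ) (C : ℝ), ∀ m : ℕ, m₀ ≤ m →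
      ∃ (T : spaceX ≃L[ℝ] spaceX) (A : arraySpace m ≃L[ℝ] arraySpace m),
        (∀ (ρ : spaceX) (i : Fin 3) (s : unitInterval),
          (T ρ : Fin 3 → C(unitInterval, ℝ)) i s = Γ.opNystrom c ε m (extendReal ρ) i s) ∧
        (∀ v : arraySpace m,
          (A v : Fin 3 × Fin (m + 2) → ℝ) = (Γ.matrixA c ε m).mulVec v) ∧
        condNumber A ≤ condNumber T ∧ condNumber T ≤ C := by
  have hS := Γ.continuousOn_kernelS hM₁₂ hM₂₁
  have hpi := Real.pi_pos
  -- the norms of the Mellin operators stay below `q`, halfway between `|χ| π` and `π`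
  have hχ : |G.χ| < 1 := abs_lt.2 ⟨G.χ_gt, G.χ_lt⟩
  have hχ0 := abs_nonneg G.χ
  set η := (1 - |G.χ|) / 2 * Real.pi with hη
  have hη0 : 0 < η := mul_pos (by linarith) hpi
  set q := |G.χ| * Real.pi + η with hq
  have hq0 : 0 ≤ q := by positivity
  have hqpi : q < Real.pi := by rw [hq, hη]; nlinarith
  obtain ⟨W, hWf, hWn⟩ := G.exists_operatorW
  have hWq : ∀ f, ‖W f‖ ≤ q * ‖f‖ := fun f =>
    (hWn f).trans (mul_le_mul_of_nonneg_right (by linarith) (norm_nonneg f))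
  have hWm : ∀ᶠ m : ℕ in atTop, ∃ B : spaceX →L[ℝ] spaceX,
      (∀ (f : spaceX) (i : Fin 3) (s : unitInterval),
        (B f : Fin 3 → C(unitInterval, ℝ)) i s = G.opWmod c ε m (extendReal f) i s) ∧
      ∀ f, ‖B f‖ ≤ q * ‖f‖ := by
    filter_upwards [G.sum_abs_kernelL_eventually_le hc hε hη0, eventually_ge_atTop 1,
      (CornerDomain.tendsto_threshold c hε₁).eventually (gt_mem_nhds one_pos)] with m hm hm1 hth
    exact G.exists_operatorWmod (CornerDomain.threshold_pos hc ε hm1) hth.le (by linarith) hm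
  obtain ⟨Wm, hWm⟩ := hWm.choice
  obtain ⟨C, hC, hSm⟩ := Γ.exists_operatorSm hS
  have hSm' : ∀ᶠ m : ℕ in atTop, ∃ B : spaceX →L[ℝ] spaceX,
      (∀ (f : spaceX) (i : Fin 3) (s : unitInterval),
        (B f : Fin 3 → C(unitInterval, ℝ)) i s = Γ.opSm m (extendReal f) i s) ∧
      ∀ f, ‖B f‖ ≤ C * ‖f‖ := by
    filter_upwards [eventually_ge_atTop 1] with m hm using hSm m hm
  obtain ⟨Sm, hSm⟩ := hSm'.choice
  obtain ⟨K, hK, hSK⟩ := Γ.exists_compact_opSm hS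
  have hSmK : ∀ᶠ m in atTop, ∀ f, ‖f‖ ≤ 1 → Sm m f ∈ K := by
    filter_upwards [hSm, eventually_ge_atTop 1] with m hm hm1 f hf
    exact hSK m hm1 f _ hf (hm.1 f)
  have hlim : ∀ f, Tendsto (fun m => Wm m f) atTop (𝓝 (W f)) := by
    intro f
    rw [Metric.tendsto_nhds]
    intro r hr
    filter_upwards [hWm, G.opWmod_error hc hε hε₁ f (half_pos hr)] with m hm herr
    rw [dist_eq_norm]
    refine lt_of_le_of_lt (norm_spaceX_le (half_pos hr).le fun i s => ?_) (half_lt_self hr)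
    have := herr i s s.2
    rwa [← hm.1, ← hWf] at this
  have hkernel : ∀ (f g : spaceX) (φ : ℕ → ℕ), Tendsto φ atTop atTop →
      Tendsto (fun n => Sm (φ n) f) atTop (𝓝 g) → -(Real.pi • f) + W f + g = 0 → f = 0 := by
    intro f g φ hφ hg heq
    refine Subtype.ext (hker f f.2 fun i s hs => ?_)
    have h1 : Tendsto (fun n => Γ.opSm (φ n) (extendReal f) i s) atTop
        (𝓝 ((g : Fin 3 → C(unitInterval, ℝ)) i ⟨s, hs⟩)) := by
      refine (((continuous_eval_spaceX i ⟨s, hs⟩).tendsto g).comp hg).congr' ?_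
      filter_upwards [hφ.eventually hSm] with n hn
      exact hn.1 f i ⟨s, hs⟩
    have h2 := (Γ.tendsto_opSm hS (fun j => continuous_extendReal f j) i hs).comp hφ
    have h3 := tendsto_nhds_unique h1 h2
    have h4 := congrArg (fun x : spaceX => (x : Fin 3 → C(unitInterval, ℝ)) i ⟨s, hs⟩) heq
    change -(Real.pi * (f : Fin 3 → C(unitInterval, ℝ)) i ⟨s, hs⟩) +
      (W f : Fin 3 → C(unitInterval, ℝ)) i ⟨s, hs⟩ +
        (g : Fin 3 → C(unitInterval, ℝ)) i ⟨s, hs⟩ = 0 at h4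
    rw [hWf, h3, ← extendReal_of_mem] at h4
    rw [CornerDomain.Sections.opExact, neg_mul]
    exact h4
  obtain ⟨δ, hδ, hbelow⟩ := spaceX.eventually_bounded_below hq0 hqpi hWq
    (hWm.mono fun m hm => hm.2) hlim hK hSmK hkernel
  obtain ⟨m₀, hm₀⟩ := eventually_atTop.1 (((hbelow.and hWm).and (hSm.and hSmK)).and
    (eventually_ge_atTop 1))
  refine ⟨m₀, (Real.pi + q + C) * δ⁻¹, fun m hm => ?_⟩
  obtain ⟨⟨⟨hb, hWf', hWn'⟩, ⟨hSf, hSn⟩, hSK'⟩, hm1⟩ := hm₀ m hm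
  obtain ⟨T, hT, hTsymm⟩ := spaceX.exists_equiv_of_bounded_below hq0 hqpi hWn' hK hSK' hδ hb
  have hTf : ∀ (ρ : spaceX) (i : Fin 3) (s : unitInterval),
      (T ρ : Fin 3 → C(unitInterval, ℝ)) i s = Γ.opNystrom c ε m (extendReal ρ) i s := by
    intro ρ i s
    rw [hT]
    change -(Real.pi * (ρ : Fin 3 → C(unitInterval, ℝ)) i s) +
      (Wm m ρ : Fin 3 → C(unitInterval, ℝ)) i s + (Sm m ρ : Fin 3 → C(unitInterval, ℝ)) i s = _
    rw [hWf', hSf, CornerDomain.Sections.opNystrom, extendReal_coe, neg_mul]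
  obtain ⟨A, hA, hcond⟩ := Γ.exists_matrix_equiv hc hm1 hTf
  refine ⟨T, A, hTf, hA, hcond, condNumber_le_mul (by positivity) (by positivity) (fun f => ?_)
    hTsymm⟩
  rw [hT]
  calc ‖-(Real.pi • f) + Wm m f + Sm m f‖ ≤ Real.pi * ‖f‖ + ‖Wm m f‖ + ‖Sm m f‖ :=
        spaceX.norm_neg_smul_add_add_le hpi.le f _ _
    _ ≤ Real.pi * ‖f‖ + q * ‖f‖ + C * ‖f‖ := add_le_add (add_le_add le_rfl (hWn' f)) (hSn f)
    _ = (Real.pi + q + C) * ‖f‖ := by ring
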